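/- Let $\Omega\subset\mathbb R^2$ be a bounded polygonal domain with Lipschitz boundary (the statement below is asserted, more generally, for every nonempty bounded open set $\Omega\subset\mathbb R^2$), let $0<\alpha<1$ and $T>0$. Let $\|\cdot\|$ be the norm of $L^2(\Omega)$, $V=H^2_0(\Omega)$ (the closure of $C_c^\infty(\Omega)$ in $H^2(\Omega)$), $V^*$ its dual (with $V\subset L^2(\Omega)\subset V^*$), $a(v,w)=\int_\Omega D^2v:D^2w\,dx$, and let $A$ be the operator $A\varphi=\Delta^2\varphi$ with domain $D(A)=\{\varphi\in V:\Delta^2\varphi\in L^2(\Omega)\}$. There is an orthonormal basis $(\varphi_j)_{j\ge1}$ of $L^2(\Omega)$ with $A\varphi_j=\mu_j\varphi_j$, $0<\mu_1\le\mu_2\le\dots$, $\mu_j\to\infty$. For any such basis and $p\ge 0$ let $D(A^p)$ be the set of those $v\in L^2(\Omega)$ for which $\|v\|_{D(A^p)}=\big(\sum_j\mu_j^{2p}|(v,\varphi_j)|^2\big)^{1/2}$ is finite. For $u_0\in L^2(\Omega)$, a weak solution of $\partial_t^\alpha u+Au=0$ on $(0,T]$, $u(0)=u_0$, is a $u\in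 L^1(0,T;V)\cap W^{1,1}(0,T;V^*)$ (taken as an absolutely continuous function $[0,T]\to V^*$) such that, for all $v\in V$, $\partial_t^\alpha\langle u(t),v\rangle+a(u(t),v)=0$ in $L^1(0,T)$, and $\lim_{t\to0}\|u(t)-u_0\|_{V^*}=0$. Here $\partial_t^\alpha u(t)=\frac1{\Gamma(1-\alpha)}\int_0^t(t-s)^{-\alpha}u'(s)\,ds$ is the Caputo derivative; for the $V^*$-valued function $u$ the integral is taken in $V^*$. There is a constant $C>0$ that depends only on $\alpha$ and $T$ such that the following holds for every such $\Omega$, every $u_0\in L^2(\Omega)$ and every weak solution $u$. For each $t\in[0,T]$ one has $u(t)\in L^2(\Omega)$; on $(0,T]$ the function $u$ is twice differentiable with values in $L^2(\Omega)$ (at $t=T$ from the left); for each $t\in(0,T]$ the integral that defines $\partial_t^\alpha u(t)$ converges in $V^*$, and $\partial_t^\alpha u(t)\in L^2(\Omega)$. Moreover: (i) For all $t\in(0,T]$, $i\in\{0,1\}$ and $0\le p\le1$, $$u^{(i)}(t)\in D(A^p),\qquad \|u^{(i)}(t)\|_{D(A^p)}\le C\,t^{-(i+\alpha p)}\|u_0\|,$$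 $$\|u''(t)\|\le C\,t^{-2}\|u_0\|,\qquad \|\partial_t^\alpha u(t)\|\le C\,t^{-\alpha}\|u_0\|.$$ In addition, $u\in C([0,T];L^2(\Omega))$ and $\max_{t\in[0,T]}\|u(t)\|\le C\|u_0\|$. (ii) If $u_0\in D(A)$, then for all $t\in(0,T]$ and $0\le p\le1$, $$\|u(t)\|_{D(A)}\le C\|u_0\|_{D(A)},\qquad \|u'(t)\|_{D(A^p)}\le C\,t^{-(1+\alpha(p-1))}\|u_0\|_{D(A)},$$ $$\|u''(t)\|\le C\,t^{\alpha-2}\|u_0\|_{D(A)},\qquad \|\partial_t^\alpha u(t)\|\le C\,\|u_0\|_{D(A)},$$ where $u(t)\in D(A)$ and $u'(t)\in D(A^p)$. Furthermore, $u\in C([0,T];D(A))$ and $\max_{t\in[0,T]}\|u(t)\|_{D(A)}\le C\|u_0\|_{D(A)}$. -/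

import Mathlib

open Set Filter Topology MeasureTheory
open scoped RealInnerProductSpace Laplacian

noncomputable section

namespace FracBiharmonic

/-- The plane `ℝ²`. -/
abbrev Plane : Type := EuclideanSpace ℝ (Fin 2)

/-- The partial derivative `∂f/∂xᵢ`. -/
def pd (i : Fin 2) (f : Plane → ℝ) : Plane → ℝ :=
  fun x => fderiv ℝ f x (EuclideanSpace.single i 1)

/-- `D(Ω)`: smooth real functions with compact support contained in `Ω`. -/
structure IsTest (Ω : Set Plane) (ψ : Plane → ℝ) : Prop where
  smooth : ContDiff ℝ ((⊤ : ℕ∞) : WithTop ℕ∞) ψ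
  compact : HasCompactSupport ψ
  supp : tsupport ψ ⊆ Ω

/-- `L²(Ω)`. -/
abbrev L2 (Ω : Set Plane) : Type := Lp ℝ 2 (volume.restrict Ω)

/-- Labels of the derivatives of order at most two: the function itself, `∂ᵢ`, and `∂ᵢ∂ⱼ`. -/
abbrev JetIdx : Type := Unit ⊕ (Fin 2 ⊕ (Fin 2 × Fin 2))

/-- Families `(v, (∂ᵢv)ᵢ, (∂ᵢ∂ⱼv)ᵢⱼ)` of `L²(Ω)` functions, with the Hilbert norm whose square is
the sum of the squares of the `L²` norms of all entries: on the jet of `v` it is `‖v‖_{H²(Ω)}`. -/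
abbrev Jet (Ω : Set Plane) : Type := PiLp 2 (fun _ : JetIdx => L2 Ω)

/-- The jet of second order `J` consists of the classical derivatives of `ψ` on `Ω`. -/
def IsJetOf (Ω : Set Plane) (J : Jet Ω) (ψ : Plane → ℝ) : Prop :=
  (J (Sum.inl ()) =ᵐ[volume.restrict Ω] ψ) ∧
  (∀ i, J (Sum.inr (Sum.inl i)) =ᵐ[volume.restrict Ω] pd i ψ) ∧
  (∀ i j, J (Sum.inr (Sum.inr (i, j))) =ᵐ[volume.restrict Ω] pd i (pd j ψ))

/-- `H²₀(Ω)`, the closure of `D(Ω)` in `H²(Ω)`. An element is stored together with its weak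
derivatives of order one and two, so that the norm of this space is the norm of `H²(Ω)`. -/
def H20 (Ω : Set Plane) : Submodule ℝ (Jet Ω) :=
  (Submodule.span ℝ {J : Jet Ω | ∃ ψ, IsTest Ω ψ ∧ IsJetOf Ω J ψ}).topologicalClosure

/-- The space `V = H²₀(Ω)` with the inner product of `H²(Ω)`. -/
def V (Ω : Set Plane) : Type := H20 Ω

instance (Ω : Set Plane) : NormedAddCommGroup (V Ω) := inferInstanceAs (NormedAddCommGroup (H20 Ω))

instance (Ω : Set Plane) : InnerProductSpace ℝ (V Ω) :=
  inferInstanceAs (InnerProductSpace ℝ (H20 Ω))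

instance (Ω : Set Plane) : CompleteSpace (V Ω) :=
  (Submodule.isClosed_topologicalClosure _).completeSpace_coe

/-- The jet of an element of `V`. -/
def V.jet (Ω : Set Plane) : V Ω →L[ℝ] Jet Ω := (H20 Ω).subtypeL

/-- The dual space `V*`. -/
abbrev VDual (Ω : Set Plane) : Type := StrongDual ℝ (V Ω)

/-- The inclusion of `V` in `L²(Ω)`. -/
def toL2 (Ω : Set Plane) : V Ω →L[ℝ] L2 Ω :=
  (PiLp.proj 2 (fun _ : JetIdx => L2 Ω) (Sum.inl ())).comp (V.jet Ω)

/-- The weak second derivative `∂ᵢ∂ⱼv` of `v ∈ V`. -/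
def hess {Ω : Set Plane} (v : V Ω) (i j : Fin 2) : L2 Ω := V.jet Ω v (Sum.inr (Sum.inr (i, j)))

/-- The bilinear form `a(v, w) = ∫_Ω D²v : D²w`. -/
def aForm {Ω : Set Plane} (v w : V Ω) : ℝ := ∑ i, ∑ j, ⟪hess v i j, hess w i j⟫

/-- The inclusion `L²(Ω) ⊂ V*`, `⟨f, v⟩ = (f, v)`. -/
def embDual (Ω : Set Plane) (f : L2 Ω) : VDual Ω := (innerSL ℝ f).comp (toL2 Ω)

/-- `Δ²f = g` on `Ω` in the sense of distributions. -/
def IsBilaplacian {Ω : Set Plane} (f g : L2 Ω) : Prop :=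
  ∀ ψ : Plane → ℝ, IsTest Ω ψ → ∫ x in Ω, f x * Δ (Δ ψ) x = ∫ x in Ω, g x * ψ x

/-- The graph of `A`: `f ∈ H²₀(Ω)`, `Δ²f ∈ L²(Ω)` and `A f = Δ²f = g`. -/
def IsA {Ω : Set Plane} (f g : L2 Ω) : Prop :=
  (∃ v : V Ω, toL2 Ω v = f) ∧ IsBilaplacian f g

/-- `f ∈ D(A) = {f ∈ H²₀(Ω) | Δ²f ∈ L²(Ω)}`. -/
def MemDomA {Ω : Set Plane} (f : L2 Ω) : Prop := ∃ g : L2 Ω, IsA f g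

/-- An orthonormal basis of `L²(Ω)` that consists of eigenfunctions of `A`, with
`0 < μ₀ ≤ μ₁ ≤ …` and `μⱼ → ∞`. -/
structure IsEigensystem (Ω : Set Plane) (φ : HilbertBasis ℕ ℝ (L2 Ω)) (μ : ℕ → ℝ) : Prop where
  pos : ∀ j, 0 < μ j
  mono : Monotone μ
  unbounded : Tendsto μ atTop atTop
  eigen : ∀ j, IsA (φ j) (μ j • φ j)

/-- `v ∈ D(A^p)`, that is `∑ⱼ μⱼ^{2p} |(v, φⱼ)|² < ∞`. -/
def MemDomPow {Ω : Set Plane} (φ : HilbertBasis ℕ ℝ (L2 Ω)) (μ : ℕ → ℝ) (p : ℝ) (v : L2 Ω) :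
    Prop :=
  Summable fun j => μ j ^ (2 * p) * |⟪v, φ j⟫| ^ 2

/-- The norm `‖v‖_{D(A^p)} = (∑ⱼ μⱼ^{2p} |(v, φⱼ)|²)^{1/2}`, meaningful for `v ∈ D(A^p)`. -/
def normPow {Ω : Set Plane} (φ : HilbertBasis ℕ ℝ (L2 Ω)) (μ : ℕ → ℝ) (p : ℝ) (v : L2 Ω) : ℝ :=
  Real.sqrt (∑' j, μ j ^ (2 * p) * |⟪v, φ j⟫| ^ 2)

section Time

variable {X : Type*} [NormedAddCommGroup X] [NormedSpace ℝ X]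

/-- The kernel `κ_β(t) = t^{β-1} / Γ(β)`. -/
def kappa (β t : ℝ) : ℝ := t ^ (β - 1) / Real.Gamma β

/-- The Riemann-Liouville integral `I^β v(t) = ∫₀ᵗ κ_β(t-s) v(s) ds`. -/
def rlIntegral (β : ℝ) (v : ℝ → X) (t : ℝ) : X := ∫ s in (0 : ℝ)..t, kappa β (t - s) • v s

/-- The Caputo derivative `∂ₜ^α u(t) = I^{1-α} u'(t)` of an absolutely continuous function. -/
def caputo (α : ℝ) (u : ℝ → X) (t : ℝ) : X := rlIntegral (1 - α) (deriv u) t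

/-- `u ∈ W^{1,1}(0,T;X)`, for the absolutely continuous representative on `[0,T]`:
`u` is the indefinite integral of some `g ∈ L¹(0,T;X)`, which is then its weak derivative. -/
def MemW11 (T : ℝ) (u : ℝ → X) : Prop :=
  ∃ g : ℝ → X, IntegrableOn g (Ioo 0 T) ∧ ∀ t ∈ Icc 0 T, u t = u 0 + ∫ s in (0 : ℝ)..t, g s

end Time

/-- `u` is a weak solution on `[0,T]` of `∂ₜ^α u + A u = 0`, `u(0) = u₀`. A weak solution belongs to
`W^{1,1}(0,T;V*)`, so it has a value in `V*` at every time of `[0,T]`; almost every value lies in `V`,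
and as a `V`-valued function (called `w` here) it belongs to `L¹(0,T;V)`. -/
structure IsWeakSolution (Ω : Set Plane) (α T : ℝ) (u₀ : L2 Ω) (u : ℝ → VDual Ω) : Prop where
  memW11 : MemW11 T u
  equation : ∃ w : ℝ → V Ω, IntegrableOn w (Ioo 0 T) ∧
    (∀ᵐ t ∂volume.restrict (Ioo 0 T), u t = embDual Ω (toL2 Ω (w t))) ∧
    ∀ v : V Ω, ∀ᵐ t ∂volume.restrict (Ioo 0 T),
      caputo α (fun s => u s v) t + aForm (w t) v = 0
  initial : Tendsto (fun t => ‖u t - embDual Ω u₀‖) (𝓝[>] 0) (𝓝 0)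

end FracBiharmonic

end

open FracBiharmonic

/-!
# Regularity of the fractional biharmonic equation

The operator `A` is inverted by the variational theory of `a` on `V = H²₀(Ω)`: the form is coercive
by Poincaré's inequality (`exists_norm_sq_le_aForm`), so `Δ²v = f` has a bounded solution operator.
Its composition with the inclusion of `V` in `L²(Ω)` is symmetric, positive definite and compact, and
the spectral theorem (`exists_hilbertBasis_eigenvectors`) gives the eigenfunctions
(`exists_isEigensystem`). Compactness (`isCompactOperator_toL2`) holds without regularity of `Ω`: a
function of `H²₀(Ω)` is the integral of its mixed second derivative over quadrants, and the
indicators of the quadrants with corner in `Ω` form a relatively compact set in `L²(Ω)`.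

Testing a weak solution with an eigenfunction gives the scalar equation `∂ₜ^α y + μ y = 0`. By
`I^α I^{1-α} = I^1` it implies a Volterra equation, whose solution is unique; hence
`y(t) = y(0) E_α(-μ t^α)` (`eq_mode_of_equation`). Since the eigenfunctions are total in `V`, the weak
solution is `u(t) = ∑ⱼ E_α(-μⱼ t^α) (u₀, φⱼ) φⱼ` (`IsWeakSolution.eq_flow`). All assertions are then
statements about this series, and the estimates follow coefficient by coefficient from bounds of
`E_α(-μ t^α)` and its derivatives that are uniform in `μ`. For example
`μ^p |E_α(-μ t^α)| ≤ C t^{-αp}` interpolates between the bounds `C` and `C / (μ t^α)`.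

The Mittag-Leffler function `E_α(-t^α)` is *defined* by its spectral representation, as the Laplace
transform of an explicit positive density (`ml`). In this form the sign, the smoothness on `(0, ∞)`
and the decay of the function and its derivatives are evident, and no power series or asymptotic
expansion is needed. What has to be shown is that this function solves `∂ₜ^α e + e = 0`, `e(0) = 1`
(`rlIntegral_ml_one`, `ml_zero_zero`). Both follow from the Stieltjes transform of the density,
which Cauchy's theorem on a rectangle evaluates to `z^α / (z^α + 1)`
(`integral_density_mul_logistic`): the Laplace transforms of both sides of the equation then agree
on the line `Re z = 1`, and a nonnegative function is determined by these values because
characteristic functions determine finite measures (`ae_eq_of_laplace_eq`).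
-/

noncomputable section

namespace MittagLeffler

section

/-! ### The spectral density of the Mittag-Leffler function -/

/-- The spectral density of `t ↦ E_α(-t^α)` in the logarithmic variable: with `r = eˣ`,
`E_α(-t^α) = ∫ exp(-t eˣ) density α x dx`. -/
def density (α x : ℝ) : ℝ :=
  Real.sin (Real.pi * α) / Real.pi * (Real.exp (α * x) /
    ((Real.exp (α * x) + Real.cos (Real.pi * α)) ^ 2 + Real.sin (Real.pi * α) ^ 2))

/-- The functions `t ↦ ∫ exp(k x) exp(-t eˣ) density α x dx`. For `k = 0` this is the
Mittag-Leffler function `E_α(-t^α)`, and `(-1)^k ml α k` is its `k`-th derivative. -/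
def ml (α : ℝ) (k : ℕ) (t : ℝ) : ℝ :=
  ∫ x : ℝ, density α x * (Real.exp (k * x) * Real.exp (-(t * Real.exp x)))

variable {α : ℝ}

lemma sin_pos (h0 : 0 < α) (h1 : α < 1) : 0 < Real.sin (Real.pi * α) :=
  Real.sin_pos_of_pos_of_lt_pi (by positivity) (by nlinarith [Real.pi_pos])

lemma density_pos (h0 : 0 < α) (h1 : α < 1) (x : ℝ) : 0 < density α x := by
  have := sin_pos h0 h1
  unfold density
  positivity

lemma continuous_density (h0 : 0 < α) (h1 : α < 1) : Continuous (density α) := by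
  have := sin_pos h0 h1
  unfold density
  refine continuous_const.mul (Continuous.div (by fun_prop) (by fun_prop) fun x => ?_)
  positivity

/-- The constant in the exponential bounds of the density. -/
def densConst (α : ℝ) : ℝ := 1 / (Real.pi * Real.sin (Real.pi * α))

lemma densConst_pos (h0 : 0 < α) (h1 : α < 1) : 0 < densConst α := by
  have := sin_pos h0 h1
  have := Real.pi_pos
  unfold densConst
  positivity

lemma density_le_exp (h0 : 0 < α) (h1 : α < 1) (x : ℝ) :
    density α x ≤ densConst α * Real.exp (α * x) := by
  have hs := sin_pos h0 h1
  have hp := Real.pi_pos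
  unfold density densConst
  set y := Real.exp (α * x)
  have hy : 0 < y := Real.exp_pos _
  have hD : Real.sin (Real.pi * α) ^ 2 ≤
      (y + Real.cos (Real.pi * α)) ^ 2 + Real.sin (Real.pi * α) ^ 2 :=
    le_add_of_nonneg_left (sq_nonneg _)
  calc _ ≤ Real.sin (Real.pi * α) / Real.pi * (y / Real.sin (Real.pi * α) ^ 2) := by gcongr
    _ = _ := by field_simp

lemma density_le_exp_neg (h0 : 0 < α) (h1 : α < 1) (x : ℝ) :
    density α x ≤ densConst α * Real.exp (-(α * x)) := by
  have hs := sin_pos h0 h1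
  have hp := Real.pi_pos
  unfold density densConst
  rw [Real.exp_neg]
  set y := Real.exp (α * x)
  have hy : 0 < y := Real.exp_pos _
  have hD : (Real.sin (Real.pi * α) * y) ^ 2 ≤
    (y + Real.cos (Real.pi * α)) ^ 2 + Real.sin (Real.pi * α) ^ 2 := by
    have h := Real.sin_sq_add_cos_sq (Real.pi * α)
    -- `|y + exp(iπα)|² = |1 + y exp(iπα)|²`
    have h2 : (y + Real.cos (Real.pi * α)) ^ 2 + Real.sin (Real.pi * α) ^ 2 =
        (1 + y * Real.cos (Real.pi * α)) ^ 2 + (Real.sin (Real.pi * α) * y) ^ 2 := by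
      linear_combination (1 - y ^ 2) * h
    rw [h2]
    exact le_add_of_nonneg_left (sq_nonneg _)
  calc _ ≤ Real.sin (Real.pi * α) / Real.pi * (y / (Real.sin (Real.pi * α) * y) ^ 2) := by gcongr
    _ = _ := by field_simp

/-- A continuous function that decays exponentially at both ends is integrable. -/
lemma integrable_of_exp_bounds {f : ℝ → ℝ} (hf : Continuous f) {a b A B : ℝ} (ha : 0 < a)
    (hb : 0 < b) (h1 : ∀ x, ‖f x‖ ≤ A * Real.exp (a * x))
    (h2 : ∀ x, ‖f x‖ ≤ B * Real.exp (-b * x)) : Integrable f := by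
  rw [← integrableOn_univ, ← Iic_union_Ioi (a := (0 : ℝ))]
  refine IntegrableOn.union ?_ ?_
  · exact ((integrableOn_exp_mul_Iic ha 0).const_mul A).mono' hf.aestronglyMeasurable
      (Eventually.of_forall h1)
  · exact ((integrableOn_exp_mul_Ioi (neg_lt_zero.2 hb) 0).const_mul B).mono'
      hf.aestronglyMeasurable (Eventually.of_forall h2)

lemma integrable_density (h0 : 0 < α) (h1 : α < 1) : Integrable (density α) := by
  refine integrable_of_exp_bounds (continuous_density h0 h1) h0 h0 (A := densConst α)
    (B := densConst α) (fun x => ?_) (fun x => ?_)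
  · rw [Real.norm_of_nonneg (density_pos h0 h1 x).le]; exact density_le_exp h0 h1 x
  · rw [Real.norm_of_nonneg (density_pos h0 h1 x).le, neg_mul]; exact density_le_exp_neg h0 h1 x

/-! ### Power-type bounds -/

lemma exp_neg_le_inv_pow (n : ℕ) {y : ℝ} (hy : 0 < y) : Real.exp (-y) ≤ n.factorial * (y ^ n)⁻¹ := by
  have := Real.pow_div_factorial_le_exp y hy.le n
  rw [Real.exp_neg, ← div_eq_mul_inv]
  rw [inv_le_comm₀ (Real.exp_pos _) (by positivity), inv_div]
  exact this

lemma integrable_exp_mul_exp_neg_exp {β : ℝ} (hβ : 0 < β) {t : ℝ} (ht : 0 < t) :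
    Integrable fun x : ℝ => Real.exp (β * x) * Real.exp (-(t * Real.exp x)) := by
  obtain ⟨n, hn⟩ := exists_nat_gt β
  refine integrable_of_exp_bounds (by fun_prop) hβ (sub_pos.2 hn) (A := 1)
    (B := n.factorial * (t ^ n)⁻¹) (fun x => ?_) (fun x => ?_)
  · rw [Real.norm_of_nonneg (by positivity), one_mul]
    exact mul_le_of_le_one_right (by positivity) (Real.exp_le_one_iff.2 (by
      have := Real.exp_pos x
      nlinarith))
  · rw [Real.norm_of_nonneg (by positivity)]
    have h := exp_neg_le_inv_pow n (y := t * Real.exp x) (by positivity)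
    calc _ ≤ Real.exp (β * x) * (n.factorial * ((t * Real.exp x) ^ n)⁻¹) := by gcongr
      _ = n.factorial * (t ^ n)⁻¹ * (Real.exp (β * x) * Real.exp (-(n * x))) := by
        rw [mul_pow, ← Real.exp_nat_mul, Real.exp_neg, mul_inv]; ring
      _ = _ := by rw [← Real.exp_add]; ring_nf

/-- The constant `∫ exp(β x) exp(-eˣ) dx`, which is `Γ(β)` for `β > 0`. -/
def expConst (β : ℝ) : ℝ := ∫ x : ℝ, Real.exp (β * x) * Real.exp (-(1 * Real.exp x))

lemma expConst_nonneg (β : ℝ) : 0 ≤ expConst β :=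
  integral_nonneg fun x => by positivity

/-- Translating `x` by `log t` removes the parameter `t`. -/
lemma integral_exp_mul_exp_neg_exp (β : ℝ) {t : ℝ} (ht : 0 < t) :
    ∫ x : ℝ, Real.exp (β * x) * Real.exp (-(t * Real.exp x)) = t ^ (-β) * expConst β := by
  rw [expConst, ← integral_const_mul,
    ← integral_add_right_eq_self _ (-Real.log t)]
  congr 1
  ext x
  have h1 : t * Real.exp (x + -Real.log t) = 1 * Real.exp x := by
    rw [Real.exp_add, Real.exp_neg, Real.exp_log ht]; field_simp
  have h2 : Real.exp (β * (x + -Real.log t)) = t ^ (-β) * Real.exp (β * x) := by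
    rw [Real.rpow_def_of_pos ht, ← Real.exp_add]; ring_nf
  rw [h1, h2, mul_assoc]

lemma integrable_ml (h0 : 0 < α) (h1 : α < 1) (k : ℕ) {t : ℝ} (ht : 0 < t) :
    Integrable fun x : ℝ => density α x * (Real.exp (k * x) * Real.exp (-(t * Real.exp x))) := by
  have hβ : 0 < k + α := by positivity
  refine ((integrable_exp_mul_exp_neg_exp hβ ht).const_mul (densConst α)).mono'
    ((continuous_density h0 h1).mul (by fun_prop)).aestronglyMeasurable
    (Eventually.of_forall fun x => ?_)
  have := density_pos h0 h1 x
  rw [Real.norm_of_nonneg (by positivity), add_mul, Real.exp_add]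
  have := density_le_exp h0 h1 x
  calc _ ≤ (densConst α * Real.exp (α * x)) * (Real.exp (k * x) * Real.exp (-(t * Real.exp x))) := by
        gcongr
    _ = _ := by ring

lemma ml_nonneg (h0 : 0 < α) (h1 : α < 1) (k : ℕ) (t : ℝ) : 0 ≤ ml α k t :=
  integral_nonneg fun x => by have := density_pos h0 h1 x; positivity

lemma ml_le_of_density_le (h0 : 0 < α) (h1 : α < 1) (k : ℕ) {t γ : ℝ} (ht : 0 < t)
    (hk : 0 < k + γ) (hγ : ∀ x, density α x ≤ densConst α * Real.exp (γ * x)) :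
    ml α k t ≤ densConst α * expConst (k + γ) * t ^ (-(k + γ)) := by
  rw [mul_assoc, mul_comm (expConst _), ← integral_exp_mul_exp_neg_exp _ ht, ← integral_const_mul]
  refine integral_mono (integrable_ml h0 h1 k ht)
    ((integrable_exp_mul_exp_neg_exp hk ht).const_mul _) fun x => ?_
  simp only [add_mul, Real.exp_add]
  calc _ ≤ (densConst α * Real.exp (γ * x)) * (Real.exp (k * x) * Real.exp (-(t * Real.exp x))) := by
        gcongr; exact hγ x
    _ = _ := by ring

/-- Algebraic decay at infinity, from the decay of the density at `-∞`. -/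
lemma ml_le_large (h0 : 0 < α) (h1 : α < 1) (k : ℕ) {t : ℝ} (ht : 0 < t) :
    ml α k t ≤ densConst α * expConst (k + α) * t ^ (-(k + α)) :=
  ml_le_of_density_le h0 h1 k ht (by positivity) (density_le_exp h0 h1)

/-- The singularity at zero, from the decay of the density at `+∞`. -/
lemma ml_le_small (h0 : 0 < α) (h1 : α < 1) {k : ℕ} (hk : 1 ≤ k) {t : ℝ} (ht : 0 < t) :
    ml α k t ≤ densConst α * expConst (k - α) * t ^ (-(k - α)) := by
  have : (1 : ℝ) ≤ k := by exact_mod_cast hk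
  exact ml_le_of_density_le h0 h1 k ht (γ := -α) (by linarith)
    (fun x => by rw [neg_mul]; exact density_le_exp_neg h0 h1 x)

/-! ### Derivatives -/

lemma hasDerivAt_ml (h0 : 0 < α) (h1 : α < 1) (k : ℕ) {t : ℝ} (ht : 0 < t) :
    HasDerivAt (ml α k) (-ml α (k + 1) t) t := by
  have hs : Ioi (t / 2) ∈ 𝓝 t := Ioi_mem_nhds (by linarith)
  have key := hasDerivAt_integral_of_dominated_loc_of_deriv_le (μ := volume) (𝕜 := ℝ)
    (F := fun t x => density α x * (Real.exp (k * x) * Real.exp (-(t * Real.exp x))))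
    (F' := fun t x => -(density α x * (Real.exp ((k + 1 : ℕ) * x) * Real.exp (-(t * Real.exp x)))))
    (bound := fun x => density α x * (Real.exp ((k + 1 : ℕ) * x) *
      Real.exp (-(t / 2 * Real.exp x)))) (x₀ := t) hs ?_ ?_ ?_ ?_ ?_ ?_
  · have h := key.2
    rw [integral_neg] at h
    exact h
  · exact Eventually.of_forall fun s =>
      ((continuous_density h0 h1).mul (by fun_prop)).aestronglyMeasurable
  · exact integrable_ml h0 h1 k ht
  · exact ((continuous_density h0 h1).mul (by fun_prop)).neg.aestronglyMeasurable
  · refine Eventually.of_forall fun x s hs => ?_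
    have := density_pos h0 h1 x
    rw [norm_neg, Real.norm_of_nonneg (by positivity)]
    have : t / 2 ≤ s := (mem_Ioi.1 hs).le
    gcongr
  · exact integrable_ml h0 h1 (k + 1) (by linarith)
  · refine Eventually.of_forall fun x s _ => ?_
    have h : HasDerivAt (fun s => -(s * Real.exp x)) (-(1 * Real.exp x)) s :=
      ((hasDerivAt_id s).mul_const _).neg
    refine ((h.exp.const_mul (Real.exp (k * x))).const_mul (density α x)).congr_deriv ?_
    push_cast
    rw [add_mul, Real.exp_add]
    ring_nf

lemma continuousOn_ml (h0 : 0 < α) (h1 : α < 1) (k : ℕ) : ContinuousOn (ml α k) (Ioi 0) :=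
  fun _ ht => (hasDerivAt_ml h0 h1 k ht).continuousAt.continuousWithinAt

lemma continuousOn_ml_zero (h0 : 0 < α) (h1 : α < 1) : ContinuousOn (ml α 0) (Ici 0) := by
  refine continuousOn_of_dominated (bound := density α) (fun t ht =>
    ((continuous_density h0 h1).mul (by fun_prop)).aestronglyMeasurable) (fun t ht => ?_)
    (integrable_density h0 h1) (Eventually.of_forall fun x => by fun_prop)
  refine Eventually.of_forall fun x => ?_
  have := density_pos h0 h1 x
  rw [Real.norm_of_nonneg (by positivity)]
  refine mul_le_of_le_one_right this.le ?_
  have : 0 ≤ t * Real.exp x := mul_nonneg ht (Real.exp_pos x).le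
  simpa using this

end

section

variable {α : ℝ}

/-! ### The Stieltjes transform of the density, by Cauchy's theorem -/

lemma exp_add_one_ne_zero {w : ℂ} (h : |w.im| < Real.pi) : Complex.exp w + 1 ≠ 0 := by
  intro h1
  have h2 : Complex.exp (w + Real.pi * Complex.I) = 1 := by
    rw [Complex.exp_add, Complex.exp_pi_mul_I]; linear_combination -h1
  obtain ⟨n, hn⟩ := Complex.exp_eq_one_iff.1 h2
  have h3 : w.im + Real.pi = n * (2 * Real.pi) := by
    have := congrArg Complex.im hn
    simpa using this
  have hp := Real.pi_pos
  rw [abs_lt] at h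
  have h4 : (0 : ℝ) < n := by
    by_contra! h0
    nlinarith
  have h5 : (n : ℝ) < 1 := by
    by_contra! h0
    nlinarith
  have h6 : 0 < n := by exact_mod_cast h4
  have h7 : n < 1 := by exact_mod_cast h5
  omega

lemma eq_zero_of_exp_eq_one {w : ℂ} (h : |w.im| < 2 * Real.pi) (h1 : Complex.exp w = 1) :
    w = 0 := by
  obtain ⟨n, hn⟩ := Complex.exp_eq_one_iff.1 h1
  have h3 : w.im = n * (2 * Real.pi) := by
    have := congrArg Complex.im hn
    simpa using this
  have hp := Real.pi_pos
  rw [abs_lt] at h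
  have h4 : (-1 : ℝ) < n := by
    by_contra! h0
    nlinarith
  have h5 : (n : ℝ) < 1 := by
    by_contra! h0
    nlinarith
  have h6 : -1 < n := by exact_mod_cast h4
  have h7 : n < 1 := by exact_mod_cast h5
  have : n = 0 := by omega
  simpa [this] using hn

/-- The function `z^α / (z^α + 1)` in the logarithmic variable `z = e^ξ`. -/
def logisticPow (α : ℝ) (ξ : ℂ) : ℂ := Complex.exp (α * ξ) / (Complex.exp (α * ξ) + 1)

lemma logisticPow_denom (h0 : 0 < α) (h1 : α < 1) {ξ : ℂ} (h : |ξ.im| ≤ Real.pi) :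
    Complex.exp (α * ξ) + 1 ≠ 0 := by
  apply exp_add_one_ne_zero
  have : ((α : ℂ) * ξ).im = α * ξ.im := by simp
  rw [this, abs_mul, abs_of_pos h0]
  nlinarith [Real.pi_pos, abs_nonneg ξ.im]

/-- The quotient `(Φ(ξ) - Φ(a)) / (e^{ξ-a} - 1)` for `Φ = logisticPow α`, with its removable
singularity at `ξ = a` filled in. -/
def contourFun (α : ℝ) (a ξ : ℂ) : ℂ :=
  dslope (logisticPow α) a ξ / dslope (fun w => Complex.exp (w - a)) a ξ

lemma contourFun_of_ne {a ξ : ℂ} (h : ξ ≠ a) :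
    contourFun α a ξ = (logisticPow α ξ - logisticPow α a) / (Complex.exp (ξ - a) - 1) := by
  have : ξ - a ≠ 0 := sub_ne_zero.2 h
  rw [contourFun, dslope_of_ne _ h, dslope_of_ne _ h, slope_def_field, slope_def_field]
  simp only [sub_self, Complex.exp_zero]
  rw [div_div_div_cancel_right₀ this]

lemma differentiableAt_logisticPow (h0 : 0 < α) (h1 : α < 1) {ξ : ℂ} (h : |ξ.im| ≤ Real.pi) :
    DifferentiableAt ℂ (logisticPow α) ξ := by
  unfold logisticPow
  exact DifferentiableAt.div (by fun_prop) (by fun_prop) (logisticPow_denom h0 h1 h)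

lemma differentiableAt_dslope {f : ℂ → ℂ} {a ξ : ℂ} {s : Set ℂ} (hs : IsOpen s)
    (hf : DifferentiableOn ℂ f s) (ha : a ∈ s) (hξ : ξ = a ∨ DifferentiableAt ℂ f ξ) :
    DifferentiableAt ℂ (dslope f a) ξ := by
  by_cases h : ξ = a
  · subst h
    exact ((Complex.differentiableOn_dslope (hs.mem_nhds ha)).2 hf).differentiableAt
      (hs.mem_nhds ha)
  · exact (differentiableAt_dslope_of_ne h).2 (hξ.resolve_left h)

lemma differentiableAt_contourFun (h0 : 0 < α) (h1 : α < 1) {a ξ : ℂ} (ha : |a.im| < Real.pi)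
    (h : |ξ.im| ≤ Real.pi) : DifferentiableAt ℂ (contourFun α a) ξ := by
  have hs : IsOpen {w : ℂ | |w.im| < Real.pi} :=
    isOpen_lt (by fun_prop) continuous_const
  refine DifferentiableAt.div ?_ ?_ ?_
  · exact differentiableAt_dslope hs (fun w hw => (differentiableAt_logisticPow h0 h1
      (le_of_lt hw)).differentiableWithinAt) ha (Or.inr (differentiableAt_logisticPow h0 h1 h))
  · exact differentiableAt_dslope hs (by fun_prop) ha (Or.inr (by fun_prop))
  · by_cases hξ : ξ = a
    · subst hξ
      have : HasDerivAt (fun w => Complex.exp (w - ξ)) (Complex.exp (ξ - ξ) * 1) ξ :=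
        ((hasDerivAt_id ξ).sub_const ξ).cexp
      rw [dslope_same, this.deriv]
      simp
    · rw [dslope_of_ne _ hξ, slope_def_field]
      refine div_ne_zero (fun h2 => hξ ?_) (sub_ne_zero.2 hξ)
      have h3 : Complex.exp (ξ - a) = 1 := by simpa [sub_eq_zero] using h2
      refine sub_eq_zero.1 (eq_zero_of_exp_eq_one ?_ h3)
      rw [Complex.sub_im]
      calc _ ≤ |ξ.im| + |a.im| := abs_sub _ _
        _ < _ := by linarith

lemma norm_exp_mul (α : ℝ) (R y : ℝ) :
    ‖Complex.exp (α * (R + y * Complex.I))‖ = Real.exp (α * R) := by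
  rw [Complex.norm_exp]; simp

lemma norm_exp_sub (a : ℂ) (R y : ℝ) :
    ‖Complex.exp ((R + y * Complex.I) - a)‖ = Real.exp (R - a.re) := by
  rw [Complex.norm_exp]; simp

lemma norm_logisticPow_le_right {R y : ℝ} (hR : 1 < Real.exp (α * R)) :
    ‖logisticPow α (R + y * Complex.I)‖ ≤ Real.exp (α * R) / (Real.exp (α * R) - 1) := by
  rw [logisticPow, norm_div, norm_exp_mul]
  have := norm_sub_norm_le (Complex.exp (α * (R + y * Complex.I))) (-1)
  rw [norm_exp_mul, sub_neg_eq_add, norm_neg, norm_one] at this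
  have : 0 < Real.exp (α * R) - 1 := by linarith
  gcongr

lemma norm_logisticPow_le_left {R y : ℝ} (hR : Real.exp (α * R) < 1) :
    ‖logisticPow α (R + y * Complex.I)‖ ≤ Real.exp (α * R) / (1 - Real.exp (α * R)) := by
  rw [logisticPow, norm_div, norm_exp_mul]
  have := norm_sub_norm_le 1 (-Complex.exp (α * (R + y * Complex.I)))
  rw [norm_neg, norm_exp_mul, sub_neg_eq_add, norm_one, add_comm] at this
  have : 0 < 1 - Real.exp (α * R) := by linarith
  gcongr

lemma ne_of_re_ne {a : ℂ} {R y : ℝ} (h : R ≠ a.re) : (R + y * Complex.I : ℂ) ≠ a := by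
  intro h1
  apply h
  have := congrArg Complex.re h1
  simpa using this

/-- On the side `Re ξ = R` the numerator is bounded and the denominator grows like `e^R`. -/
lemma tendsto_integral_right (h0 : 0 < α) (a : ℂ) :
    Tendsto (fun R : ℝ => ∫ y : ℝ in -Real.pi..Real.pi, contourFun α a (R + y * Complex.I))
      atTop (𝓝 0) := by
  have hE : Tendsto (fun R : ℝ => Real.exp (α * R)) atTop atTop :=
    Real.tendsto_exp_atTop.comp (tendsto_id.const_mul_atTop h0)
  have hE2 : Tendsto (fun R : ℝ => Real.exp (R - a.re) - 1) atTop atTop :=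
    tendsto_atTop_add_const_right _ _ (Real.tendsto_exp_atTop.comp
      (tendsto_atTop_add_const_right _ _ tendsto_id))
  have hlim : Tendsto (fun R : ℝ => (2 + ‖logisticPow α a‖) / (Real.exp (R - a.re) - 1) *
      |Real.pi - (-Real.pi)|) atTop (𝓝 0) := by
    simpa using (hE2.const_div_atTop (2 + ‖logisticPow α a‖)).mul_const (|Real.pi - (-Real.pi)|)
  refine squeeze_zero_norm' ?_ hlim
  filter_upwards [hE.eventually_ge_atTop 2, eventually_gt_atTop a.re] with R hR hRa
  refine intervalIntegral.norm_integral_le_of_norm_le_const fun y _ => ?_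
  rw [contourFun_of_ne (ne_of_re_ne hRa.ne'), norm_div]
  have hb : 0 < Real.exp (R - a.re) - 1 := by
    have := Real.add_one_lt_exp (x := R - a.re) (by linarith)
    linarith
  have h2 := norm_sub_norm_le (Complex.exp ((R + y * Complex.I) - a)) 1
  rw [norm_exp_sub, norm_one] at h2
  have h3 : ‖logisticPow α (R + y * Complex.I)‖ ≤ 2 := by
    refine (norm_logisticPow_le_right (by linarith)).trans ?_
    rw [div_le_iff₀ (by linarith)]
    linarith
  have h4 := norm_sub_le (logisticPow α (R + y * Complex.I)) (logisticPow α a)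
  gcongr
  linarith

/-- On the side `Re ξ = -R` the integrand of the contour integral tends to
`(0 - Φ(a)) / (0 - 1) = Φ(a)`, where `Φ = logisticPow α`. -/
lemma tendsto_integral_left (h0 : 0 < α) (h1 : α < 1) {a : ℂ} (ha : |a.im| < Real.pi) :
    Tendsto (fun R : ℝ => ∫ y : ℝ in -Real.pi..Real.pi,
      contourFun α a ((-R : ℝ) + y * Complex.I)) atTop (𝓝 (2 * Real.pi * logisticPow α a)) := by
  have hE : Tendsto (fun R : ℝ => Real.exp (α * -R)) atTop (𝓝 0) :=
    Real.tendsto_exp_atBot.comp (tendsto_neg_atTop_atBot.const_mul_atBot h0)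
  have hE2 : Tendsto (fun R : ℝ => Real.exp (-R - a.re)) atTop (𝓝 0) :=
    Real.tendsto_exp_atBot.comp (tendsto_atBot_add_const_right _ _ tendsto_neg_atTop_atBot)
  have hlim : Tendsto (fun R : ℝ => (Real.exp (α * -R) / (1 - Real.exp (α * -R)) +
      ‖logisticPow α a‖ * Real.exp (-R - a.re)) / (1 - Real.exp (-R - a.re)) *
      |Real.pi - (-Real.pi)|) atTop (𝓝 0) := by
    have := (((hE.div (hE.const_sub 1) (by norm_num)).add
      (hE2.const_mul ‖logisticPow α a‖)).div (hE2.const_sub 1) (by norm_num)).mul_const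
      (|Real.pi - (-Real.pi)|)
    simpa using this
  rw [tendsto_iff_norm_sub_tendsto_zero]
  refine squeeze_zero' (Eventually.of_forall fun _ => norm_nonneg _) ?_ hlim
  filter_upwards [eventually_gt_atTop 0, eventually_gt_atTop (-a.re)] with R hR hRa
  have hR1 : Real.exp (α * -R) < 1 := by
    rw [Real.exp_lt_one_iff]; nlinarith
  have hR2 : Real.exp (-R - a.re) < 1 := by
    rw [Real.exp_lt_one_iff]; linarith
  have hne : ∀ y : ℝ, ((-R : ℝ) + y * Complex.I : ℂ) ≠ a := fun y => ne_of_re_ne (by linarith)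
  have hc : (2 * Real.pi * logisticPow α a : ℂ) =
      ∫ _y : ℝ in -Real.pi..Real.pi, logisticPow α a := by
    rw [intervalIntegral.integral_const, Complex.real_smul]; push_cast; ring
  rw [hc, ← intervalIntegral.integral_sub]
  · refine intervalIntegral.norm_integral_le_of_norm_le_const fun y _ => ?_
    have h2 := norm_sub_norm_le 1 (Complex.exp (((-R : ℝ) + y * Complex.I) - a))
    rw [norm_exp_sub, norm_one, norm_sub_rev] at h2
    have hb : 0 < 1 - Real.exp (-R - a.re) := by linarith
    have hb' : Complex.exp (((-R : ℝ) + y * Complex.I) - a) - 1 ≠ 0 := by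
      rw [← norm_pos_iff]; linarith
    have h5 : contourFun α a ((-R : ℝ) + y * Complex.I) - logisticPow α a =
        (logisticPow α ((-R : ℝ) + y * Complex.I) - logisticPow α a *
          Complex.exp (((-R : ℝ) + y * Complex.I) - a)) /
          (Complex.exp (((-R : ℝ) + y * Complex.I) - a) - 1) := by
      rw [contourFun_of_ne (hne y)]
      field_simp
      ring
    rw [h5, norm_div]
    have h3 := norm_logisticPow_le_left (y := y) hR1
    have h4 := norm_sub_le (logisticPow α ((-R : ℝ) + y * Complex.I)) (logisticPow α a *
          Complex.exp (((-R : ℝ) + y * Complex.I) - a))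
    rw [norm_mul, norm_exp_sub] at h4
    gcongr
    linarith
  · refine ContinuousOn.intervalIntegrable fun y hy => ?_
    have h6 : ContinuousAt (contourFun α a) ((-R : ℝ) + y * Complex.I) := by
      refine (differentiableAt_contourFun h0 h1 ha ?_).continuousAt
      rw [uIcc_of_le (by linarith [Real.pi_pos])] at hy
      simpa [abs_le] using hy
    exact (ContinuousAt.comp (f := fun y : ℝ => ((-R : ℝ) + y * Complex.I : ℂ)) h6
      (by fun_prop)).continuousWithinAt
  · exact intervalIntegrable_const

/-- The density is the jump of `logisticPow` across the cut of `z ↦ z^α`, up to the factor `2πi`. -/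
lemma density_eq_jump (h0 : 0 < α) (h1 : α < 1) (x : ℝ) :
    logisticPow α (x + Real.pi * Complex.I) - logisticPow α (x + (-Real.pi : ℝ) * Complex.I) =
      2 * Real.pi * Complex.I * density α x := by
  have hp := Real.pi_pos
  have hs := sin_pos h0 h1
  have hd1 := logisticPow_denom h0 h1 (ξ := x + Real.pi * Complex.I) (by simp [abs_of_pos hp])
  have hd2 := logisticPow_denom h0 h1 (ξ := x + (-Real.pi : ℝ) * Complex.I)
    (by simp [abs_of_pos hp])
  have e1 : Complex.exp (α * (x + Real.pi * Complex.I)) = (Real.exp (α * x) : ℂ) *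
      ((Real.cos (Real.pi * α) : ℂ) + (Real.sin (Real.pi * α) : ℂ) * Complex.I) := by
    rw [Complex.ofReal_cos, Complex.ofReal_sin, ← Complex.exp_mul_I, Complex.ofReal_exp,
      ← Complex.exp_add]
    push_cast; ring_nf
  have e2 : Complex.exp (α * (x + (-Real.pi : ℝ) * Complex.I)) = (Real.exp (α * x) : ℂ) *
      ((Real.cos (Real.pi * α) : ℂ) - (Real.sin (Real.pi * α) : ℂ) * Complex.I) := by
    have : ((Real.cos (Real.pi * α) : ℂ) - (Real.sin (Real.pi * α) : ℂ) * Complex.I) =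
        Complex.exp (-(Real.pi * α : ℝ) * Complex.I) := by
      rw [Complex.exp_mul_I, Complex.cos_neg, Complex.sin_neg, Complex.ofReal_cos,
        Complex.ofReal_sin]
      ring
    rw [this, Complex.ofReal_exp, ← Complex.exp_add]
    push_cast; ring_nf
  have hcs : (Real.sin (Real.pi * α) : ℂ) ^ 2 + (Real.cos (Real.pi * α) : ℂ) ^ 2 = 1 := by
    exact_mod_cast Real.sin_sq_add_cos_sq (Real.pi * α)
  have hD : (((Real.exp (α * x) + Real.cos (Real.pi * α)) ^ 2 + Real.sin (Real.pi * α) ^ 2 : ℝ) : ℂ)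
      = (Complex.exp (α * (x + Real.pi * Complex.I)) + 1) *
        (Complex.exp (α * (x + (-Real.pi : ℝ) * Complex.I)) + 1) := by
    rw [e1, e2]
    push_cast at hcs ⊢
    linear_combination (1 - Complex.exp (α * x) ^ 2) * hcs +
      (Complex.exp (α * x) ^ 2 * Complex.sin (Real.pi * α) ^ 2) * Complex.I_sq
  rw [density, logisticPow, logisticPow, div_sub_div _ _ hd1 hd2, Complex.ofReal_mul,
    Complex.ofReal_div, Complex.ofReal_div _ ((_ : ℝ) + _), hD]
  have hpc : (Real.pi : ℂ) ≠ 0 := by exact_mod_cast hp.ne'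
  rw [← mul_assoc, mul_div_assoc', div_left_inj' (mul_ne_zero hd1 hd2), e1, e2]
  field_simp
  ring

/-- The kernel `1 / (1 + e^{x-a})` has no pole on the real line when `e^a` is in the right half plane. -/
lemma one_le_norm_one_add_exp {a : ℂ} (ha : |a.im| ≤ Real.pi / 2) (x : ℝ) :
    1 ≤ ‖1 + Complex.exp (x - a)‖ := by
  refine le_trans ?_ (Complex.re_le_norm _)
  rw [Complex.add_re, Complex.one_re, Complex.exp_re]
  have : 0 ≤ Real.cos ((x - a : ℂ).im) := by
    apply Real.cos_nonneg_of_neg_pi_div_two_le_of_le <;> simp <;> linarith [abs_le.1 ha]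
  have := mul_nonneg (Real.exp_pos ((x - a : ℂ).re)).le this
  linarith

lemma integrable_density_mul_logistic (h0 : 0 < α) (h1 : α < 1) {a : ℂ}
    (ha : |a.im| ≤ Real.pi / 2) :
    Integrable fun x : ℝ => (density α x : ℂ) * (1 + Complex.exp (x - a))⁻¹ := by
  have hn := one_le_norm_one_add_exp ha
  refine (integrable_density h0 h1).mono' (Continuous.aestronglyMeasurable ?_)
    (Eventually.of_forall fun x => ?_)
  · have := continuous_density h0 h1
    refine Continuous.mul (by fun_prop) (Continuous.inv₀ (by fun_prop) fun x => ?_)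
    rw [← norm_pos_iff]
    linarith [hn x]
  · rw [norm_mul, norm_inv, Complex.norm_real, Real.norm_of_nonneg (density_pos h0 h1 x).le]
    exact mul_le_of_le_one_right (density_pos h0 h1 x).le (inv_le_one_of_one_le₀ (hn x))

/-- The Stieltjes transform of the density: Cauchy's theorem for the rectangle with vertices
`±R ± iπ`. The jump of `logisticPow` between the sides `Im ξ = ±π` is a multiple of the density,
the side `Re ξ = R` contributes nothing in the limit, and `Re ξ = -R` contributes the value at
`a`. -/
theorem integral_density_mul_logistic (h0 : 0 < α) (h1 : α < 1) {a : ℂ}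
    (ha : |a.im| ≤ Real.pi / 2) :
    ∫ x : ℝ, (density α x : ℂ) * (1 + Complex.exp (x - a))⁻¹ = logisticPow α a := by
  have hp := Real.pi_pos
  have ha' : |a.im| < Real.pi := by linarith
  have hn := one_le_norm_one_add_exp ha
  have hrect : ∀ R : ℝ, (2 * Real.pi * Complex.I) *
      (∫ x : ℝ in -R..R, (density α x : ℂ) * (1 + Complex.exp (x - a))⁻¹) +
      Complex.I * (∫ y : ℝ in -Real.pi..Real.pi, contourFun α a (R + y * Complex.I)) -
      Complex.I * (∫ y : ℝ in -Real.pi..Real.pi, contourFun α a ((-R : ℝ) + y * Complex.I)) = 0 := by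
    intro R
    have hc := Complex.integral_boundary_rect_eq_zero_of_differentiableOn (contourFun α a)
      (⟨-R, -Real.pi⟩ : ℂ) (⟨R, Real.pi⟩ : ℂ) (fun ξ hξ => by
        refine (differentiableAt_contourFun h0 h1 ha' ?_).differentiableWithinAt
        have := hξ.2
        simp only [mem_preimage] at this
        rw [uIcc_of_le (by linarith)] at this
        exact abs_le.2 this)
    simp only [smul_eq_mul] at hc
    have hcont : ∀ b : ℝ, |b| = Real.pi → IntervalIntegrable
        (fun x : ℝ => contourFun α a (x + b * Complex.I)) volume (-R) R := fun b hb => by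
      refine ContinuousOn.intervalIntegrable fun x _ => ?_
      have h6 : ContinuousAt (contourFun α a) (x + b * Complex.I) := by
        refine (differentiableAt_contourFun h0 h1 ha' ?_).continuousAt
        simp [hb]
      exact (ContinuousAt.comp (f := fun x : ℝ => (x + b * Complex.I : ℂ)) h6
        (by fun_prop)).continuousWithinAt
    rw [← intervalIntegral.integral_sub (hcont _ (by rw [abs_neg, abs_of_pos hp]))
      (hcont _ (abs_of_pos hp))] at hc
    rw [← hc, ← intervalIntegral.integral_const_mul]
    congr 3
    funext x
    have hne : ∀ b : ℝ, |b| = Real.pi → (x + b * Complex.I : ℂ) ≠ a := fun b hb h => by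
      have := congrArg Complex.im h
      simp only [Complex.add_im, Complex.ofReal_im, Complex.mul_im, Complex.ofReal_re,
        Complex.I_im, Complex.I_re] at this
      rw [← this] at ha'
      simp [hb] at ha'
    have he : ∀ b : ℝ, Complex.exp (b * Complex.I) = -1 →
        Complex.exp ((x + b * Complex.I) - a) - 1 = -(1 + Complex.exp (x - a)) := fun b hb => by
      rw [show ((x + b * Complex.I) - a : ℂ) = (x - a) + b * Complex.I by ring, Complex.exp_add, hb]
      ring
    have hd : (1 + Complex.exp (x - a) : ℂ) ≠ 0 := by
      rw [← norm_pos_iff]; linarith [hn x]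
    rw [contourFun_of_ne (hne _ (by rw [abs_neg, abs_of_pos hp])),
      contourFun_of_ne (hne _ (abs_of_pos hp)), he _ (by simp [Complex.exp_neg]),
      he _ Complex.exp_pi_mul_I, ← sub_div, ← mul_assoc, ← density_eq_jump h0 h1 x,
      div_neg, ← div_eq_mul_inv, ← neg_div]
    congr 1
    ring
  have hlim := (((intervalIntegral_tendsto_integral (integrable_density_mul_logistic h0 h1 ha)
    tendsto_neg_atTop_atBot tendsto_id).const_mul (2 * Real.pi * Complex.I)).add
    ((tendsto_integral_right h0 a).const_mul Complex.I)).sub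
    ((tendsto_integral_left h0 h1 ha').const_mul Complex.I)
  have h0' := tendsto_nhds_unique hlim (tendsto_const_nhds.congr fun R => (hrect R).symm)
  have hpc : (2 * Real.pi * Complex.I : ℂ) ≠ 0 := by
    simp [hp.ne']
  apply mul_left_cancel₀ hpc
  linear_combination h0'

end

section

variable {α : ℝ}

/-! ### The kernels of fractional integration -/

lemma kappa_nonneg {β t : ℝ} (hβ : 0 < β) (ht : 0 ≤ t) : 0 ≤ kappa β t :=
  div_nonneg (Real.rpow_nonneg ht _) (Real.Gamma_pos_of_pos hβ).le

lemma measurable_kappa (β : ℝ) : Measurable (kappa β) := by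
  unfold kappa; fun_prop

lemma intervalIntegrable_kappa {β : ℝ} (hβ : 0 < β) (a b : ℝ) :
    IntervalIntegrable (kappa β) volume a b :=
  (intervalIntegral.intervalIntegrable_rpow' (by linarith)).div_const _

/-- The integrand of Euler's beta integral on `(0, r)` is integrable, by scaling from `r = 1`. -/
lemma intervalIntegrable_kappa_mul_kappa_zero {a b : ℝ} (ha : 0 < a) (hb : 0 < b) {r : ℝ}
    (hr : 0 < r) :
    IntervalIntegrable (fun x => kappa a x * kappa b (r - x)) volume 0 r := by
  have h := Complex.betaIntegral_convergent (u := a) (v := b) (by simpa) (by simpa)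
  have h1 : IntervalIntegrable (fun x : ℝ => x ^ (a - 1) * (1 - x) ^ (b - 1)) volume 0 1 := by
    rw [intervalIntegrable_iff_integrableOn_Ioo_of_le zero_le_one] at h ⊢
    refine IntegrableOn.congr_fun (f := fun x : ℝ => ‖(x : ℂ) ^ ((a : ℂ) - 1) *
      (1 - (x : ℂ)) ^ ((b : ℂ) - 1)‖) h.norm (fun x hx => ?_) measurableSet_Ioo
    have h1 : (x : ℂ) ^ ((a : ℂ) - 1) * (1 - (x : ℂ)) ^ ((b : ℂ) - 1) =
        ((x ^ (a - 1) * (1 - x) ^ (b - 1) : ℝ) : ℂ) := by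
      rw [Complex.ofReal_mul, Complex.ofReal_cpow hx.1.le, Complex.ofReal_cpow (by linarith [hx.2])]
      push_cast; rfl
    simp only [h1, Complex.norm_real]
    exact Real.norm_of_nonneg (mul_nonneg (Real.rpow_nonneg hx.1.le _)
      (Real.rpow_nonneg (by linarith [hx.2]) _))
  have h2 := (h1.comp_mul_left (c := r⁻¹)).const_mul
    (r ^ (a - 1) * r ^ (b - 1) / (Real.Gamma a * Real.Gamma b))
  simp only [zero_div, one_div, inv_inv] at h2
  rw [intervalIntegrable_iff_integrableOn_Ioo_of_le hr.le] at h2 ⊢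
  refine h2.congr_fun (fun x hx => ?_) measurableSet_Ioo
  have e1 : (r⁻¹ * x) ^ (a - 1) = (r ^ (a - 1))⁻¹ * x ^ (a - 1) := by
    rw [Real.mul_rpow (by positivity) hx.1.le, Real.inv_rpow hr.le]
  have e2 : (1 - r⁻¹ * x) ^ (b - 1) = (r ^ (b - 1))⁻¹ * (r - x) ^ (b - 1) := by
    rw [show 1 - r⁻¹ * x = r⁻¹ * (r - x) by field_simp,
      Real.mul_rpow (by positivity) (by linarith [hx.2]), Real.inv_rpow hr.le]
  have := Real.rpow_pos_of_pos hr (a - 1)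
  have := Real.rpow_pos_of_pos hr (b - 1)
  simp only [kappa, e1, e2]
  field_simp

lemma integral_kappa_mul_kappa_zero {a b : ℝ} (ha : 0 < a) (hb : 0 < b) (hab : a + b = 1) {r : ℝ}
    (hr : 0 < r) : ∫ x in (0 : ℝ)..r, kappa a x * kappa b (r - x) = 1 := by
  have hΓa := Real.Gamma_pos_of_pos ha
  have hΓb := Real.Gamma_pos_of_pos hb
  have h := Complex.betaIntegral_scaled a b hr
  have hval : Complex.betaIntegral a b = ((Real.Gamma a * Real.Gamma b : ℝ) : ℂ) := by
    rw [Complex.betaIntegral_eq_Gamma_mul_div _ _ (by simpa) (by simpa), ← Complex.ofReal_add, hab]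
    simp [Complex.Gamma_ofReal]
  rw [hval, ← Complex.ofReal_add, hab] at h
  simp only [Complex.ofReal_one, sub_self, Complex.cpow_zero, one_mul] at h
  have h2 : ∫ x in (0 : ℝ)..r, x ^ (a - 1) * (r - x) ^ (b - 1) = Real.Gamma a * Real.Gamma b := by
    apply Complex.ofReal_injective
    rw [← h, ← intervalIntegral.integral_ofReal]
    refine intervalIntegral.integral_congr_ae (Eventually.of_forall fun x hx => ?_)
    rw [uIoc_of_le hr.le] at hx
    rw [Complex.ofReal_mul, Complex.ofReal_cpow hx.1.le, Complex.ofReal_cpow (by linarith [hx.2])]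
    push_cast; rfl
  have h3 : ∀ x, kappa a x * kappa b (r - x) =
      (Real.Gamma a * Real.Gamma b)⁻¹ * (x ^ (a - 1) * (r - x) ^ (b - 1)) := fun x => by
    simp only [kappa]; field_simp
  simp only [h3]
  rw [intervalIntegral.integral_const_mul, h2]
  field_simp

lemma intervalIntegrable_kappa_mul_kappa {a b : ℝ} (ha : 0 < a) (hb : 0 < b) {s t : ℝ}
    (hst : s < t) :
    IntervalIntegrable (fun τ => kappa a (t - τ) * kappa b (τ - s)) volume s t := by
  have h := (intervalIntegrable_kappa_mul_kappa_zero hb ha (sub_pos.2 hst)).comp_sub_right s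
  simp only [zero_add, sub_add_cancel] at h
  refine h.congr (fun τ _ => ?_)
  rw [mul_comm]; congr 2; ring

/-- Euler's beta integral. -/
lemma integral_kappa_mul_kappa {a b : ℝ} (ha : 0 < a) (hb : 0 < b) (hab : a + b = 1) {s t : ℝ}
    (hst : s < t) : ∫ τ in s..t, kappa a (t - τ) * kappa b (τ - s) = 1 := by
  rw [← integral_kappa_mul_kappa_zero hb ha (by linarith) (sub_pos.2 hst)]
  have h := intervalIntegral.integral_comp_sub_right (a := s) (b := t)
    (fun x => kappa b x * kappa a (t - s - x)) s
  rw [sub_self] at h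
  rw [← h]
  congr 1
  ext τ
  rw [mul_comm]; congr 2; ring

/-! ### Laplace transforms -/

lemma withDensity_charFun {f : ℝ → ℝ} (hf : Measurable f) (h0 : ∀ t ∈ Ioi (0 : ℝ), 0 ≤ f t)
    (y : ℝ) :
    charFun ((volume.restrict (Ioi 0)).withDensity fun t => ENNReal.ofReal (Real.exp (-t) * f t)) y
      = ∫ t in Ioi (0 : ℝ), (f t : ℂ) * Complex.exp (-((1 + (-y : ℝ) * Complex.I) * t)) := by
  rw [charFun_apply_real, integral_withDensity_eq_integral_toReal_smul (by fun_prop)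
    (Eventually.of_forall fun _ => ENNReal.ofReal_lt_top)]
  refine setIntegral_congr_fun measurableSet_Ioi fun t ht => ?_
  rw [ENNReal.toReal_ofReal (mul_nonneg (Real.exp_pos _).le (h0 t ht)), Complex.real_smul,
    Complex.ofReal_mul, Complex.ofReal_exp, mul_comm (Complex.exp _), mul_assoc, ← Complex.exp_add]
  congr 2
  push_cast
  ring

/-- A nonnegative function on `(0, ∞)` is determined by its Laplace transform on the line
`Re z = 1`. -/
lemma ae_eq_of_laplace_eq {f g : ℝ → ℝ} (hf : Measurable f) (hg : Measurable g)
    (hf0 : ∀ t ∈ Ioi (0 : ℝ), 0 ≤ f t) (hg0 : ∀ t ∈ Ioi (0 : ℝ), 0 ≤ g t)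
    (hfi : IntegrableOn (fun t => Real.exp (-t) * f t) (Ioi 0))
    (hgi : IntegrableOn (fun t => Real.exp (-t) * g t) (Ioi 0))
    (h : ∀ y : ℝ, ∫ t in Ioi (0 : ℝ), (f t : ℂ) * Complex.exp (-((1 + y * Complex.I) * t)) =
      ∫ t in Ioi (0 : ℝ), (g t : ℂ) * Complex.exp (-((1 + y * Complex.I) * t))) :
    f =ᵐ[volume.restrict (Ioi 0)] g := by
  have fin : ∀ {f : ℝ → ℝ}, IntegrableOn (fun t => Real.exp (-t) * f t) (Ioi 0) →
      ∫⁻ t in Ioi (0 : ℝ), ENNReal.ofReal (Real.exp (-t) * f t) ≠ ⊤ := fun hfi => by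
    refine ne_top_of_le_ne_top hfi.2.ne (lintegral_mono fun t => ?_)
    exact Real.ofReal_le_enorm _
  have := isFiniteMeasure_withDensity (fin hfi)
  have := isFiniteMeasure_withDensity (fin hgi)
  have heq : (volume.restrict (Ioi 0)).withDensity (fun t => ENNReal.ofReal (Real.exp (-t) * f t)) =
      (volume.restrict (Ioi 0)).withDensity (fun t => ENNReal.ofReal (Real.exp (-t) * g t)) := by
    refine Measure.ext_of_charFun (funext fun y => ?_)
    rw [withDensity_charFun hf hf0, withDensity_charFun hg hg0]
    exact h (-y)
  rw [withDensity_eq_iff (by fun_prop) (by fun_prop) (fin hfi)] at heq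
  filter_upwards [heq, ae_restrict_mem measurableSet_Ioi] with t ht htm
  rw [ENNReal.ofReal_eq_ofReal_iff (mul_nonneg (Real.exp_pos _).le (hf0 t htm))
    (mul_nonneg (Real.exp_pos _).le (hg0 t htm))] at ht
  exact mul_left_cancel₀ (Real.exp_pos _).ne' ht

lemma measurable_ml (h0 : 0 < α) (h1 : α < 1) (k : ℕ) : Measurable (ml α k) := by
  have : StronglyMeasurable fun p : ℝ × ℝ =>
      density α p.2 * (Real.exp (k * p.2) * Real.exp (-(p.1 * Real.exp p.2))) := by
    have := continuous_density h0 h1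
    exact Continuous.stronglyMeasurable (by fun_prop)
  exact this.integral_prod_right'.measurable

/-- The density has total mass one: let `a → ∞` in its Stieltjes transform. -/
theorem integral_density (h0 : 0 < α) (h1 : α < 1) : ∫ x, density α x = 1 := by
  have hL : Tendsto (fun n : ℕ => ∫ x : ℝ, (density α x : ℂ) * (1 + Complex.exp (x - (n : ℂ)))⁻¹)
      atTop (𝓝 (∫ x : ℝ, (density α x : ℂ))) := by
    refine tendsto_integral_of_dominated_convergence (density α) (fun n => ?_)
      (integrable_density h0 h1) (fun n => Eventually.of_forall fun x => ?_)
      (Eventually.of_forall fun x => ?_)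
    · exact (integrable_density_mul_logistic h0 h1 (a := n)
        (by simp; positivity)).aestronglyMeasurable
    · rw [norm_mul, norm_inv, Complex.norm_real, Real.norm_of_nonneg (density_pos h0 h1 x).le]
      exact mul_le_of_le_one_right (density_pos h0 h1 x).le
        (inv_le_one_of_one_le₀ (one_le_norm_one_add_exp (by simp; positivity) x))
    · have : Tendsto (fun n : ℕ => ((Real.exp (x - n) : ℝ) : ℂ)) atTop (𝓝 ((0 : ℝ) : ℂ)) := by
        refine (Complex.continuous_ofReal.tendsto 0).comp (Real.tendsto_exp_atBot.comp ?_)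
        exact tendsto_atBot_add_const_left _ x
          (tendsto_neg_atTop_atBot.comp tendsto_natCast_atTop_atTop)
      have h2 := ((this.const_add 1).inv₀ (by simp)).const_mul (density α x : ℂ)
      simpa using h2
  have hR : Tendsto (fun n : ℕ => logisticPow α n) atTop (𝓝 1) := by
    have : Tendsto (fun n : ℕ => ((Real.exp (-(α * n)) : ℝ) : ℂ)) atTop (𝓝 ((0 : ℝ) : ℂ)) := by
      refine (Complex.continuous_ofReal.tendsto 0).comp (Real.tendsto_exp_atBot.comp ?_)
      exact tendsto_neg_atTop_atBot.comp (tendsto_natCast_atTop_atTop.const_mul_atTop h0)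
    have h2 := (this.const_add 1).inv₀ (by simp)
    simp only [Complex.ofReal_zero, add_zero, inv_one] at h2
    refine h2.congr fun n => ?_
    rw [logisticPow, Complex.ofReal_exp]
    push_cast
    have he := Complex.exp_ne_zero (α * n)
    have hd : Complex.exp (α * n) + 1 ≠ 0 := logisticPow_denom h0 h1 (ξ := n)
      (by simp; positivity)
    rw [Complex.exp_neg]
    have : 1 + (Complex.exp (α * n))⁻¹ ≠ 0 := by
      intro h; apply hd; field_simp at h; simpa using h
    field_simp
  have h3 : ∀ n : ℕ, ∫ x : ℝ, (density α x : ℂ) * (1 + Complex.exp (x - (n : ℂ)))⁻¹ =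
      logisticPow α n := fun n =>
    integral_density_mul_logistic h0 h1 (a := n) (by simp; positivity)
  have h4 := tendsto_nhds_unique (hL.congr h3) hR
  rw [integral_complex_ofReal] at h4
  exact_mod_cast h4

lemma ml_zero_zero (h0 : 0 < α) (h1 : α < 1) : ml α 0 0 = 1 := by
  simp [ml, integral_density h0 h1]

lemma ml_zero_le_one (h0 : 0 < α) (h1 : α < 1) {t : ℝ} (ht : 0 ≤ t) : ml α 0 t ≤ 1 := by
  rw [← integral_density h0 h1]
  refine integral_mono_of_nonneg (Eventually.of_forall fun x => ?_) (integrable_density h0 h1)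
    (Eventually.of_forall fun x => ?_)
  · have := density_pos h0 h1 x
    positivity
  · have : 0 ≤ t * Real.exp x := by positivity
    refine mul_le_of_le_one_right (density_pos h0 h1 x).le ?_
    simpa using this

lemma continuous_cexp_neg_mul (z : ℂ) : Continuous fun t : ℝ => Complex.exp (-(z * t)) := by
  fun_prop

lemma norm_cexp_neg_mul {z : ℂ} (hz : z.re = 1) (t : ℝ) :
    ‖Complex.exp (-(z * t))‖ = Real.exp (-t) := by
  rw [Complex.norm_exp]; simp [hz]

lemma integrableOn_exp_neg_mul_rpow {β : ℝ} (hβ : 0 < β) :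
    IntegrableOn (fun t : ℝ => Real.exp (-t) * t ^ (β - 1)) (Ioi 0) :=
  Real.GammaIntegral_convergent hβ

lemma integrableOn_laplace_of_le {f : ℝ → ℝ} (hf : Measurable f) {β C : ℝ} (hβ : 0 < β)
    (hC : ∀ t ∈ Ioi (0 : ℝ), |f t| ≤ C * t ^ (β - 1)) {z : ℂ} (hz : z.re = 1) :
    IntegrableOn (fun t : ℝ => (f t : ℂ) * Complex.exp (-(z * t))) (Ioi 0) := by
  refine ((integrableOn_exp_neg_mul_rpow hβ).const_mul C).mono' ?_ ?_
  · exact ((Complex.measurable_ofReal.comp hf).mul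
      (continuous_cexp_neg_mul z).measurable).aestronglyMeasurable
  · filter_upwards [ae_restrict_mem measurableSet_Ioi] with t ht
    rw [norm_mul, norm_cexp_neg_mul hz, Complex.norm_real, Real.norm_eq_abs]
    calc _ ≤ (C * t ^ (β - 1)) * Real.exp (-t) := by gcongr; exact hC t ht
      _ = _ := by ring

lemma abs_ml_one_le (h0 : 0 < α) (h1 : α < 1) : ∀ t ∈ Ioi (0 : ℝ),
    |ml α 1 t| ≤ densConst α * expConst (1 - α) * t ^ (α - 1) := fun t ht => by
  rw [abs_of_nonneg (ml_nonneg h0 h1 1 t)]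
  convert ml_le_small h0 h1 le_rfl ht using 2 <;> norm_num

lemma abs_ml_zero_le (h0 : 0 < α) (h1 : α < 1) : ∀ t ∈ Ioi (0 : ℝ),
    |ml α 0 t| ≤ 1 * t ^ ((1 : ℝ) - 1) := fun t ht => by
  rw [abs_of_nonneg (ml_nonneg h0 h1 0 t)]
  simpa using ml_zero_le_one h0 h1 (le_of_lt ht)

lemma integral_cexp_neg_mul_Ioi {c : ℂ} (hc : 0 < c.re) :
    ∫ t in Ioi (0 : ℝ), Complex.exp (-(c * t)) = c⁻¹ := by
  have h := integral_exp_mul_complex_Ioi (a := -c) (by simpa) 0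
  simpa [neg_mul] using h

/-- The Laplace transform of the Mittag-Leffler function. -/
lemma laplace_ml_zero (h0 : 0 < α) (h1 : α < 1) {z : ℂ} (hz : z.re = 1) :
    ∫ t in Ioi (0 : ℝ), (ml α 0 t : ℂ) * Complex.exp (-(z * t)) =
      logisticPow α (Complex.log z) / z := by
  have hz0 : z ≠ 0 := fun h => by simp [h] at hz
  have harg : |(Complex.log z).im| ≤ Real.pi / 2 := by
    rw [Complex.log_im]
    exact Complex.abs_arg_le_pi_div_two_iff.2 (by rw [hz]; norm_num)
  have hcd := continuous_density h0 h1
  have hint : Integrable (Function.uncurry fun (t x : ℝ) => (density α x : ℂ) *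
      (Complex.exp (-(((Real.exp x : ℂ) + z) * t)))) ((volume.restrict (Ioi 0)).prod volume) := by
    have hb : Integrable (fun p : ℝ × ℝ => Real.exp (-1 * p.1) * density α p.2)
        ((volume.restrict (Ioi 0)).prod volume) :=
      (integrableOn_exp_mul_Ioi (a := -1) (by norm_num) 0).mul_prod (integrable_density h0 h1)
    refine hb.mono' ?_ ?_
    · refine Continuous.aestronglyMeasurable ?_
      simp only [Function.uncurry_def]
      fun_prop
    · have : ∀ᵐ p ∂((volume.restrict (Ioi (0 : ℝ))).prod (volume : Measure ℝ)), 0 < p.1 :=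
        Measure.quasiMeasurePreserving_fst.ae (ae_restrict_mem measurableSet_Ioi)
      filter_upwards [this] with p hp
      simp only [Function.uncurry_def]
      rw [norm_mul, Complex.norm_real, Real.norm_of_nonneg (density_pos h0 h1 _).le,
        Complex.norm_exp, mul_comm]
      have := density_pos h0 h1 p.2
      gcongr
      simp [hz]
      have := Real.exp_pos p.2
      rw [← Complex.ofReal_exp, Complex.ofReal_re]
      nlinarith
  calc _ = ∫ t in Ioi (0 : ℝ), ∫ x : ℝ, (density α x : ℂ) *
      (Complex.exp (-(((Real.exp x : ℂ) + z) * t))) := by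
        refine integral_congr_ae (Eventually.of_forall fun t => ?_)
        simp only [ml]
        rw [← integral_complex_ofReal, ← integral_mul_const]
        congr 1
        ext x
        push_cast
        rw [mul_assoc, mul_assoc, ← Complex.exp_add, ← Complex.exp_add]
        congr 2
        ring
    _ = ∫ x : ℝ, ∫ t in Ioi (0 : ℝ), (density α x : ℂ) *
      (Complex.exp (-(((Real.exp x : ℂ) + z) * t))) := integral_integral_swap hint
    _ = ∫ x : ℝ, ((density α x : ℂ) * (1 + Complex.exp (x - Complex.log z))⁻¹) / z := by
        congr 1
        ext x
        have hre : 0 < ((Real.exp x : ℂ) + z).re := by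
          rw [Complex.add_re, Complex.ofReal_re, hz]; positivity
        rw [integral_const_mul, integral_cexp_neg_mul_Ioi hre, Complex.exp_sub,
          Complex.exp_log hz0, mul_div_assoc]
        congr 1
        rw [Complex.ofReal_exp] at *
        have hne : Complex.exp x + z ≠ 0 := fun h => by rw [h] at hre; simp at hre
        have hne' : 1 + Complex.exp x / z ≠ 0 := fun h => hne (by
          field_simp at h; linear_combination h)
        rw [eq_div_iff hz0, inv_mul_eq_iff_eq_mul₀ hne, eq_mul_inv_iff_mul_eq₀ hne']
        field_simp
        ring
    _ = _ := by rw [integral_div, integral_density_mul_logistic h0 h1 harg]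

/-- The Laplace transform of `-d/dt E_α(-t^α)`, by integration by parts. -/
lemma laplace_ml_one (h0 : 0 < α) (h1 : α < 1) {z : ℂ} (hz : z.re = 1) :
    ∫ t in Ioi (0 : ℝ), (ml α 1 t : ℂ) * Complex.exp (-(z * t)) =
      1 - logisticPow α (Complex.log z) := by
  have hz0 : z ≠ 0 := fun h => by simp [h] at hz
  have hi0 := integrableOn_laplace_of_le (measurable_ml h0 h1 0) one_pos (abs_ml_zero_le h0 h1) hz
  have hi1 := integrableOn_laplace_of_le (measurable_ml h0 h1 1) h0 (abs_ml_one_le h0 h1) hz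
  have key := integral_Ioi_of_hasDerivAt_of_tendsto (a := 0) (m := 0)
    (f := fun t : ℝ => (ml α 0 t : ℂ) * Complex.exp (-(z * t)))
    (f' := fun t : ℝ => -((ml α 1 t : ℂ) * Complex.exp (-(z * t))) -
      z * ((ml α 0 t : ℂ) * Complex.exp (-(z * t)))) ?_ ?_ ?_ ?_
  · rw [integral_sub (f := fun t : ℝ => -((ml α 1 t : ℂ) * Complex.exp (-(z * t)))) hi1.neg
      (hi0.const_mul z), integral_neg, integral_const_mul,
      laplace_ml_zero h0 h1 hz, ml_zero_zero h0 h1] at key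
    simp only [Complex.ofReal_one, Complex.ofReal_zero, mul_zero, neg_zero, Complex.exp_zero,
      mul_one] at key
    rw [mul_div_cancel₀ _ hz0] at key
    linear_combination -key
  · refine ContinuousWithinAt.mul ?_ (by fun_prop)
    exact Complex.continuous_ofReal.continuousAt.comp_continuousWithinAt
      (continuousOn_ml_zero h0 h1 0 self_mem_Ici)
  · intro t ht
    have h2 := (hasDerivAt_ml h0 h1 0 ht).ofReal_comp
    have h3 : HasDerivAt (fun t : ℝ => Complex.exp (-(z * t))) (Complex.exp (-(z * t)) *
        (-(z * 1))) t := ((Complex.ofRealCLM.hasDerivAt (x := t)).const_mul z).neg.cexp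
    refine (h2.mul h3).congr_deriv ?_
    push_cast
    ring_nf
  · exact hi1.neg.sub (hi0.const_mul z)
  · refine squeeze_zero_norm' ?_ Real.tendsto_exp_neg_atTop_nhds_zero
    filter_upwards [eventually_ge_atTop 0] with t ht
    rw [norm_mul, norm_cexp_neg_mul hz, Complex.norm_real, Real.norm_of_nonneg
      (ml_nonneg h0 h1 0 t)]
    exact mul_le_of_le_one_left (Real.exp_pos _).le (ml_zero_le_one h0 h1 ht)

/-- Euler's integral with a complex rate, by analytic continuation from positive rates. -/
lemma integral_rpow_mul_cexp_neg_mul {b : ℝ} (hb : 0 < b) {z : ℂ} (hz : 0 < z.re) :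
    ∫ t in Ioi (0 : ℝ), ((t ^ (b - 1) : ℝ) : ℂ) * Complex.exp (-(z * t)) =
      Complex.exp (-(b * Complex.log z)) * Real.Gamma b := by
  set ν : Measure ℝ := (volume.restrict (Ioi 0)).withDensity fun t => ENNReal.ofReal (t ^ (b - 1))
  have hmgf : ∀ z : ℂ, ProbabilityTheory.complexMGF (fun t : ℝ => -t) ν z =
      ∫ t in Ioi (0 : ℝ), ((t ^ (b - 1) : ℝ) : ℂ) * Complex.exp (-(z * t)) := fun z => by
    rw [ProbabilityTheory.complexMGF, integral_withDensity_eq_integral_toReal_smul (by fun_prop)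
      (Eventually.of_forall fun _ => ENNReal.ofReal_lt_top)]
    refine setIntegral_congr_fun measurableSet_Ioi fun t ht => ?_
    rw [ENNReal.toReal_ofReal (Real.rpow_nonneg (le_of_lt ht) _), Complex.real_smul]
    push_cast
    ring_nf
  have hset : Ioi 0 ⊆ ProbabilityTheory.integrableExpSet (fun t : ℝ => -t) ν := fun s hs => by
    have hs0 : 0 < s := hs
    rw [ProbabilityTheory.integrableExpSet, mem_ofPred_eq,
      integrable_withDensity_iff_integrable_smul' (by fun_prop)
        (Eventually.of_forall fun _ => ENNReal.ofReal_lt_top)]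
    have h := integrableOn_rpow_mul_exp_neg_mul_rpow (s := b - 1) (p := 1) (by linarith) one_pos hs0
    refine IntegrableOn.congr_fun h (fun t ht => ?_) measurableSet_Ioi
    rw [ENNReal.toReal_ofReal (Real.rpow_nonneg (le_of_lt ht) _), smul_eq_mul, Real.rpow_one]
    ring_nf
  have hU : {z : ℂ | 0 < z.re} ⊆
      {z | z.re ∈ interior (ProbabilityTheory.integrableExpSet (fun t : ℝ => -t) ν)} :=
    fun z hz => interior_maximal hset isOpen_Ioi hz
  have hopen : IsOpen {z : ℂ | 0 < z.re} := isOpen_lt continuous_const Complex.continuous_re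
  have hA : AnalyticOnNhd ℂ (ProbabilityTheory.complexMGF (fun t : ℝ => -t) ν) {z | 0 < z.re} :=
    (ProbabilityTheory.differentiableOn_complexMGF.mono hU).analyticOnNhd hopen
  have hB : AnalyticOnNhd ℂ (fun z => Complex.exp (-(b * Complex.log z)) * Real.Gamma b)
      {z | 0 < z.re} := by
    refine DifferentiableOn.analyticOnNhd (fun z hz => ?_) hopen
    have : DifferentiableAt ℂ Complex.log z := Complex.differentiableAt_log (Or.inl hz)
    exact DifferentiableAt.differentiableWithinAt (by fun_prop)
  have hreal : ∀ r : ℝ, 0 < r → ProbabilityTheory.complexMGF (fun t : ℝ => -t) ν r =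
      Complex.exp (-(b * Complex.log r)) * Real.Gamma b := fun r hr => by
    have h := Complex.integral_cpow_mul_exp_neg_mul_Ioi (a := b) (r := r) (by simpa) hr
    rw [Complex.Gamma_ofReal, Complex.cpow_def_of_ne_zero (by simp [hr.ne']), one_div,
      Complex.log_inv _ (by rw [Complex.arg_ofReal_of_nonneg hr.le]; exact Real.pi_pos.ne)] at h
    rw [hmgf, show -(b * Complex.log r) = -Complex.log r * b by ring, ← h]
    refine setIntegral_congr_fun measurableSet_Ioi fun t ht => ?_
    rw [Complex.ofReal_cpow (le_of_lt ht)]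
    push_cast
    rfl
  have hfreq : ∃ᶠ w in 𝓝[≠] (1 : ℂ), ProbabilityTheory.complexMGF (fun t : ℝ => -t) ν w =
      Complex.exp (-(b * Complex.log w)) * Real.Gamma b := by
    have ht : Tendsto (fun r : ℝ => (r : ℂ)) (𝓝[≠] 1) (𝓝[≠] (1 : ℂ)) := by
      refine tendsto_nhdsWithin_of_tendsto_nhds_of_eventually_within _
        ((Complex.continuous_ofReal.tendsto' 1 1 (by simp)).mono_left nhdsWithin_le_nhds) ?_
      filter_upwards [self_mem_nhdsWithin] with r hr
      simpa using hr
    refine ht.frequently (Eventually.frequently ?_)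
    filter_upwards [nhdsWithin_le_nhds (Ioi_mem_nhds one_pos)] with r hr using hreal r hr
  have hconn : IsPreconnected {z : ℂ | 0 < z.re} := (convex_halfSpace_re_gt 0).isPreconnected
  have := hA.eqOn_of_preconnected_of_frequently_eq hB hconn (z₀ := 1) (by simp) hfreq hz
  rw [← hmgf]
  exact this

/-- The Laplace transform of `κ_{1-α}` is `z^{α-1}`. -/
lemma laplace_kappa (h1 : α < 1) {z : ℂ} (hz : z.re = 1) :
    ∫ t in Ioi (0 : ℝ), (kappa (1 - α) t : ℂ) * Complex.exp (-(z * t)) =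
      Complex.exp (α * Complex.log z) / z := by
  have hz0 : z ≠ 0 := fun h => by simp [h] at hz
  have hΓ := Real.Gamma_pos_of_pos (sub_pos.2 h1)
  have hΓ' : (Real.Gamma (1 - α) : ℂ) ≠ 0 := by exact_mod_cast hΓ.ne'
  have h := integral_rpow_mul_cexp_neg_mul (sub_pos.2 h1) (z := z) (by rw [hz]; exact one_pos)
  have hpow : Complex.exp (-((1 - α : ℝ) * Complex.log z)) =
      Complex.exp (α * Complex.log z) / z := by
    rw [show -((1 - α : ℝ) * Complex.log z) = α * Complex.log z - Complex.log z by
      push_cast; ring, Complex.exp_sub, Complex.exp_log hz0]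
  rw [← hpow, eq_div_of_mul_eq hΓ' h.symm, ← integral_div]
  congr 1
  ext t
  simp only [kappa]
  push_cast
  ring

/-! ### The Caputo equation -/

lemma integrableOn_laplace_kappa (h1 : α < 1) {z : ℂ} (hz : z.re = 1) :
    IntegrableOn (fun t : ℝ => (kappa (1 - α) t : ℂ) * Complex.exp (-(z * t))) (Ioi 0) := by
  refine integrableOn_laplace_of_le (measurable_kappa _) (sub_pos.2 h1)
    (C := (Real.Gamma (1 - α))⁻¹) (fun t ht => ?_) hz
  rw [abs_of_nonneg (kappa_nonneg (sub_pos.2 h1) (le_of_lt ht)), kappa, div_eq_inv_mul]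

/-- The Laplace factor splits over a convolution. -/
lemma posConvolution_integrand (z : ℂ) (x : ℝ) :
    ∫ t in (0 : ℝ)..x, ContinuousLinearMap.mul ℝ ℂ ((ml α 1 t : ℂ) * Complex.exp (-(z * t)))
      ((kappa (1 - α) (x - t) : ℂ) * Complex.exp (-(z * (x - t : ℝ)))) =
      ((rlIntegral (1 - α) (ml α 1) x : ℝ) : ℂ) * Complex.exp (-(z * x)) := by
  rw [rlIntegral, ← intervalIntegral.integral_ofReal, ← intervalIntegral.integral_mul_const]
  refine intervalIntegral.integral_congr fun t _ => ?_
  simp only [ContinuousLinearMap.mul_apply', smul_eq_mul, Complex.ofReal_mul]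
  rw [show -(z * x) = -(z * t) + -(z * (x - t : ℝ)) by push_cast; ring, Complex.exp_add]
  ring

/-- The substitution `s = t σ`. -/
lemma rlIntegral_scale (β : ℝ) (v : ℝ → ℝ) {t : ℝ} (ht : 0 < t) :
    rlIntegral β v t = t ^ β * ∫ σ in (0 : ℝ)..1, kappa β (1 - σ) * v (t * σ) := by
  have h := intervalIntegral.integral_comp_mul_left (a := 0) (b := 1)
    (fun s => kappa β (t - s) * v s) ht.ne'
  rw [mul_zero, mul_one, eq_inv_smul_iff₀ ht.ne'] at h
  rw [rlIntegral]
  simp only [smul_eq_mul] at h ⊢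
  rw [← h, ← intervalIntegral.integral_const_mul, ← intervalIntegral.integral_const_mul]
  refine intervalIntegral.integral_congr_ae (Eventually.of_forall fun σ hσ => ?_)
  rw [uIoc_of_le zero_le_one] at hσ
  simp only [kappa]
  rw [show t - t * σ = t * (1 - σ) by ring, Real.mul_rpow ht.le (by linarith [hσ.2]),
    Real.rpow_sub_one ht.ne']
  field_simp

/-- The fractional integral of a continuous function with an integrable power singularity at zero is
continuous: scaling to `(0, 1)` gives an integrable bound that is uniform near each `t`. -/
lemma continuousOn_rlIntegral_of_le {β γ C : ℝ} (hβ : 0 < β) (hγ : 0 < γ) (hγ1 : γ ≤ 1)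
    {v : ℝ → ℝ} (hC : ∀ t ∈ Ioi (0 : ℝ), |v t| ≤ C * t ^ (γ - 1)) (hv : ContinuousOn v (Ioi 0)) :
    ContinuousOn (rlIntegral β v) (Ioi 0) := by
  have hC0 : 0 ≤ C := by
    have := (abs_nonneg _).trans (hC 1 (mem_Ioi.2 one_pos))
    simpa using this
  have hcont : ContinuousOn (fun t : ℝ => t ^ β * ∫ σ in (0 : ℝ)..1, kappa β (1 - σ) * v (t * σ))
      (Ioi 0) := by
    refine ContinuousOn.mul (fun t ht => (Real.continuousAt_rpow_const t β
      (Or.inl (ne_of_gt ht))).continuousWithinAt) ?_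
    intro t ht
    refine ContinuousAt.continuousWithinAt ?_
    have ht0 : 0 < t := ht
    have hI := ((intervalIntegrable_kappa_mul_kappa_zero hγ hβ one_pos).const_mul
      (C * (t / 2) ^ (γ - 1) * Real.Gamma γ))
    refine intervalIntegral.continuousAt_of_dominated_interval ?_ ?_ hI ?_
    · filter_upwards [Ioi_mem_nhds ht0] with s hs
      rw [uIoc_of_le zero_le_one, ← restrict_Ioo_eq_restrict_Ioc]
      refine ContinuousOn.aestronglyMeasurable (fun σ hσ => ?_) measurableSet_Ioo
      refine ContinuousWithinAt.mul ?_ ?_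
      · refine ContinuousAt.continuousWithinAt (ContinuousAt.div_const ?_ _)
        exact ContinuousAt.rpow_const (by fun_prop) (Or.inl (by linarith [hσ.2]))
      · have hs' : 0 < s * σ := mul_pos hs hσ.1
        exact ((hv.continuousAt (Ioi_mem_nhds hs')).comp (by fun_prop)).continuousWithinAt
    · filter_upwards [Ioi_mem_nhds (show t / 2 < t by linarith)] with s hs
      refine Eventually.of_forall fun σ hσ => ?_
      rw [uIoc_of_le zero_le_one] at hσ
      have hs2 : t / 2 < s := hs
      have hsσ : 0 < s * σ := mul_pos (by linarith) hσ.1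
      have hk := kappa_nonneg hβ (show 0 ≤ 1 - σ by linarith [hσ.2])
      rw [norm_mul, Real.norm_of_nonneg hk, Real.norm_eq_abs]
      have h1 := hC _ hsσ
      have h2 : (s * σ) ^ (γ - 1) ≤ (t / 2) ^ (γ - 1) * σ ^ (γ - 1) := by
        rw [← Real.mul_rpow (by linarith) hσ.1.le]
        refine Real.rpow_le_rpow_of_nonpos (mul_pos (by linarith) hσ.1) ?_ (by linarith)
        exact mul_le_mul_of_nonneg_right hs2.le hσ.1.le
      have hΓ := Real.Gamma_pos_of_pos hγ
      calc _ ≤ kappa β (1 - σ) * (C * ((t / 2) ^ (γ - 1) * σ ^ (γ - 1))) := by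
            gcongr
            exact h1.trans (by gcongr)
        _ = _ := by simp only [kappa]; field_simp
    · refine Eventually.of_forall fun σ hσ => ?_
      rw [uIoc_of_le zero_le_one] at hσ
      refine ContinuousAt.mul continuousAt_const ?_
      exact (hv.continuousAt (Ioi_mem_nhds (mul_pos ht0 hσ.1))).comp
        (f := fun s => s * σ) (by fun_prop)
  exact hcont.congr fun t ht => rlIntegral_scale β v ht

/-- The Mittag-Leffler function `e(t) = E_α(-t^α)` solves `∂ₜ^α e + e = 0`: both sides have the
same Laplace transform. -/
theorem rlIntegral_ml_one (h0 : 0 < α) (h1 : α < 1) {t : ℝ} (ht : 0 < t) :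
    rlIntegral (1 - α) (ml α 1) t = ml α 0 t := by
  have hcont := continuousOn_rlIntegral_of_le (sub_pos.2 h1) h0 h1.le (abs_ml_one_le h0 h1)
    (continuousOn_ml h0 h1 1)
  have hnn : ∀ t ∈ Ioi (0 : ℝ), 0 ≤ rlIntegral (1 - α) (ml α 1) t := fun t ht => by
    refine intervalIntegral.integral_nonneg (le_of_lt ht) fun s hs => ?_
    exact mul_nonneg (kappa_nonneg (sub_pos.2 h1) (by linarith [hs.2])) (ml_nonneg h0 h1 1 s)
  let f : ℝ → ℝ := (Ioi 0).indicator (rlIntegral (1 - α) (ml α 1))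
  have hfe : ∀ t ∈ Ioi (0 : ℝ), f t = rlIntegral (1 - α) (ml α 1) t := fun t ht =>
    indicator_of_mem ht _
  have hfm : Measurable f := by
    have := hcont.measurable_piecewise (g := 0) continuousOn_const
      measurableSet_Ioi
    rwa [piecewise_eq_indicator] at this
  have hfi : ∀ {z : ℂ}, z.re = 1 →
      IntegrableOn (fun t : ℝ => (f t : ℂ) * Complex.exp (-(z * t))) (Ioi 0) ∧
      ∫ t in Ioi (0 : ℝ), (f t : ℂ) * Complex.exp (-(z * t)) =
        logisticPow α (Complex.log z) / z := fun {z} hz => by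
    have hi1 := integrableOn_laplace_of_le (measurable_ml h0 h1 1) h0 (abs_ml_one_le h0 h1) hz
    have hik := integrableOn_laplace_kappa h1 hz
    have hconv := integrable_posConvolution hi1 hik (ContinuousLinearMap.mul ℝ ℂ)
    have hint := integral_posConvolution hi1 hik (ContinuousLinearMap.mul ℝ ℂ)
    unfold posConvolution at hconv
    rw [integrable_indicator_iff measurableSet_Ioi] at hconv
    simp only [posConvolution_integrand] at hconv hint
    have hcongr : EqOn (fun t : ℝ => (f t : ℂ) * Complex.exp (-(z * t)))
        (fun t : ℝ => ((rlIntegral (1 - α) (ml α 1) t : ℝ) : ℂ) * Complex.exp (-(z * t)))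
        (Ioi 0) := fun t ht => by simp only [hfe t ht]
    refine ⟨hconv.congr_fun hcongr.symm measurableSet_Ioi, ?_⟩
    rw [setIntegral_congr_fun measurableSet_Ioi hcongr, hint, laplace_ml_one h0 h1 hz,
      laplace_kappa h1 hz, ContinuousLinearMap.mul_apply']
    have hd : Complex.exp (α * Complex.log z) + 1 ≠ 0 :=
      logisticPow_denom h0 h1 (by rw [Complex.log_im]; exact Complex.abs_arg_le_pi z)
    rw [logisticPow]
    field_simp
    ring
  have hnorm : ∀ {g : ℝ → ℝ}, (∀ t ∈ Ioi (0 : ℝ), 0 ≤ g t) →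
      IntegrableOn (fun t : ℝ => (g t : ℂ) * Complex.exp (-((1 : ℂ) * t))) (Ioi 0) →
      IntegrableOn (fun t => Real.exp (-t) * g t) (Ioi 0) := fun hg h => by
    refine IntegrableOn.congr_fun (Integrable.norm h) (fun t ht => ?_) measurableSet_Ioi
    rw [norm_mul, norm_cexp_neg_mul Complex.one_re, Complex.norm_real,
      Real.norm_of_nonneg (hg t ht), mul_comm]
  have hf0 : ∀ t ∈ Ioi (0 : ℝ), 0 ≤ f t := fun t ht => by rw [hfe t ht]; exact hnn t ht
  have hre : ∀ y : ℝ, (1 + y * Complex.I : ℂ).re = 1 := fun y => by simp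
  have hae := ae_eq_of_laplace_eq hfm (measurable_ml h0 h1 0) hf0
    (fun t _ => ml_nonneg h0 h1 0 t) (hnorm hf0 (hfi Complex.one_re).1)
    (hnorm (fun t _ => ml_nonneg h0 h1 0 t) (integrableOn_laplace_of_le (measurable_ml h0 h1 0)
      one_pos (abs_ml_zero_le h0 h1) Complex.one_re))
    (fun y => by rw [(hfi (hre y)).2, laplace_ml_zero h0 h1 (hre y)])
  have heq := Measure.eqOn_open_of_ae_eq hae isOpen_Ioi (hcont.congr hfe)
    (continuousOn_ml h0 h1 0)
  rw [← hfe t ht]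
  exact heq ht

end

section

variable {α : ℝ}

/-! ### Fractional integrals and the scalar fractional equation -/

/-- `I^a I^b = I^1` for `a + b = 1`, on integrable functions: after exchanging the integrals, the
inner one is Euler's beta integral. -/
theorem rlIntegral_rlIntegral {a b : ℝ} (ha : 0 < a) (hb : 0 < b) (hab : a + b = 1) {h : ℝ → ℝ}
    {t : ℝ} (ht : 0 ≤ t) (hh : IntegrableOn h (Ioo 0 t)) :
    rlIntegral a (rlIntegral b h) t = ∫ s in (0 : ℝ)..t, h s := by
  set μ : Measure ℝ := volume.restrict (Ioo 0 t) with hμ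
  -- the kernel of the double integral over the triangle `s < τ < t`
  let K : ℝ → ℝ → ℝ := fun s τ => (Ioi s).indicator (fun τ => kappa a (t - τ) * kappa b (τ - s)) τ
  have hset : ∀ s ∈ Ioo 0 t, Ioo 0 t ∩ Ioi s = Ioo s t := fun s hs => by
    ext τ; simp only [mem_inter_iff, mem_Ioo, mem_Ioi]
    constructor
    · rintro ⟨⟨_, h2⟩, h3⟩; exact ⟨h3, h2⟩
    · rintro ⟨h1, h2⟩; exact ⟨⟨hs.1.trans h1, h2⟩, h1⟩
  have hKnn : ∀ s, ∀ τ ∈ Ioo 0 t, 0 ≤ K s τ := fun s τ hτ => by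
    simp only [K]
    refine indicator_apply_nonneg fun hs => ?_
    exact mul_nonneg (kappa_nonneg ha (by linarith [hτ.2]))
      (kappa_nonneg hb (by linarith [mem_Ioi.1 hs]))
  have hKi : ∀ s ∈ Ioo 0 t, Integrable (K s) μ := fun s hs => by
    rw [integrable_indicator_iff measurableSet_Ioi, IntegrableOn, hμ,
      Measure.restrict_restrict measurableSet_Ioi, inter_comm, hset s hs]
    exact (intervalIntegrable_iff_integrableOn_Ioo_of_le hs.2.le).1
      (intervalIntegrable_kappa_mul_kappa ha hb hs.2)
  have hK1 : ∀ s ∈ Ioo 0 t, ∫ τ, K s τ ∂μ = 1 := fun s hs => by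
    simp only [K]
    rw [integral_indicator measurableSet_Ioi, hμ,
      Measure.restrict_restrict measurableSet_Ioi, inter_comm, hset s hs,
      ← integral_Ioc_eq_integral_Ioo, ← intervalIntegral.integral_of_le hs.2.le]
    exact integral_kappa_mul_kappa ha hb hab hs.2
  have hmem : ∀ᵐ s ∂μ, s ∈ Ioo 0 t := ae_restrict_mem measurableSet_Ioo
  have hmeasK : Measurable fun p : ℝ × ℝ => K p.2 p.1 := by
    have : (fun p : ℝ × ℝ => K p.2 p.1) = {p : ℝ × ℝ | p.2 < p.1}.indicator
        (fun p => kappa a (t - p.1) * kappa b (p.1 - p.2)) := by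
      ext p; simp only [K, indicator, mem_Ioi, mem_ofPred_eq]
    rw [this]
    refine Measurable.indicator ?_ (measurableSet_lt measurable_snd measurable_fst)
    exact ((measurable_kappa a).comp (by fun_prop)).mul ((measurable_kappa b).comp (by fun_prop))
  have hint : Integrable (Function.uncurry fun τ s => K s τ * h s) (μ.prod μ) := by
    rw [integrable_prod_iff']
    · constructor
      · filter_upwards [hmem] with s hs
        exact (hKi s hs).mul_const (h s)
      · refine hh.norm.congr ?_
        filter_upwards [hmem] with s hs
        have : ∫ τ, ‖K s τ * h s‖ ∂μ = ∫ τ, K s τ * ‖h s‖ ∂μ := by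
          refine integral_congr_ae ?_
          filter_upwards [hmem] with τ hτ
          rw [norm_mul, Real.norm_of_nonneg (hKnn s τ hτ)]
        simp only [Function.uncurry_apply_pair]
        rw [this, integral_mul_const, hK1 s hs, one_mul]
    · exact hmeasK.aestronglyMeasurable.mul hh.aestronglyMeasurable.comp_snd
  have hswap := integral_integral_swap hint
  have hR : ∫ s, ∫ τ, K s τ * h s ∂μ ∂μ = ∫ s in (0 : ℝ)..t, h s := by
    rw [intervalIntegral.integral_of_le ht, integral_Ioc_eq_integral_Ioo]
    refine integral_congr_ae ?_
    filter_upwards [hmem] with s hs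
    rw [integral_mul_const, hK1 s hs, one_mul]
  rw [← hR, ← hswap, rlIntegral, intervalIntegral.integral_of_le ht, integral_Ioc_eq_integral_Ioo]
  refine integral_congr_ae ?_
  filter_upwards [hmem] with τ hτ
  rw [smul_eq_mul, rlIntegral, intervalIntegral.integral_of_le hτ.1.le,
    integral_Ioc_eq_integral_Ioo, ← integral_const_mul]
  have hset2 : Ioo 0 τ = Ioo 0 t ∩ Iio τ := by
    ext s; simp only [mem_inter_iff, mem_Ioo, mem_Iio]
    constructor
    · rintro ⟨h1, h2⟩; exact ⟨⟨h1, h2.trans hτ.2⟩, h2⟩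
    · rintro ⟨⟨h1, _⟩, h2⟩; exact ⟨h1, h2⟩
  rw [hset2, inter_comm, ← Measure.restrict_restrict measurableSet_Iio,
    ← integral_indicator measurableSet_Iio]
  congr 1
  ext s
  simp only [K, indicator, mem_Ioi, mem_Iio, smul_eq_mul]
  split_ifs <;> ring

/-- Uniqueness for the Volterra equation with kernel `κ_a`, by weighting with `exp(-L t)` for a
large rate `L`. -/
theorem eq_zero_of_volterra {a c T : ℝ} (ha : 0 < a) {z : ℝ → ℝ} (hz : ContinuousOn z (Icc 0 T))
    (heq : ∀ t ∈ Icc 0 T, z t = c * rlIntegral a z t) : ∀ t ∈ Icc 0 T, z t = 0 := by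
  rcases lt_or_ge T 0 with hT | hT
  · intro t ht; exact absurd (ht.1.trans ht.2) (not_le.2 hT)
  have hlim : Tendsto (fun L : ℝ => |c| * L ^ (-a)) atTop (𝓝 0) := by
    simpa using (tendsto_rpow_neg_atTop ha).const_mul |c|
  obtain ⟨L, hL, hL0⟩ := ((hlim.eventually (gt_mem_nhds one_pos)).and (eventually_gt_atTop 0)).exists
  -- the maximum `M` of the weighted function satisfies `M ≤ |c| L^{-a} M` with `|c| L^{-a} < 1`
  obtain ⟨t₁, ht₁, hmax⟩ := isCompact_Icc.exists_isMaxOn (nonempty_Icc.2 hT)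
    (f := fun t => Real.exp (-(L * t)) * |z t|) (by fun_prop)
  set M := Real.exp (-(L * t₁)) * |z t₁| with hM
  have hM0 : 0 ≤ M := by positivity
  have hbound : ∀ τ ∈ Icc 0 T, |z τ| ≤ M * Real.exp (L * τ) := fun τ hτ => by
    have := isMaxOn_iff.1 hmax τ hτ
    rw [Real.exp_neg] at this
    rwa [inv_mul_le_iff₀ (Real.exp_pos _), mul_comm] at this
  have hΓ := Real.Gamma_pos_of_pos ha
  have hker : IntegrableOn (fun r => kappa a r * Real.exp (-(L * r))) (Ioi 0) := by
    have h := (integrableOn_rpow_mul_exp_neg_mul_rpow (s := a - 1) (p := 1) (by linarith) one_pos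
      hL0).div_const (Real.Gamma a)
    refine IntegrableOn.congr_fun h (fun r _ => ?_) measurableSet_Ioi
    simp only [kappa, Real.rpow_one, neg_mul]
    ring
  have hkval : ∫ r in Ioi (0 : ℝ), kappa a r * Real.exp (-(L * r)) = L ^ (-a) := by
    have h := Real.integral_rpow_mul_exp_neg_mul_Ioi ha hL0
    have h2 : ∀ r, kappa a r * Real.exp (-(L * r)) =
        (Real.Gamma a)⁻¹ * (r ^ (a - 1) * Real.exp (-(L * r))) := fun r => by
      simp only [kappa]; ring
    simp only [h2]
    rw [integral_const_mul, h, one_div, Real.inv_rpow hL0.le, Real.rpow_neg hL0.le]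
    field_simp
  have hI : |rlIntegral a z t₁| ≤ M * Real.exp (L * t₁) * L ^ (-a) := by
    have h1 : |rlIntegral a z t₁| ≤
        ∫ s in (0 : ℝ)..t₁,
          M * Real.exp (L * t₁) * (kappa a (t₁ - s) * Real.exp (-(L * (t₁ - s)))) := by
      rw [rlIntegral, ← Real.norm_eq_abs]
      refine intervalIntegral.norm_integral_le_of_norm_le ht₁.1 ?_ ?_
      · refine Eventually.of_forall fun s hs => ?_
        have hk := kappa_nonneg ha (show 0 ≤ t₁ - s by linarith [hs.2])
        rw [norm_smul, Real.norm_of_nonneg hk, Real.norm_eq_abs]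
        calc _ ≤ kappa a (t₁ - s) * (M * Real.exp (L * s)) := by
              gcongr; exact hbound s ⟨hs.1.le, hs.2.trans ht₁.2⟩
          _ = M * (kappa a (t₁ - s) * (Real.exp (L * t₁) * Real.exp (-(L * (t₁ - s))))) := by
              rw [← Real.exp_add]; ring_nf
          _ = _ := by ring
      · refine IntervalIntegrable.const_mul ?_ _
        have h3 : IntervalIntegrable (fun r => kappa a r * Real.exp (-(L * r))) volume 0 t₁ := by
          rw [intervalIntegrable_iff_integrableOn_Ioc_of_le ht₁.1]
          exact hker.mono_set Ioc_subset_Ioi_self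
        have := (h3.comp_sub_left t₁).symm
        simpa using this
    refine h1.trans ?_
    rw [intervalIntegral.integral_const_mul]
    refine mul_le_mul_of_nonneg_left ?_ (by positivity)
    have h4 := intervalIntegral.integral_comp_sub_left (a := 0) (b := t₁)
      (fun r => kappa a r * Real.exp (-(L * r))) t₁
    rw [h4, sub_self, sub_zero, intervalIntegral.integral_of_le ht₁.1, ← hkval]
    refine setIntegral_mono_set hker ?_ (Eventually.of_forall fun _ h => h.1)
    filter_upwards [ae_restrict_mem measurableSet_Ioi] with r hr
    exact mul_nonneg (kappa_nonneg ha (le_of_lt hr)) (Real.exp_pos _).le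
  have hMle : M ≤ |c| * L ^ (-a) * M := by
    have h5 : |z t₁| ≤ |c| * (M * Real.exp (L * t₁) * L ^ (-a)) := by
      conv_lhs => rw [heq t₁ ht₁, abs_mul]
      gcongr
    calc M ≤ Real.exp (-(L * t₁)) * (|c| * (M * Real.exp (L * t₁) * L ^ (-a))) := by
          rw [hM] at *; gcongr
      _ = |c| * L ^ (-a) * M * (Real.exp (-(L * t₁)) * Real.exp (L * t₁)) := by ring
      _ = _ := by rw [← Real.exp_add]; simp
  have hM1 : M = 0 := by nlinarith
  intro t ht
  have := hbound t ht
  rw [hM1, zero_mul] at this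
  exact abs_nonpos_iff.1 this

/-! ### The modes -/

/-- The decay rate `μ^{1/α}` of the mode with eigenvalue `μ`. -/
def rate (α μ : ℝ) : ℝ := μ ^ α⁻¹

/-- The solution `E_α(-μ t^α)` of `∂ₜ^α e + μ e = 0`, `e(0) = 1`. -/
def mode (α μ t : ℝ) : ℝ := ml α 0 (rate α μ * t)

/-- The first derivative of `mode` in time. -/
def mode' (α μ t : ℝ) : ℝ := -(rate α μ * ml α 1 (rate α μ * t))

/-- The second derivative of `mode` in time. -/
def mode'' (α μ t : ℝ) : ℝ := rate α μ ^ 2 * ml α 2 (rate α μ * t)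

variable {μ : ℝ}

lemma rate_pos (hμ : 0 < μ) : 0 < rate α μ := Real.rpow_pos_of_pos hμ _

lemma rate_rpow (h0 : 0 < α) (hμ : 0 < μ) : rate α μ ^ α = μ := by
  rw [rate, ← Real.rpow_mul hμ.le, inv_mul_cancel₀ h0.ne', Real.rpow_one]

lemma rate_mul_rpow (h0 : 0 < α) (hμ : 0 < μ) {t : ℝ} (ht : 0 < t) :
    (rate α μ * t) ^ α = μ * t ^ α := by
  rw [Real.mul_rpow (rate_pos hμ).le ht.le, rate_rpow h0 hμ]

lemma hasDerivAt_mode (h0 : 0 < α) (h1 : α < 1) (hμ : 0 < μ) {t : ℝ} (ht : 0 < t) :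
    HasDerivAt (mode α μ) (mode' α μ t) t := by
  have h := (hasDerivAt_ml h0 h1 0 (mul_pos (rate_pos (α := α) hμ) ht)).comp t
    ((hasDerivAt_id t).const_mul (rate α μ))
  refine h.congr_deriv ?_
  simp only [mode']; ring

lemma hasDerivAt_mode' (h0 : 0 < α) (h1 : α < 1) (hμ : 0 < μ) {t : ℝ} (ht : 0 < t) :
    HasDerivAt (mode' α μ) (mode'' α μ t) t := by
  have h := (((hasDerivAt_ml h0 h1 1 (mul_pos (rate_pos (α := α) hμ) ht)).comp t
    ((hasDerivAt_id t).const_mul (rate α μ))).const_mul (rate α μ)).neg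
  refine h.congr_deriv ?_
  simp only [mode'']; ring

lemma continuousOn_mode (h0 : 0 < α) (h1 : α < 1) (hμ : 0 < μ) :
    ContinuousOn (mode α μ) (Ici 0) :=
  (continuousOn_ml_zero h0 h1).comp (by fun_prop) fun _ ht => mul_nonneg (rate_pos hμ).le ht

lemma continuousOn_mode' (h0 : 0 < α) (h1 : α < 1) (hμ : 0 < μ) :
    ContinuousOn (mode' α μ) (Ioi 0) :=
  fun _ ht => (hasDerivAt_mode' h0 h1 hμ ht).continuousAt.continuousWithinAt

lemma mode_zero (h0 : 0 < α) (h1 : α < 1) : mode α μ 0 = 1 := by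
  rw [mode, mul_zero, ml_zero_zero h0 h1]

lemma mode_nonneg (h0 : 0 < α) (h1 : α < 1) (t : ℝ) : 0 ≤ mode α μ t := ml_nonneg h0 h1 _ _

lemma mode_le_one (h0 : 0 < α) (h1 : α < 1) (hμ : 0 < μ) {t : ℝ} (ht : 0 ≤ t) :
    mode α μ t ≤ 1 := ml_zero_le_one h0 h1 (mul_nonneg (rate_pos hμ).le ht)

/-- A common constant for all bounds of the modes. -/
def modeConst (α : ℝ) : ℝ :=
  1 + densConst α * (expConst (0 + α) + (expConst (1 + α) + expConst (1 - α)) +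
    (expConst (2 + α) + expConst (2 - α)))

lemma one_le_modeConst (h0 : 0 < α) (h1 : α < 1) : 1 ≤ modeConst α := by
  have := densConst_pos h0 h1
  have h := expConst_nonneg
  have : 0 ≤ densConst α * (expConst (0 + α) + (expConst (1 + α) + expConst (1 - α)) +
    (expConst (2 + α) + expConst (2 - α))) :=
    mul_nonneg this.le (by linarith [h (0 + α), h (1 + α), h (1 - α), h (2 + α), h (2 - α)])
  unfold modeConst; linarith

lemma const_le_modeConst (h0 : 0 < α) (h1 : α < 1) :
    densConst α * expConst (0 + α) ≤ modeConst α ∧ densConst α * expConst (1 + α) ≤ modeConst α ∧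
    densConst α * expConst (1 - α) ≤ modeConst α ∧ densConst α * expConst (2 + α) ≤ modeConst α ∧
    densConst α * expConst (2 - α) ≤ modeConst α := by
  have hd := (densConst_pos h0 h1).le
  have h := fun β => mul_nonneg hd (expConst_nonneg β)
  have := h (0 + α); have := h (1 + α); have := h (1 - α); have := h (2 + α); have := h (2 - α)
  unfold modeConst
  refine ⟨?_, ?_, ?_, ?_, ?_⟩ <;> nlinarith

lemma ml_scaled_le {s c C : ℝ} (hs : 0 < s) {k : ℕ} {γ : ℝ} (h : ml α k s ≤ c * s ^ (-(k + γ)))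
    (hc : c ≤ C) : s ^ k * ml α k s ≤ C * s ^ (-γ) := by
  have := Real.rpow_pos_of_pos hs (-γ)
  calc s ^ k * ml α k s ≤ s ^ k * (c * s ^ (-(k + γ))) := by gcongr
    _ = c * s ^ (-γ) := by
      rw [← Real.rpow_natCast, mul_left_comm, ← Real.rpow_add hs]; congr 2; ring
    _ ≤ _ := by gcongr

/-- The bounds of `ml α k`, multiplied by `s^k`, with the common constant. -/
lemma scaled_ml_le (h0 : 0 < α) (h1 : α < 1) {s : ℝ} (hs : 0 < s) :
    ml α 0 s ≤ modeConst α * s ^ (-α) ∧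
    s ^ 1 * ml α 1 s ≤ modeConst α * s ^ (-α) ∧ s ^ 1 * ml α 1 s ≤ modeConst α * s ^ α ∧
    s ^ 2 * ml α 2 s ≤ modeConst α * s ^ (-α) ∧ s ^ 2 * ml α 2 s ≤ modeConst α * s ^ α := by
  obtain ⟨c0, c1, c1', c2, c2'⟩ := const_le_modeConst h0 h1
  refine ⟨?_, ?_, ?_, ?_, ?_⟩
  · have := ml_scaled_le hs (ml_le_large h0 h1 0 hs) (C := modeConst α) (by simpa using c0)
    simpa using this
  · exact ml_scaled_le hs (ml_le_large h0 h1 1 hs) (by simpa using c1)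
  · have := ml_scaled_le (γ := -α) (C := modeConst α) hs
      (by simpa only [sub_eq_add_neg] using ml_le_small h0 h1 le_rfl hs)
      (by simpa [sub_eq_add_neg] using c1')
    rwa [neg_neg] at this
  · exact ml_scaled_le hs (ml_le_large h0 h1 2 hs) (by simpa using c2)
  · have := ml_scaled_le (γ := -α) (C := modeConst α) hs
      (by simpa only [sub_eq_add_neg] using ml_le_small h0 h1 one_le_two hs)
      (by simpa [sub_eq_add_neg] using c2')
    rwa [neg_neg] at this

/-- The decay of the modes for `μ t^α ≥ 1`. -/
lemma mode_le (h0 : 0 < α) (h1 : α < 1) (hμ : 0 < μ) {t : ℝ} (ht : 0 < t) :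
    mode α μ t ≤ modeConst α * (μ * t ^ α)⁻¹ := by
  have hs := mul_pos (rate_pos (α := α) hμ) ht
  have := (scaled_ml_le h0 h1 hs).1
  rwa [Real.rpow_neg hs.le, rate_mul_rpow h0 hμ ht] at this

/-- The two regimes `μ t^α ≥ 1` and `μ t^α ≤ 1` of the first derivative. -/
lemma abs_mode'_le (h0 : 0 < α) (h1 : α < 1) (hμ : 0 < μ) {t : ℝ} (ht : 0 < t) :
    t * |mode' α μ t| ≤ modeConst α * (μ * t ^ α)⁻¹ ∧
    t * |mode' α μ t| ≤ modeConst α * (μ * t ^ α) := by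
  have hr := rate_pos (α := α) hμ
  have hs := mul_pos hr ht
  obtain ⟨_, h2, h3, _, _⟩ := scaled_ml_le h0 h1 hs
  rw [Real.rpow_neg hs.le] at h2
  rw [rate_mul_rpow h0 hμ ht] at h2 h3
  have he : t * |mode' α μ t| = (rate α μ * t) ^ 1 * ml α 1 (rate α μ * t) := by
    rw [mode', abs_neg, abs_of_nonneg (mul_nonneg hr.le (ml_nonneg h0 h1 _ _))]; ring
  rw [he]
  exact ⟨h2, h3⟩

/-- The two regimes `μ t^α ≥ 1` and `μ t^α ≤ 1` of the second derivative. -/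
lemma abs_mode''_le (h0 : 0 < α) (h1 : α < 1) (hμ : 0 < μ) {t : ℝ} (ht : 0 < t) :
    t ^ 2 * |mode'' α μ t| ≤ modeConst α * (μ * t ^ α)⁻¹ ∧
    t ^ 2 * |mode'' α μ t| ≤ modeConst α * (μ * t ^ α) := by
  have hr := rate_pos (α := α) hμ
  have hs := mul_pos hr ht
  obtain ⟨_, _, _, h2, h3⟩ := scaled_ml_le h0 h1 hs
  rw [Real.rpow_neg hs.le] at h2
  rw [rate_mul_rpow h0 hμ ht] at h2 h3
  have he : t ^ 2 * |mode'' α μ t| = (rate α μ * t) ^ 2 * ml α 2 (rate α μ * t) := by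
    rw [mode'', abs_of_nonneg (mul_nonneg (by positivity) (ml_nonneg h0 h1 _ _))]; ring
  rw [he]
  exact ⟨h2, h3⟩

/-- Interpolation between `m ≤ C` and `x m ≤ C`. -/
lemma rpow_mul_le_of_le_inv {x p m C : ℝ} (hx : 0 < x) (hp : p ∈ Icc (0 : ℝ) 1) (hm : 0 ≤ m)
    (h1 : m ≤ C) (h2 : m ≤ C * x⁻¹) : x ^ p * m ≤ C := by
  rcases le_total x 1 with h | h
  · calc x ^ p * m ≤ 1 * m := by gcongr; exact Real.rpow_le_one hx.le h hp.1
      _ ≤ C := by linarith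
  · calc x ^ p * m ≤ x ^ (1 : ℝ) * (C * x⁻¹) := by gcongr; exact hp.2
      _ = C := by rw [Real.rpow_one]; field_simp

lemma le_of_le_min {x m C : ℝ} (hC : 0 ≤ C) (h1 : m ≤ C * x⁻¹) (h2 : m ≤ C * x) :
    m ≤ C := by
  rcases le_total x 1 with h | h
  · exact h2.trans (mul_le_of_le_one_right hC h)
  · exact h1.trans (mul_le_of_le_one_right hC (inv_le_one_of_one_le₀ h))

/-- Turns powers of `μ` into powers of the dimensionless variable `μ t^α`. -/
lemma rpow_mul_rpow (h : 0 < μ) {t : ℝ} (ht : 0 < t) (p : ℝ) :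
    μ ^ p = (μ * t ^ α) ^ p * t ^ (-(α * p)) := by
  rw [Real.mul_rpow h.le (by positivity), ← Real.rpow_mul ht.le, mul_assoc, ← Real.rpow_add ht]
  simp

lemma rpow_mul_mode_le (h0 : 0 < α) (h1 : α < 1) (hμ : 0 < μ) {t p : ℝ} (ht : 0 < t)
    (hp : p ∈ Icc (0 : ℝ) 1) : μ ^ p * |mode α μ t| ≤ modeConst α * t ^ (-(α * p)) := by
  have hx : 0 < μ * t ^ α := by positivity
  rw [abs_of_nonneg (mode_nonneg h0 h1 t), rpow_mul_rpow (α := α) hμ ht, mul_right_comm]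
  gcongr
  exact rpow_mul_le_of_le_inv hx hp (mode_nonneg h0 h1 t)
    ((mode_le_one h0 h1 hμ ht.le).trans (one_le_modeConst h0 h1)) (mode_le h0 h1 hμ ht)

lemma mul_abs_mode'_le (h0 : 0 < α) (h1 : α < 1) (hμ : 0 < μ) {t : ℝ} (ht : 0 < t) :
    t * |mode' α μ t| ≤ modeConst α :=
  le_of_le_min (by linarith [one_le_modeConst h0 h1])
    (abs_mode'_le h0 h1 hμ ht).1 (abs_mode'_le h0 h1 hμ ht).2

lemma rpow_mul_mode'_le (h0 : 0 < α) (h1 : α < 1) (hμ : 0 < μ) {t p : ℝ} (ht : 0 < t)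
    (hp : p ∈ Icc (0 : ℝ) 1) : μ ^ p * |mode' α μ t| ≤ modeConst α * t ^ (-(1 + α * p)) := by
  have hx : 0 < μ * t ^ α := by positivity
  have h := rpow_mul_le_of_le_inv hx hp (by positivity) (mul_abs_mode'_le h0 h1 hμ ht)
    (abs_mode'_le h0 h1 hμ ht).1
  have e : t ^ (-(1 + α * p)) = t⁻¹ * t ^ (-(α * p)) := by
    rw [neg_add, Real.rpow_add ht, Real.rpow_neg_one]
  calc μ ^ p * |mode' α μ t| = ((μ * t ^ α) ^ p * (t * |mode' α μ t|)) * (t⁻¹ * t ^ (-(α * p))) := by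
        rw [rpow_mul_rpow (α := α) hμ ht]; field_simp
    _ ≤ _ := by rw [e]; gcongr

lemma rpow_mul_mode'_le_smooth (h0 : 0 < α) (h1 : α < 1) (hμ : 0 < μ) {t p : ℝ} (ht : 0 < t)
    (hp : p ∈ Icc (0 : ℝ) 1) :
    μ ^ p * |mode' α μ t| ≤ modeConst α * t ^ (-(1 + α * (p - 1))) * μ := by
  have hx : 0 < μ * t ^ α := by positivity
  obtain ⟨h2, h3⟩ := abs_mode'_le h0 h1 hμ ht
  have hC : 0 < modeConst α := by linarith [one_le_modeConst h0 h1]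
  have h : (μ * t ^ α) ^ p * (t * |mode' α μ t|) ≤ modeConst α * (μ * t ^ α) := by
    rcases le_total (μ * t ^ α) 1 with hx1 | hx1
    · calc _ ≤ 1 * (t * |mode' α μ t|) := by gcongr; exact Real.rpow_le_one hx.le hx1 hp.1
        _ ≤ _ := by linarith
    · calc _ ≤ (μ * t ^ α) ^ (1 : ℝ) * (modeConst α * (μ * t ^ α)⁻¹) := by gcongr; exact hp.2
        _ = modeConst α * 1 := by rw [Real.rpow_one]; field_simp
        _ ≤ _ := by gcongr
  have e : t ^ (-(1 + α * (p - 1))) = t⁻¹ * t ^ (-(α * p)) * t ^ α := by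
    rw [← Real.rpow_neg_one, ← Real.rpow_add ht, ← Real.rpow_add ht]; congr 1; ring
  calc μ ^ p * |mode' α μ t| = ((μ * t ^ α) ^ p * (t * |mode' α μ t|)) * (t⁻¹ * t ^ (-(α * p))) := by
        rw [rpow_mul_rpow (α := α) hμ ht]; field_simp
    _ ≤ modeConst α * (μ * t ^ α) * (t⁻¹ * t ^ (-(α * p))) := by gcongr
    _ = _ := by rw [e]; ring

lemma abs_mode''_le_rpow (h0 : 0 < α) (h1 : α < 1) (hμ : 0 < μ) {t : ℝ} (ht : 0 < t) :
    |mode'' α μ t| ≤ modeConst α * t ^ (-2 : ℝ) := by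
  have h := le_of_le_min (by linarith [one_le_modeConst h0 h1])
    (abs_mode''_le h0 h1 hμ ht).1 (abs_mode''_le h0 h1 hμ ht).2
  have e : t ^ (-2 : ℝ) = (t ^ 2)⁻¹ := by
    rw [Real.rpow_neg ht.le]; norm_cast
  rw [e, ← div_eq_mul_inv, le_div_iff₀ (by positivity), mul_comm]
  exact h

lemma abs_mode''_le_smooth (h0 : 0 < α) (h1 : α < 1) (hμ : 0 < μ) {t : ℝ} (ht : 0 < t) :
    |mode'' α μ t| ≤ modeConst α * t ^ (α - 2) * μ := by
  have h := (abs_mode''_le h0 h1 hμ ht).2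
  have e : t ^ (α - 2) = t ^ α * (t ^ 2)⁻¹ := by
    rw [Real.rpow_sub ht, div_eq_mul_inv]; norm_cast
  rw [e, ← mul_assoc, mul_right_comm, ← div_eq_mul_inv, le_div_iff₀ (by positivity)]
  calc _ = t ^ 2 * |mode'' α μ t| := by ring
    _ ≤ _ := h
    _ = _ := by ring

/-! ### The modes solve the fractional equation -/

/-- The scaling `t ↦ μ^{1/α} t` turns the equation of the Mittag-Leffler function into
`∂ₜ^α e + μ e = 0`. -/
lemma rlIntegral_mode' (h0 : 0 < α) (h1 : α < 1) (hμ : 0 < μ) {t : ℝ} (ht : 0 < t) :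
    rlIntegral (1 - α) (mode' α μ) t = -μ * mode α μ t := by
  have hr := rate_pos (α := α) hμ
  have hs := mul_pos hr ht
  have h := rlIntegral_ml_one h0 h1 hs
  rw [rlIntegral_scale _ _ hs] at h
  rw [rlIntegral_scale _ _ ht, mode, ← h]
  simp only [mode', mul_neg, intervalIntegral.integral_neg]
  have e : (rate α μ * t) ^ (1 - α) = rate α μ * μ⁻¹ * t ^ (1 - α) := by
    rw [Real.mul_rpow hr.le ht.le, Real.rpow_sub hr, Real.rpow_one, rate_rpow h0 hμ]; ring
  have : ∀ σ : ℝ, kappa (1 - α) (1 - σ) * (rate α μ * ml α 1 (rate α μ * (t * σ))) =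
      rate α μ * (kappa (1 - α) (1 - σ) * ml α 1 (rate α μ * t * σ)) := fun σ => by
    rw [mul_assoc (rate α μ) t σ]; ring
  simp only [this]
  rw [intervalIntegral.integral_const_mul, e]
  generalize (∫ σ in (0 : ℝ)..1, kappa (1 - α) (1 - σ) * ml α 1 (rate α μ * t * σ)) = J
  field_simp

lemma integrableOn_mode' (h0 : 0 < α) (h1 : α < 1) (hμ : 0 < μ) (t : ℝ) :
    IntegrableOn (mode' α μ) (Ioc 0 t) := by
  rcases le_or_gt t 0 with ht | ht
  · simp [Ioc_eq_empty_of_le ht]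
  have hI : IntegrableOn (fun s : ℝ => modeConst α * μ * s ^ (α - 1)) (Ioc 0 t) := by
    rw [← intervalIntegrable_iff_integrableOn_Ioc_of_le ht.le]
    exact (intervalIntegral.intervalIntegrable_rpow' (by linarith)).const_mul _
  refine Integrable.mono' hI ?_ ?_
  · exact ((continuousOn_mode' h0 h1 hμ).mono Ioc_subset_Ioi_self).aestronglyMeasurable
      measurableSet_Ioc
  · filter_upwards [ae_restrict_mem measurableSet_Ioc] with s hs
    have h := (abs_mode'_le h0 h1 hμ hs.1).2
    rw [Real.norm_eq_abs, Real.rpow_sub_one hs.1.ne', ← mul_div_assoc, le_div_iff₀ hs.1]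
    linarith

lemma mode_eq_integral (h0 : 0 < α) (h1 : α < 1) (hμ : 0 < μ) {t : ℝ} (ht : 0 ≤ t) :
    mode α μ t = 1 + ∫ s in (0 : ℝ)..t, mode' α μ s := by
  rw [intervalIntegral.integral_eq_sub_of_hasDerivAt_of_le ht
    ((continuousOn_mode h0 h1 hμ).mono Icc_subset_Ici_self)
    (fun s hs => hasDerivAt_mode h0 h1 hμ hs.1)
    ((intervalIntegrable_iff_integrableOn_Ioc_of_le ht).2 (integrableOn_mode' h0 h1 hμ t)),
    mode_zero h0 h1]
  ring

/-- Applying `I^α` to `I^{1-α} h + μ y = 0` gives a Volterra equation. -/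
lemma eq_add_rlIntegral (h0 : 0 < α) (h1 : α < 1) {T : ℝ} {y h : ℝ → ℝ}
    (hh : IntegrableOn h (Ioo 0 T)) (hy : ∀ t ∈ Icc 0 T, y t = y 0 + ∫ s in (0 : ℝ)..t, h s)
    (heq : ∀ᵐ t ∂volume.restrict (Ioo 0 T), rlIntegral (1 - α) h t + μ * y t = 0) :
    ∀ t ∈ Icc 0 T, y t = y 0 + -μ * rlIntegral α y t := by
  intro t ht
  have hhT := hh.mono_set (Ioo_subset_Ioo_right ht.2)
  rw [hy t ht, ← rlIntegral_rlIntegral h0 (sub_pos.2 h1) (by ring) ht.1 hhT]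
  congr 1
  simp only [rlIntegral, smul_eq_mul]
  rw [← intervalIntegral.integral_const_mul]
  refine intervalIntegral.integral_congr_ae_restrict ?_
  rw [uIoc_of_le ht.1, ← restrict_Ioo_eq_restrict_Ioc]
  filter_upwards [ae_restrict_of_ae_restrict_of_subset (Ioo_subset_Ioo_right ht.2) heq] with τ hτ
  simp only [rlIntegral, smul_eq_mul] at hτ
  rw [eq_neg_of_add_eq_zero_left hτ]
  ring

lemma continuousOn_of_eq_integral {T : ℝ} {X : Type*} [NormedAddCommGroup X] [NormedSpace ℝ X]
    {y h : ℝ → X} (hh : IntegrableOn h (Ioo 0 T))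
    (hy : ∀ t ∈ Icc 0 T, y t = y 0 + ∫ s in (0 : ℝ)..t, h s) : ContinuousOn y (Icc 0 T) := by
  rcases lt_or_ge T 0 with hT | hT
  · simp [Icc_eq_empty_of_lt hT]
  rw [← integrableOn_Icc_iff_integrableOn_Ioo, ← uIcc_of_le hT] at hh
  have h1 := intervalIntegral.continuousOn_primitive_interval hh
  rw [uIcc_of_le hT] at h1
  exact (continuousOn_const.add h1).congr hy

/-- Uniqueness for the scalar equation `∂ₜ^α y + μ y = 0`. -/
theorem eq_mode_of_equation (h0 : 0 < α) (h1 : α < 1) (hμ : 0 < μ) {T : ℝ} {y h : ℝ → ℝ}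
    (hh : IntegrableOn h (Ioo 0 T)) (hy : ∀ t ∈ Icc 0 T, y t = y 0 + ∫ s in (0 : ℝ)..t, h s)
    (heq : ∀ᵐ t ∂volume.restrict (Ioo 0 T), rlIntegral (1 - α) h t + μ * y t = 0) :
    ∀ t ∈ Icc 0 T, y t = y 0 * mode α μ t := by
  have hyc : ContinuousOn y (Icc 0 T) := continuousOn_of_eq_integral hh hy
  have hmc : ContinuousOn (mode α μ) (Icc 0 T) :=
    (continuousOn_mode h0 h1 hμ).mono Icc_subset_Ici_self
  have hyV := eq_add_rlIntegral h0 h1 hh hy heq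
  have hmV := eq_add_rlIntegral (T := T) (μ := μ) (y := mode α μ) h0 h1
    ((integrableOn_mode' h0 h1 hμ T).mono_set Ioo_subset_Ioc_self)
    (fun t ht => by rw [mode_zero h0 h1, mode_eq_integral h0 h1 hμ ht.1]) (by
      filter_upwards [ae_restrict_mem measurableSet_Ioo] with t ht
      rw [rlIntegral_mode' h0 h1 hμ ht.1]; ring)
  have hz := eq_zero_of_volterra h0 (c := -μ) (z := fun t => y t - y 0 * mode α μ t)
    (hyc.sub (continuousOn_const.mul hmc)) (fun t ht => by
      have hint : ∀ {v : ℝ → ℝ}, ContinuousOn v (Icc 0 T) →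
          IntervalIntegrable (fun s => kappa α (t - s) * v s) volume 0 t := fun hv => by
        have hk : IntervalIntegrable (fun s => kappa α (t - s)) volume 0 t := by
          simpa using ((intervalIntegrable_kappa h0 0 t).comp_sub_left t).symm
        refine hk.mul_continuousOn (hv.mono ?_)
        rw [uIcc_of_le ht.1]
        exact Icc_subset_Icc_right ht.2
      have hsub : rlIntegral α (fun t => y t - y 0 * mode α μ t) t =
          rlIntegral α y t - y 0 * rlIntegral α (mode α μ) t := by
        simp only [rlIntegral, smul_eq_mul]
        rw [← intervalIntegral.integral_const_mul, ← intervalIntegral.integral_sub (hint hyc)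
          ((hint hmc).const_mul _)]
        congr 1; ext s; ring
      rw [hsub, hyV t ht, hmV t ht, mode_zero h0 h1]
      have h2 := hyV 0 ⟨le_rfl, ht.1.trans ht.2⟩
      ring_nf)
  intro t ht
  have := hz t ht
  linarith

end

end MittagLeffler

namespace FracBiharmonic

section

variable {Ω : Set Plane} {ψ χ : Plane → ℝ}

/-! ### Test functions and integration by parts -/

lemma contDiff_pd (h : ContDiff ℝ ((⊤ : ℕ∞) : WithTop ℕ∞) ψ) (i : Fin 2) :
    ContDiff ℝ ((⊤ : ℕ∞) : WithTop ℕ∞) (pd i ψ) :=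
  (h.fderiv_right (m := ((⊤ : ℕ∞) : WithTop ℕ∞)) (by simp)).clm_apply contDiff_const

lemma tsupport_pd_subset (i : Fin 2) : tsupport (pd i ψ) ⊆ tsupport ψ :=
  tsupport_fderiv_apply_subset ℝ _

lemma IsTest.pd (h : IsTest Ω ψ) (i : Fin 2) : IsTest Ω (pd i ψ) where
  smooth := contDiff_pd h.smooth i
  compact := h.compact.fderiv_apply ℝ _
  supp := (tsupport_pd_subset i).trans h.supp

lemma IsTest.zero : IsTest Ω (0 : Plane → ℝ) where
  smooth := contDiff_const
  compact := HasCompactSupport.zero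
  supp := by simp

lemma IsTest.add (h : IsTest Ω ψ) (h' : IsTest Ω χ) : IsTest Ω (ψ + χ) where
  smooth := h.smooth.add h'.smooth
  compact := h.compact.add h'.compact
  supp := (tsupport_add ψ χ).trans (union_subset h.supp h'.supp)

lemma IsTest.smul (h : IsTest Ω ψ) (c : ℝ) : IsTest Ω (c • ψ) where
  smooth := contDiff_const.smul h.smooth
  compact := h.compact.smul_left (f := fun _ => c)
  supp := (tsupport_smul_subset_right (fun _ => c) ψ).trans h.supp

lemma IsTest.differentiable (h : IsTest Ω ψ) : Differentiable ℝ ψ :=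
  h.smooth.differentiable (by simp)

lemma pd_add (i : Fin 2) (h : Differentiable ℝ ψ) (h' : Differentiable ℝ χ) :
    pd i (ψ + χ) = pd i ψ + pd i χ := by
  ext x
  simp [pd, fderiv_add (h x) (h' x)]

lemma pd_smul (i : Fin 2) (h : Differentiable ℝ ψ) (c : ℝ) : pd i (c • ψ) = c • pd i ψ := by
  ext x
  simp [pd, fderiv_const_smul (h x) c]

lemma pd_zero (i : Fin 2) : pd i (0 : Plane → ℝ) = 0 := by
  ext x
  simp [pd]

/-- Symmetry of second derivatives. -/
lemma pd_comm (h : ContDiff ℝ ((⊤ : ℕ∞) : WithTop ℕ∞) ψ) (i j : Fin 2) :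
    pd i (pd j ψ) = pd j (pd i ψ) := by
  ext x
  have hd : DifferentiableAt ℝ (fderiv ℝ ψ) x :=
    (h.fderiv_right (m := ((⊤ : ℕ∞) : WithTop ℕ∞)) (by simp)).differentiable (by simp) x
  have hsymm : IsSymmSndFDerivAt ℝ ψ x :=
    h.contDiffAt.isSymmSndFDerivAt (by
    simpa using WithTop.coe_le_coe.2 (le_top (a := (2 : ℕ∞))))
  have e : ∀ v w : Plane, fderiv ℝ (fun y => fderiv ℝ ψ y v) x w =
      fderiv ℝ (fderiv ℝ ψ) x w v := fun v w => by
    rw [fderiv_clm_apply hd (differentiableAt_const v)]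
    simp
  unfold pd
  rw [e, e]
  exact hsymm _ _

lemma laplacian_eq_sum_pd (h : ContDiff ℝ ((⊤ : ℕ∞) : WithTop ℕ∞) ψ) :
    Δ ψ = fun x => ∑ i, pd i (pd i ψ) x := by
  ext x
  rw [InnerProductSpace.laplacian_eq_iteratedFDeriv_orthonormalBasis ψ
    (EuclideanSpace.basisFun (Fin 2) ℝ)]
  refine Finset.sum_congr rfl fun i _ => ?_
  have hd : DifferentiableAt ℝ (fderiv ℝ ψ) x :=
    (h.fderiv_right (m := ((⊤ : ℕ∞) : WithTop ℕ∞)) (by simp)).differentiable (by simp) x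
  rw [iteratedFDeriv_two_apply]
  unfold pd
  rw [fderiv_clm_apply hd (differentiableAt_const _)]
  simp

lemma bilaplacian_eq_sum_pd (h : ContDiff ℝ ((⊤ : ℕ∞) : WithTop ℕ∞) ψ) (x : Plane) :
    Δ (Δ ψ) x = ∑ i, ∑ j, pd j (pd i (pd i (pd j ψ))) x := by
  have hpd := fun i => contDiff_pd h i
  have hpp := fun i j => contDiff_pd (hpd i) j
  have e : (fun x => ∑ i, pd i (pd i ψ) x) = pd 0 (pd 0 ψ) + pd 1 (pd 1 ψ) := by
    ext x; simp [Fin.sum_univ_two]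
  rw [laplacian_eq_sum_pd h, e,
    laplacian_eq_sum_pd (ψ := pd 0 (pd 0 ψ) + pd 1 (pd 1 ψ)) ((hpp 0 0).add (hpp 1 1))]
  have d : ∀ {f : Plane → ℝ}, ContDiff ℝ ((⊤ : ℕ∞) : WithTop ℕ∞) f → Differentiable ℝ f :=
    fun hf => hf.differentiable (by simp)
  have e2 : ∀ i, pd i (pd i (pd 0 (pd 0 ψ) + pd 1 (pd 1 ψ))) =
      pd i (pd i (pd 0 (pd 0 ψ))) + pd i (pd i (pd 1 (pd 1 ψ))) := fun i => by
    rw [pd_add _ (d (hpp 0 0)) (d (hpp 1 1)), pd_add _ (d (contDiff_pd (hpp 0 0) i))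
      (d (contDiff_pd (hpp 1 1) i))]
  have e3 : ∀ i j, pd j (pd i (pd i (pd j ψ))) = pd i (pd i (pd j (pd j ψ))) := fun i j => by
    rw [pd_comm (contDiff_pd (hpd j) i) j i, pd_comm (hpd j) j i]
  refine Finset.sum_congr rfl fun i _ => ?_
  rw [e2, Fin.sum_univ_two, e3, e3]
  rfl

lemma IsTest.integrable_mul (h : IsTest Ω ψ) {f : Plane → ℝ} (hf : Continuous f) :
    Integrable fun x => f x * ψ x :=
  (hf.mul h.smooth.continuous).integrable_of_hasCompactSupport h.compact.mul_left

/-- Integration by parts against a test function. -/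
lemma integral_pd_mul (h : IsTest Ω χ) {f : Plane → ℝ}
    (hf : ContDiff ℝ ((⊤ : ℕ∞) : WithTop ℕ∞) f) (i : Fin 2) :
    ∫ x, pd i f x * χ x = -∫ x, f x * pd i χ x := by
  have := integral_mul_fderiv_eq_neg_fderiv_mul_of_integrable (μ := (volume : Measure Plane))
    (f := f) (g := χ) (v := EuclideanSpace.single i 1)
    (h.integrable_mul (contDiff_pd hf i).continuous) ((h.pd i).integrable_mul hf.continuous)
    (h.integrable_mul hf.continuous) (fun x _ => hf.differentiable (by simp) x)
    (fun x _ => h.differentiable x)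
  simp only [pd]
  rw [this, neg_neg]

lemma IsTest.eq_zero (h : IsTest Ω ψ) {x : Plane} (hx : x ∉ Ω) : ψ x = 0 :=
  image_eq_zero_of_notMem_tsupport fun h' => hx (h.supp h')

lemma IsTest.setIntegral_mul (h : IsTest Ω ψ) (f : Plane → ℝ) :
    ∫ x in Ω, f x * ψ x = ∫ x, f x * ψ x :=
  setIntegral_eq_integral_of_forall_compl_eq_zero fun x hx => by rw [h.eq_zero hx, mul_zero]

lemma IsTest.memLp (h : IsTest Ω ψ) : MemLp ψ 2 (volume.restrict Ω) :=
  (h.smooth.continuous.memLp_of_hasCompactSupport h.compact).restrict Ω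

/-- A test function as an element of `L²(Ω)`. -/
def IsTest.toLp (h : IsTest Ω ψ) : L2 Ω := h.memLp.toLp ψ

lemma IsTest.coeFn_toLp (h : IsTest Ω ψ) : h.toLp =ᵐ[volume.restrict Ω] ψ := h.memLp.coeFn_toLp

lemma inner_eq_integral (f g : L2 Ω) : ⟪f, g⟫ = ∫ x in Ω, f x * g x := by
  rw [L2.inner_def]
  refine integral_congr_ae (Eventually.of_forall fun x => ?_)
  simp [mul_comm]

lemma inner_toLp (f : L2 Ω) (h : IsTest Ω ψ) : ⟪f, h.toLp⟫ = ∫ x in Ω, f x * ψ x := by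
  rw [inner_eq_integral]
  refine integral_congr_ae ?_
  filter_upwards [h.coeFn_toLp] with x hx
  rw [hx]

lemma inner_toLp_toLp (h : IsTest Ω ψ) (h' : IsTest Ω χ) : ⟪h.toLp, h'.toLp⟫ = ∫ x, ψ x * χ x := by
  rw [inner_toLp, ← h'.setIntegral_mul]
  refine integral_congr_ae ?_
  filter_upwards [h.coeFn_toLp] with x hx
  rw [hx]

lemma inner_pd_toLp (h : IsTest Ω ψ) (h' : IsTest Ω χ) (i : Fin 2) :
    ⟪(h.pd i).toLp, h'.toLp⟫ = -⟪h.toLp, (h'.pd i).toLp⟫ := by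
  rw [inner_toLp_toLp, inner_toLp_toLp, integral_pd_mul h' h.smooth]

/-- By the fundamental lemma of the calculus of variations, test functions are total in `L²`. -/
lemma eq_zero_of_inner_toLp (hΩ : IsOpen Ω) {f : L2 Ω}
    (hf : ∀ (ψ : Plane → ℝ) (h : IsTest Ω ψ), ⟪f, h.toLp⟫ = 0) : f = 0 := by
  have hloc : LocallyIntegrableOn f Ω (volume : Measure Plane) := by
    have h1 : LocallyIntegrable f (volume.restrict Ω) := (Lp.memLp f).locallyIntegrable (by norm_num)
    exact locallyIntegrableOn_of_locallyIntegrable_restrict h1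
  have := hΩ.ae_eq_zero_of_integral_contDiff_smul_eq_zero hloc fun g hg hgc hgs => by
    have ht : IsTest Ω g := ⟨hg, hgc, hgs⟩
    have h2 := hf g ht
    rw [inner_toLp, ht.setIntegral_mul] at h2
    simpa [smul_eq_mul, mul_comm] using h2
  rw [Lp.eq_zero_iff_ae_eq_zero]
  exact (ae_restrict_iff' hΩ.measurableSet).2 this

/-! ### The space `H²₀(Ω)` -/

/-- `hess` as a continuous linear map. -/
def hessL (Ω : Set Plane) (i j : Fin 2) : V Ω →L[ℝ] L2 Ω :=
  (PiLp.proj 2 (fun _ : JetIdx => L2 Ω) (Sum.inr (Sum.inr (i, j)))).comp (V.jet Ω)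

lemma continuous_hess (i j : Fin 2) : Continuous fun v : V Ω => hess v i j :=
  (hessL Ω i j).continuous

/-- The jet of a test function. -/
def IsTest.jet (h : IsTest Ω ψ) : Jet Ω := WithLp.toLp 2 fun
  | Sum.inl () => h.toLp
  | Sum.inr (Sum.inl i) => (h.pd i).toLp
  | Sum.inr (Sum.inr (i, j)) => ((h.pd j).pd i).toLp

lemma IsTest.isJetOf (h : IsTest Ω ψ) : IsJetOf Ω h.jet ψ :=
  ⟨h.coeFn_toLp, fun i => (h.pd i).coeFn_toLp, fun i j => ((h.pd j).pd i).coeFn_toLp⟩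

lemma IsJetOf.eq_jet {J : Jet Ω} (hJ : IsJetOf Ω J ψ) (h : IsTest Ω ψ) : J = h.jet := by
  ext1 k
  rcases k with ⟨⟩ | i | ⟨i, j⟩
  · exact Lp.ext (hJ.1.trans h.coeFn_toLp.symm)
  · exact Lp.ext ((hJ.2.1 i).trans (h.pd i).coeFn_toLp.symm)
  · exact Lp.ext ((hJ.2.2 i j).trans ((h.pd j).pd i).coeFn_toLp.symm)

/-- A test function as an element of `V`. -/
def IsTest.toV (h : IsTest Ω ψ) : V Ω :=
  (⟨h.jet, Submodule.le_topologicalClosure _ (Submodule.subset_span ⟨ψ, h, h.isJetOf⟩)⟩ : H20 Ω)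

lemma toL2_toV (h : IsTest Ω ψ) : toL2 Ω h.toV = h.toLp := rfl

lemma hess_toV (h : IsTest Ω ψ) (i j : Fin 2) : hess h.toV i j = ((h.pd j).pd i).toLp := rfl

/-- The jets of test functions already form a subspace. -/
lemma exists_isTest_of_mem_span {J : Jet Ω}
    (hJ : J ∈ Submodule.span ℝ {J : Jet Ω | ∃ ψ, IsTest Ω ψ ∧ IsJetOf Ω J ψ}) :
    ∃ ψ, IsTest Ω ψ ∧ IsJetOf Ω J ψ := by
  induction hJ using Submodule.span_induction with
  | mem J h => exact h
  | zero =>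
    refine ⟨0, IsTest.zero, ?_, fun i => ?_, fun i j => ?_⟩
    · exact Lp.coeFn_zero _ _ _
    · rw [pd_zero]; exact Lp.coeFn_zero _ _ _
    · rw [pd_zero, pd_zero]; exact Lp.coeFn_zero _ _ _
  | add J J' _ _ h h' =>
    obtain ⟨ψ, h, hJ⟩ := h
    obtain ⟨χ, h', hJ'⟩ := h'
    refine ⟨ψ + χ, h.add h', ?_, fun i => ?_, fun i j => ?_⟩
    · exact (Lp.coeFn_add _ _).trans (hJ.1.add hJ'.1)
    · rw [pd_add i h.differentiable h'.differentiable]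
      exact (Lp.coeFn_add _ _).trans ((hJ.2.1 i).add (hJ'.2.1 i))
    · rw [pd_add j h.differentiable h'.differentiable,
        pd_add i (h.pd j).differentiable (h'.pd j).differentiable]
      exact (Lp.coeFn_add _ _).trans ((hJ.2.2 i j).add (hJ'.2.2 i j))
  | smul c J _ h =>
    obtain ⟨ψ, h, hJ⟩ := h
    refine ⟨c • ψ, h.smul c, ?_, fun i => ?_, fun i j => ?_⟩
    · exact (Lp.coeFn_smul _ _).trans (hJ.1.const_smul c)
    · rw [pd_smul i h.differentiable]
      exact (Lp.coeFn_smul _ _).trans ((hJ.2.1 i).const_smul c)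
    · rw [pd_smul j h.differentiable, pd_smul i (h.pd j).differentiable]
      exact (Lp.coeFn_smul _ _).trans ((hJ.2.2 i j).const_smul c)

/-- A closed property of test functions holds on all of `V`. -/
theorem V.induction {P : V Ω → Prop} (hP : IsClosed {v | P v})
    (h : ∀ (ψ : Plane → ℝ) (h : IsTest Ω ψ), P h.toV) (v : V Ω) : P v := by
  have hv : (v : H20 Ω).1 ∈ closure ((Submodule.span ℝ
      {J : Jet Ω | ∃ ψ, IsTest Ω ψ ∧ IsJetOf Ω J ψ} : Submodule ℝ (Jet Ω)) : Set (Jet Ω)) :=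
    (v : H20 Ω).2
  obtain ⟨J, hJ, hlim⟩ := mem_closure_iff_seq_limit.1 hv
  choose ψ hψ hJψ using fun n => exists_isTest_of_mem_span (hJ n)
  have hlim' : Tendsto (fun n => (hψ n).toV) atTop (𝓝 v) := by
    refine tendsto_subtype_rng.2 ?_
    refine hlim.congr fun n => ?_
    rw [(hJψ n).eq_jet (hψ n)]
    rfl
  exact hP.mem_of_tendsto hlim' (Eventually.of_forall fun n => h _ (hψ n))

/-- The entries of `hess v` are weak second derivatives of `v`. -/
lemma inner_hess_toLp (v : V Ω) (h : IsTest Ω χ) (i j : Fin 2) :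
    ⟪hess v i j, h.toLp⟫ = ⟪toL2 Ω v, ((h.pd i).pd j).toLp⟫ := by
  refine V.induction (P := fun v => ⟪hess v i j, h.toLp⟫ = ⟪toL2 Ω v, ((h.pd i).pd j).toLp⟫)
    (isClosed_eq ((continuous_hess i j).inner continuous_const)
      ((toL2 Ω).continuous.inner continuous_const)) (fun ψ hψ => ?_) v
  rw [hess_toV, toL2_toV, inner_pd_toLp (hψ.pd j) h, inner_pd_toLp hψ (h.pd i), neg_neg]

lemma integrable_mul_of_isTest (f : L2 Ω) (h : IsTest Ω ψ) :
    Integrable (fun x => f x * ψ x) (volume.restrict Ω) :=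
  (Lp.memLp f).integrable_mul h.memLp

/-- Against a test function, the form `a` is the distributional bilaplacian. -/
lemma aForm_toV (v : V Ω) (h : IsTest Ω χ) :
    aForm v h.toV = ∫ x in Ω, toL2 Ω v x * Δ (Δ χ) x := by
  simp only [aForm, hess_toV, inner_hess_toLp]
  simp only [inner_toLp, bilaplacian_eq_sum_pd h.smooth, Finset.mul_sum]
  have hi : ∀ i j, Integrable (fun x => toL2 Ω v x * pd j (pd i (pd i (pd j χ))) x)
      (volume.restrict Ω) := fun i j =>
    integrable_mul_of_isTest _ ((((h.pd j).pd i).pd i).pd j)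
  rw [integral_finsetSum _ fun i _ => integrable_finsetSum _ fun j _ => hi i j]
  refine Finset.sum_congr rfl fun i _ => ?_
  rw [integral_finsetSum _ fun j _ => hi i j]

lemma continuous_aForm_right (v : V Ω) : Continuous fun w : V Ω => aForm v w :=
  continuous_finsetSum _ fun i _ => continuous_finsetSum _ fun j _ =>
    continuous_const.inner (continuous_hess i j)

lemma aForm_comm (v w : V Ω) : aForm v w = aForm w v := by
  simp only [aForm, real_inner_comm]

/-- The distributional equation `Δ²v = g` is the variational equation on `V`. -/
lemma isBilaplacian_iff (v : V Ω) (g : L2 Ω) :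
    IsBilaplacian (toL2 Ω v) g ↔ ∀ w, aForm v w = ⟪g, toL2 Ω w⟫ := by
  constructor
  · intro h w
    refine V.induction (P := fun w => aForm v w = ⟪g, toL2 Ω w⟫) (isClosed_eq
      (continuous_aForm_right v) (continuous_const.inner (toL2 Ω).continuous)) (fun ψ hψ => ?_) w
    rw [aForm_toV, toL2_toV, inner_toLp, h ψ hψ]
  · intro h ψ hψ
    rw [← aForm_toV v hψ, h, toL2_toV, inner_toLp]

/-! ### The Poincaré inequality -/

lemma norm_toLp_sq (h : IsTest Ω ψ) : ‖h.toLp‖ ^ 2 = ∫ x, ψ x * ψ x := by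
  rw [← inner_toLp_toLp h h, real_inner_self_eq_norm_sq]

/-- Poincaré's inequality, from `∫ ψ² = ∫ ψ² ∂ᵢxᵢ = -2 ∫ xᵢ ψ ∂ᵢψ`. -/
lemma norm_toLp_le {R : ℝ} (hR : ∀ x ∈ Ω, ‖x‖ ≤ R) (hR0 : 0 ≤ R) (h : IsTest Ω ψ) (i : Fin 2) :
    ‖h.toLp‖ ≤ 2 * R * ‖(h.pd i).toLp‖ := by
  have hcoord : ContDiff ℝ ((⊤ : ℕ∞) : WithTop ℕ∞) fun x : Plane => x i :=
    (EuclideanSpace.proj (𝕜 := ℝ) i).contDiff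
  have hcoord' : ∀ x : Plane, fderiv ℝ (fun x : Plane => x i) x (EuclideanSpace.single i 1) = 1 :=
    fun x => by
      have : fderiv ℝ (fun x : Plane => x i) x = EuclideanSpace.proj (𝕜 := ℝ) i :=
        (EuclideanSpace.proj (𝕜 := ℝ) i).fderiv
      rw [this]
      simp
  have hd : ∀ x, pd i (fun x => x i * ψ x) x = ψ x + x i * pd i ψ x := fun x => by
    have h1 : DifferentiableAt ℝ (fun x : Plane => x i) x := hcoord.differentiable (by simp) x
    unfold pd
    rw [fderiv_fun_mul h1 (h.differentiable x)]
    simp [hcoord']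
    ring
  have hx : IsTest Ω fun x => x i * pd i ψ x :=
    ⟨hcoord.mul (h.pd i).smooth, (h.pd i).compact.mul_left,
      (tsupport_mul_subset_right).trans (h.pd i).supp⟩
  have hxψ : Continuous fun x : Plane => x i * ψ x := hcoord.continuous.mul h.smooth.continuous
  have hparts := integral_pd_mul h (hcoord.mul h.smooth) i
  simp only [hd] at hparts
  have hkey : ‖h.toLp‖ ^ 2 = -2 * ⟪hx.toLp, h.toLp⟫ := by
    rw [norm_toLp_sq, inner_toLp_toLp]
    have e1 : ∫ x, (ψ x + x i * pd i ψ x) * ψ x =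
        (∫ x, ψ x * ψ x) + ∫ x, x i * pd i ψ x * ψ x := by
      rw [← integral_add (h.integrable_mul h.smooth.continuous)
        (h.integrable_mul hx.smooth.continuous)]
      congr 1; ext x; ring
    have e2 : ∫ x, x i * ψ x * pd i ψ x = ∫ x, x i * pd i ψ x * ψ x := by
      congr 1; ext x; ring
    rw [e1, e2] at hparts
    linarith
  have hle : ‖hx.toLp‖ ≤ R * ‖(h.pd i).toLp‖ := by
    refine Lp.norm_le_mul_norm_of_ae_le_mul ?_
    filter_upwards [hx.coeFn_toLp, (h.pd i).coeFn_toLp] with x h1 h2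
    rw [h1, h2, norm_mul]
    by_cases hxΩ : x ∈ Ω
    · gcongr
      exact (PiLp.norm_apply_le x i).trans (hR x hxΩ)
    · rw [(h.pd i).eq_zero hxΩ]; simp
  have h3 := abs_real_inner_le_norm hx.toLp h.toLp
  by_cases h0 : ‖h.toLp‖ = 0
  · rw [h0]; positivity
  · have h0' : 0 < ‖h.toLp‖ := lt_of_le_of_ne (norm_nonneg _) (Ne.symm h0)
    have h4 : ‖h.toLp‖ * ‖h.toLp‖ ≤ 2 * R * ‖(h.pd i).toLp‖ * ‖h.toLp‖ := by
      have := neg_abs_le ⟪hx.toLp, h.toLp⟫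
      nlinarith
    exact le_of_mul_le_mul_right h4 h0'

lemma norm_sq_eq (v : V Ω) : ‖v‖ ^ 2 = ‖toL2 Ω v‖ ^ 2 +
    (∑ i, ‖V.jet Ω v (Sum.inr (Sum.inl i))‖ ^ 2 + ∑ i, ∑ j, ‖hess v i j‖ ^ 2) := by
  have : ‖v‖ = ‖V.jet Ω v‖ := rfl
  rw [this, PiLp.norm_sq_eq_of_L2, Fintype.sum_sum_type, Fintype.sum_sum_type, Fintype.sum_prod_type]
  simp only [Finset.univ_unique, Finset.sum_singleton]
  rfl

lemma aForm_self (v : V Ω) : aForm v v = ∑ i, ∑ j, ‖hess v i j‖ ^ 2 := by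
  simp only [aForm, real_inner_self_eq_norm_sq]

/-- The form `a` is coercive on `V` when `Ω` is bounded. -/
theorem exists_norm_sq_le_aForm (hΩ : Bornology.IsBounded Ω) :
    ∃ C : ℝ, 0 < C ∧ ∀ v : V Ω, ‖v‖ ^ 2 ≤ C * aForm v v := by
  obtain ⟨R, hR0, hR⟩ := hΩ.exists_pos_norm_le
  set D := 2 * R
  have hD : 0 < D := by positivity
  refine ⟨D ^ 4 + D ^ 2 + 1, by positivity, fun v => ?_⟩
  refine V.induction (P := fun v => ‖v‖ ^ 2 ≤ (D ^ 4 + D ^ 2 + 1) * aForm v v) ?_ (fun ψ h => ?_) v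
  · refine isClosed_le (by fun_prop) (continuous_const.mul ?_)
    exact continuous_finsetSum _ fun i _ => continuous_finsetSum _ fun j _ =>
      (continuous_hess i j).inner (continuous_hess i j)
  · have e : ∀ i, V.jet Ω h.toV (Sum.inr (Sum.inl i)) = (h.pd i).toLp := fun _ => rfl
    rw [norm_sq_eq, aForm_self, toL2_toV]
    simp only [e, hess_toV, Fin.sum_univ_two]
    have p : ∀ {ψ : Plane → ℝ} (h : IsTest Ω ψ) (i : Fin 2),
        ‖h.toLp‖ ^ 2 ≤ D ^ 2 * ‖(h.pd i).toLp‖ ^ 2 := fun h i => by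
      rw [← mul_pow]
      exact pow_le_pow_left₀ (norm_nonneg _) (norm_toLp_le hR hR0.le h i) 2
    have p0 := p h 0
    have p00 := p (h.pd 0) 0
    have p11 := p (h.pd 1) 1
    have p4 : ‖h.toLp‖ ^ 2 ≤ D ^ 4 * ‖((h.pd 0).pd 0).toLp‖ ^ 2 := by
      calc _ ≤ D ^ 2 * (D ^ 2 * ‖((h.pd 0).pd 0).toLp‖ ^ 2) := p0.trans (by gcongr)
        _ = _ := by ring
    have hD4 : 0 ≤ D ^ 4 := by positivity
    have hD2 : 0 ≤ D ^ 2 := by positivity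
    have q := fun i j => sq_nonneg ‖((h.pd j).pd i).toLp‖
    nlinarith [mul_nonneg hD4 (q 0 1), mul_nonneg hD4 (q 1 0), mul_nonneg hD4 (q 1 1),
      mul_nonneg hD2 (q 0 1), mul_nonneg hD2 (q 1 0)]

lemma aForm_self_nonneg (v : V Ω) : 0 ≤ aForm v v := by
  rw [aForm_self]; positivity

/-- An element of `V` is determined by its values: weak derivatives are unique. -/
lemma toL2_injective (hΩ : IsOpen Ω) (hb : Bornology.IsBounded Ω) :
    Function.Injective (toL2 Ω) := by
  rw [injective_iff_map_eq_zero]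
  intro v hv
  obtain ⟨C, hC, h⟩ := exists_norm_sq_le_aForm hb
  have hz : ∀ i j, hess v i j = 0 := fun i j => eq_zero_of_inner_toLp hΩ fun ψ hψ => by
    rw [inner_hess_toLp, hv, inner_zero_left]
  have h2 := h v
  rw [aForm_self] at h2
  simp only [hz, norm_zero] at h2
  have h3 : ‖v‖ ^ 2 ≤ 0 := by simpa using h2
  exact norm_eq_zero.1 (pow_eq_zero_iff two_ne_zero |>.1 (le_antisymm h3 (sq_nonneg _)))

end

section

variable {Ω : Set Plane} {ψ χ : Plane → ℝ}

/-! ### Compactness of the inclusion of `H²₀(Ω)` in `L²(Ω)` -/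

/-- The closed quadrant below and to the left of `x`. -/
def quadrant (x : Plane) : Set Plane := {y | y 0 ≤ x 0 ∧ y 1 ≤ x 1}

lemma measurableSet_quadrant (x : Plane) : MeasurableSet (quadrant x) := by
  have h : ∀ i : Fin 2, MeasurableSet {y : Plane | y i ≤ x i} := fun i =>
    (isClosed_le (by fun_prop) continuous_const).measurableSet
  exact (h 0).inter (h 1)

/-- The fundamental theorem of calculus along a line parallel to an axis. -/
lemma integral_Iic_pd (h : IsTest Ω ψ) (p : Plane) (i : Fin 2) (c : ℝ) :
    ∫ b in Iic c, pd i ψ (p + b • EuclideanSpace.single i (1 : ℝ)) =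
      ψ (p + c • EuclideanSpace.single i (1 : ℝ)) := by
  set e : Plane := EuclideanSpace.single i (1 : ℝ) with he
  have hsm : ContDiff ℝ 1 fun b : ℝ => ψ (p + b • e) :=
    (h.smooth.of_le (by simp)).comp (contDiff_const.add (contDiff_id.smul contDiff_const))
  have hder : ∀ b : ℝ, deriv (fun b : ℝ => ψ (p + b • e)) b = pd i ψ (p + b • e) := fun b => by
    have h1 : HasDerivAt (fun b : ℝ => p + b • e) ((1 : ℝ) • e) b :=
      ((hasDerivAt_id b).smul_const e).const_add p
    have h2 := (h.differentiable (p + b • e)).hasFDerivAt.comp_hasDerivAt b h1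
    rw [one_smul] at h2
    exact h2.deriv
  obtain ⟨R, hR⟩ := h.compact.isCompact.isBounded.exists_norm_le
  have hcs : HasCompactSupport fun b : ℝ => ψ (p + b • e) := by
    refine HasCompactSupport.intro (isCompact_closedBall (0 : ℝ) (R + ‖p‖)) fun b hb => ?_
    refine image_eq_zero_of_notMem_tsupport fun hmem => hb ?_
    rw [mem_closedBall_zero_iff]
    have h3 := hR _ hmem
    have h4 : ‖b • e‖ = ‖b‖ := by rw [norm_smul, he]; simp
    have h5 := norm_sub_le (p + b • e) p
    rw [add_sub_cancel_left, h4] at h5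
    linarith
  have := HasCompactSupport.integral_Iic_deriv_eq hsm hcs c
  simpa only [hder] using this

/-- A test function is the integral of its mixed second derivative over a quadrant. -/
lemma setIntegral_quadrant (h : IsTest Ω ψ) (x : Plane) :
    ∫ y in quadrant x, pd 1 (pd 0 ψ) y = ψ x := by
  let E : Plane ≃ᵐ ℝ × ℝ :=
    (MeasurableEquiv.toLp 2 (Fin 2 → ℝ)).symm.trans (MeasurableEquiv.finTwoArrow (α := ℝ))
  have hE : MeasurePreserving E volume volume :=
    (EuclideanSpace.volume_preserving_symm_measurableEquiv_toLp (Fin 2)).trans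
      (volume_preserving_finTwoArrow ℝ)
  have hEs : MeasurePreserving E.symm volume volume := hE.symm
  have hEv : ∀ p : ℝ × ℝ, E.symm p = !₂[p.1, p.2] := fun p => rfl
  have hpre : E.symm ⁻¹' quadrant x = Iic (x 0) ×ˢ Iic (x 1) := by
    ext p
    simp [quadrant, hEv, Prod.le_def]
  have hint : Integrable (pd 1 (pd 0 ψ)) (volume : Measure Plane) :=
    ((h.pd 0).pd 1).smooth.continuous.integrable_of_hasCompactSupport ((h.pd 0).pd 1).compact
  have hint2 : Integrable (fun p : ℝ × ℝ => pd 1 (pd 0 ψ) (E.symm p)) volume :=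
    (hEs.integrable_comp_emb E.symm.measurableEmbedding).2 hint
  rw [← hEs.setIntegral_preimage_emb E.symm.measurableEmbedding, hpre,
    Measure.volume_eq_prod, setIntegral_prod _ hint2.integrableOn]
  have e1 : ∀ a b : ℝ, E.symm (a, b) = !₂[a, 0] + b • EuclideanSpace.single 1 (1 : ℝ) := fun a b => by
    rw [hEv]; ext k; fin_cases k <;> simp
  have e2 : ∀ a : ℝ, (!₂[a, 0] + x 1 • EuclideanSpace.single 1 (1 : ℝ) : Plane) =
      !₂[0, x 1] + a • EuclideanSpace.single 0 (1 : ℝ) := fun a => by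
    ext k; fin_cases k <;> simp
  have e3 : (!₂[0, x 1] + x 0 • EuclideanSpace.single 0 (1 : ℝ) : Plane) = x := by
    ext k; fin_cases k <;> simp
  simp only [e1, integral_Iic_pd (h.pd 0), e2, integral_Iic_pd h, e3]

variable (Ω) in
/-- The indicator of a quadrant in `L²(Ω)`, for `Ω` of finite measure. -/
def quadrantLp [IsFiniteMeasure (volume.restrict Ω)] (x : Plane) : L2 Ω :=
  indicatorConstLp 2 (measurableSet_quadrant x) (measure_ne_top (volume.restrict Ω) _) (1 : ℝ)

lemma volume_coord_eq (i : Fin 2) (c : ℝ) : (volume : Measure Plane) {y | y i = c} = 0 := by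
  have h := (EuclideanSpace.volume_preserving_symm_measurableEquiv_toLp (Fin 2)).measure_preimage
    (s := {f : Fin 2 → ℝ | f i = c})
    (measurableSet_eq_fun (measurable_pi_apply i) measurable_const).nullMeasurableSet
  rw [volume_pi, Measure.pi_hyperplane] at h
  exact h

/-- The indicator of a quadrant depends continuously on the corner, since the boundary of a quadrant
is a null set. -/
lemma continuous_quadrantLp [IsFiniteMeasure (volume.restrict Ω)] :
    Continuous (quadrantLp Ω) := by
  refine continuous_indicatorConstLp_set (by norm_num) fun x => ?_
  have hae : ∀ᵐ z ∂(volume.restrict Ω), z 0 ≠ x 0 ∧ z 1 ≠ x 1 := by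
    refine ae_restrict_of_ae ?_
    have h0 : ∀ᵐ z ∂(volume : Measure Plane), z 0 ≠ x 0 := by
      rw [ae_iff]; simpa using volume_coord_eq 0 (x 0)
    have h1 : ∀ᵐ z ∂(volume : Measure Plane), z 1 ≠ x 1 := by
      rw [ae_iff]; simpa using volume_coord_eq 1 (x 1)
    exact h0.and h1
  have key := tendsto_measure_of_ae_tendsto_indicator_of_isFiniteMeasure (𝓝 x)
    (μ := volume.restrict Ω) (A := ∅) (As := fun y => symmDiff (quadrant y) (quadrant x))
    MeasurableSet.empty (fun y => (measurableSet_quadrant y).symmDiff (measurableSet_quadrant x)) ?_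
  · simpa using key
  · filter_upwards [hae] with z hz
    have hc : ∀ i : Fin 2, z i ≠ x i → ∀ᶠ y : Plane in 𝓝 x, (z i ≤ y i ↔ z i ≤ x i) := fun i hi => by
      have hcont : Tendsto (fun y : Plane => y i) (𝓝 x) (𝓝 (x i)) :=
        (EuclideanSpace.proj (𝕜 := ℝ) i).continuous.tendsto x
      rcases lt_or_gt_of_ne hi with h | h
      · filter_upwards [hcont.eventually (lt_mem_nhds h)] with y hy
        exact ⟨fun _ => h.le, fun _ => hy.le⟩
      · filter_upwards [hcont.eventually (gt_mem_nhds h)] with y hy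
        exact ⟨fun h' => absurd h' (not_le.2 hy), fun h' => absurd h' (not_le.2 h)⟩
    filter_upwards [hc 0 hz.1, hc 1 hz.2] with y h0 h1
    simp [mem_symmDiff, quadrant, h0, h1]

lemma norm_quadrantLp_le [IsFiniteMeasure (volume.restrict Ω)] (x : Plane) :
    ‖quadrantLp Ω x‖ ≤ (volume.restrict Ω).real univ ^ (1 / (2 : ℝ)) := by
  rw [quadrantLp, norm_indicatorConstLp (by norm_num) (by norm_num)]
  simp only [norm_one, one_mul, ENNReal.toReal_ofNat]
  exact Real.rpow_le_rpow measureReal_nonneg (measureReal_mono (subset_univ _)) (by norm_num)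

lemma memLp_inner_quadrantLp [IsFiniteMeasure (volume.restrict Ω)] (f : L2 Ω) :
    MemLp (fun x => ⟪quadrantLp Ω x, f⟫) 2 (volume.restrict Ω) := by
  refine MemLp.of_bound (continuous_quadrantLp.inner continuous_const).aestronglyMeasurable
    ((volume.restrict Ω).real univ ^ (1 / (2 : ℝ)) * ‖f‖) (Eventually.of_forall fun x => ?_)
  exact (norm_inner_le_norm _ _).trans (by gcongr; exact norm_quadrantLp_le x)

lemma norm_toLp_le_of_bound [IsFiniteMeasure (volume.restrict Ω)] {g : Plane → ℝ} {C : ℝ}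
    (hC : 0 ≤ C) (hg : MemLp g 2 (volume.restrict Ω)) (h : ∀ᵐ x ∂volume.restrict Ω, |g x| ≤ C) :
    ‖hg.toLp g‖ ≤ (measureUnivNNReal (volume.restrict Ω) : ℝ) ^ ((2 : ENNReal).toReal⁻¹) * C := by
  refine Lp.norm_le_of_ae_bound hC ?_
  filter_upwards [hg.coeFn_toLp, h] with x h1 h2
  rw [h1]
  exact h2

variable (Ω) in
/-- Integration over quadrants, `f ↦ (x ↦ ∫_{y ≤ x} f)`, as an operator on `L²(Ω)`. -/
def quadrantOp [IsFiniteMeasure (volume.restrict Ω)] : L2 Ω →L[ℝ] L2 Ω :=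
  LinearMap.mkContinuous
    { toFun := fun f => (memLp_inner_quadrantLp f).toLp _
      map_add' := fun f g => by
        rw [← MemLp.toLp_add]
        exact MemLp.toLp_congr _ _ (Eventually.of_forall fun x => inner_add_right _ _ _)
      map_smul' := fun c f => by
        rw [RingHom.id_apply, ← MemLp.toLp_const_smul]
        exact MemLp.toLp_congr _ _ (Eventually.of_forall fun x => inner_smul_right _ _ _) }
    ((measureUnivNNReal (volume.restrict Ω) : ℝ) ^ ((2 : ENNReal).toReal⁻¹) *
      (volume.restrict Ω).real univ ^ (1 / (2 : ℝ)))
    (fun f => by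
      rw [mul_assoc]
      exact norm_toLp_le_of_bound (by positivity) (memLp_inner_quadrantLp f)
        (Eventually.of_forall fun x => (abs_real_inner_le_norm _ _).trans
          (mul_le_mul_of_nonneg_right (norm_quadrantLp_le x) (norm_nonneg f))))

lemma coeFn_quadrantOp [IsFiniteMeasure (volume.restrict Ω)] (f : L2 Ω) :
    quadrantOp Ω f =ᵐ[volume.restrict Ω] fun x => ⟪quadrantLp Ω x, f⟫ :=
  (memLp_inner_quadrantLp f).coeFn_toLp

/-- An element of `H²₀(Ω)` is recovered from its mixed second derivative by integration over
quadrants. -/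
lemma toL2_eq_quadrantOp [IsFiniteMeasure (volume.restrict Ω)] (v : V Ω) :
    toL2 Ω v = quadrantOp Ω (hess v 1 0) := by
  refine V.induction (P := fun v => toL2 Ω v = quadrantOp Ω (hess v 1 0))
    (isClosed_eq (toL2 Ω).continuous ((quadrantOp Ω).continuous.comp (continuous_hess 1 0)))
    (fun ψ h => ?_) v
  rw [toL2_toV, hess_toV]
  refine Lp.ext ?_
  filter_upwards [h.coeFn_toLp, coeFn_quadrantOp ((h.pd 0).pd 1).toLp] with x h1 h2
  rw [h1, h2, quadrantLp, L2.inner_indicatorConstLp_one,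
    setIntegral_congr_ae (g := pd 1 (pd 0 ψ)) (measurableSet_quadrant x)
      (((h.pd 0).pd 1).coeFn_toLp.mono fun y hy _ => hy),
    Measure.restrict_restrict (measurableSet_quadrant x), ← setIntegral_quadrant h x]
  refine (setIntegral_eq_of_subset_of_forall_sdiff_eq_zero (measurableSet_quadrant x)
    inter_subset_left fun y hy => ((h.pd 0).pd 1).eq_zero fun hyΩ => hy.2 ⟨hy.1, hyΩ⟩)

/-- The operator `quadrantOp` is compact: the indicators of the quadrants with corner in `Ω` form
a relatively compact subset of `L²(Ω)`, hence are uniformly close to a finite-dimensional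
subspace. -/
theorem isCompactOperator_quadrantOp (hb : Bornology.IsBounded Ω) (hΩ : MeasurableSet Ω)
    [IsFiniteMeasure (volume.restrict Ω)] : IsCompactOperator (quadrantOp Ω) := by
  set m : ℝ := (measureUnivNNReal (volume.restrict Ω) : ℝ) ^ ((2 : ENNReal).toReal⁻¹) with hm
  have hm0 : 0 ≤ m := by positivity
  -- `quadrantOp Ω` is approximated by its composition with the orthogonal projection onto the span
  -- of finitely many indicators
  have hcl : quadrantOp Ω ∈ closure {T : L2 Ω →L[ℝ] L2 Ω | IsCompactOperator T} := by
    rw [Metric.mem_closure_iff]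
    intro ε hε
    obtain ⟨δ, hδ, hδε⟩ : ∃ δ > 0, m * δ < ε := by
      refine ⟨ε / (m + 1), by positivity, ?_⟩
      rw [← mul_div_assoc, div_lt_iff₀ (by positivity)]
      nlinarith
    have hK : IsCompact (quadrantLp Ω '' closure Ω) := hb.isCompact_closure.image continuous_quadrantLp
    obtain ⟨t, _, htf, htc⟩ := hK.finite_cover_balls hδ
    let W : Submodule ℝ (L2 Ω) := Submodule.span ℝ t
    have hWf : FiniteDimensional ℝ W := FiniteDimensional.span_of_finite ℝ htf
    let P : L2 Ω →L[ℝ] L2 Ω := W.starProjection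
    have hPc : IsCompactOperator P :=
      (isCompactOperator_of_locallyCompactSpace_dom W.orthogonalProjectionOnto).clm_comp W.subtypeL
    refine ⟨(quadrantOp Ω).comp P, hPc.clm_comp (quadrantOp Ω), ?_⟩
    rw [dist_eq_norm]
    refine lt_of_le_of_lt (ContinuousLinearMap.opNorm_le_bound _ (mul_nonneg hm0 hδ.le)
      fun f => ?_) hδε
    have hsub : (quadrantOp Ω - (quadrantOp Ω).comp P) f = quadrantOp Ω (f - P f) := by
      simp [map_sub]
    rw [hsub, mul_assoc]
    refine norm_toLp_le_of_bound (by positivity) (memLp_inner_quadrantLp _) ?_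
    filter_upwards [ae_restrict_mem hΩ] with x hx
    obtain ⟨w, hw, hxw⟩ := mem_iUnion₂.1 (htc (mem_image_of_mem _ (subset_closure hx)))
    have hwW : w ∈ W := Submodule.subset_span hw
    have horth : ⟪w, f - P f⟫ = 0 := by
      have := Submodule.sub_starProjection_mem_orthogonal (K := W) f
      exact (Submodule.mem_orthogonal W _).1 this w hwW
    have hfP : ‖f - P f‖ ≤ ‖f‖ := by
      have h1 : f - P f = Wᗮ.starProjection f := by
        rw [Submodule.starProjection_orthogonal']
        simp [P]
      rw [h1]
      exact Submodule.norm_starProjection_apply_le _ _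
    have h2 : ⟪quadrantLp Ω x, f - P f⟫ = ⟪quadrantLp Ω x - w, f - P f⟫ := by
      rw [inner_sub_left, horth, sub_zero]
    rw [h2]
    refine (abs_real_inner_le_norm _ _).trans ?_
    rw [mem_ball_iff_norm] at hxw
    gcongr
  rwa [isClosed_setOfPred_isCompactOperator.closure_eq] at hcl

lemma isFiniteMeasure_restrict_of_isBounded (hb : Bornology.IsBounded Ω) :
    IsFiniteMeasure (volume.restrict Ω) :=
  MeasureTheory.isFiniteMeasure_restrict.2 hb.measure_lt_top.ne

/-- The inclusion of `H²₀(Ω)` in `L²(Ω)` is compact. -/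
theorem isCompactOperator_toL2 (hb : Bornology.IsBounded Ω) (hΩ : IsOpen Ω) :
    IsCompactOperator (toL2 Ω) := by
  have := isFiniteMeasure_restrict_of_isBounded hb
  have h : toL2 Ω = (quadrantOp Ω).comp (hessL Ω 1 0) := by
    ext1 v
    exact toL2_eq_quadrantOp v
  rw [h]
  exact (isCompactOperator_quadrantOp hb hΩ.measurableSet).comp_clm (hessL Ω 1 0)

/-- `L²(Ω)` is infinite-dimensional: it contains the indicators of infinitely many disjoint open
sets. -/
theorem not_finiteDimensional_L2 (hΩ : IsOpen Ω) (hb : Bornology.IsBounded Ω) (hne : Ω.Nonempty) :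
    ¬ FiniteDimensional ℝ (L2 Ω) := by
  intro hfd
  have := isFiniteMeasure_restrict_of_isBounded hb
  have hinf : Infinite Ω := by
    obtain ⟨x, hx⟩ := hne
    exact ((infinite_of_mem_nhds x (hΩ.mem_nhds hx))).to_subtype
  obtain ⟨U, hU, hUo, hd⟩ := exists_seq_infinite_isOpen_pairwise_disjoint Ω
  let S : ℕ → Set Plane := fun n => Subtype.val '' U n
  have hSo : ∀ n, IsOpen (S n) := fun n => hΩ.isOpenMap_subtype_val _ (hUo n)
  have hSne : ∀ n, (S n).Nonempty := fun n => ((hU n).nonempty).image _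
  have hSΩ : ∀ n, S n ⊆ Ω := fun n => by
    rintro _ ⟨y, _, rfl⟩; exact y.2
  let f : ℕ → L2 Ω := fun n => indicatorConstLp 2 (hSo n).measurableSet
    (measure_ne_top (volume.restrict Ω) _) (1 : ℝ)
  have hli : LinearIndependent ℝ f := by
    refine linearIndependent_of_ne_zero_of_inner_eq_zero (𝕜 := ℝ) (fun n hn => ?_) fun m n hmn => ?_
    · have h1 : (volume.restrict Ω) (S n) ≠ 0 := by
        rw [Measure.restrict_apply (hSo n).measurableSet, inter_eq_left.2 (hSΩ n)]
        exact ((hSo n).measure_pos volume (hSne n)).ne'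
      have h2 := congrArg (fun g : L2 Ω => ‖g‖) hn
      simp only [f, norm_indicatorConstLp (p := 2) (by norm_num) (by norm_num), norm_zero,
        norm_one, one_mul] at h2
      rw [Real.rpow_eq_zero measureReal_nonneg (by norm_num), measureReal_eq_zero_iff] at h2
      exact h1 h2
    · change ⟪f m, f n⟫ = 0
      rw [L2.inner_indicatorConstLp_one]
      have hdisj : Disjoint (S m) (S n) := (disjoint_image_iff Subtype.val_injective).2 (hd hmn)
      refine (setIntegral_congr_ae (g := fun _ => (0 : ℝ)) (hSo m).measurableSet ?_).trans (by simp)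
      filter_upwards [indicatorConstLp_coeFn (p := 2) (μ := volume.restrict Ω)
        (hs := (hSo n).measurableSet) (hμs := measure_ne_top _ _) (c := (1 : ℝ))] with y hy hym
      rw [hy, indicator_of_notMem (disjoint_left.1 hdisj hym)]
  have := hli.finite
  exact not_finite ℕ

end

section

/-! ### Spectral theorem for compact positive operators -/

/-- A real function with finite sublevel sets on an infinite type can be listed increasingly. -/
lemma exists_equiv_nat_monotone {ι : Type*} [Infinite ι] (f : ι → ℝ)
    (hf : ∀ C, {i | f i ≤ C}.Finite) : ∃ e : ℕ ≃ ι, Monotone (f ∘ e) := by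
  have hc : Countable ι := by
    rw [← Set.countable_univ_iff]
    have : (univ : Set ι) = ⋃ n : ℕ, {i | f i ≤ n} := by
      refine (Set.eq_univ_of_forall fun i => ?_).symm
      exact mem_iUnion.2 (exists_nat_ge (f i))
    rw [this]
    exact Set.countable_iUnion fun n => (hf n).countable
  obtain ⟨c, hc⟩ := Countable.exists_injective_nat ι
  -- the number of predecessors for the order by `f`, ties being broken by `c`
  let g : ι → ℝ ×ₗ ℕ := fun i => toLex (f i, c i)
  have hg : Function.Injective g := fun i j h => hc (Prod.ext_iff.1 (toLex.injective h)).2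
  have hgf : ∀ i j, g i ≤ g j → f i ≤ f j := fun i j h => by
    rcases Prod.Lex.toLex_le_toLex.1 h with h | h
    · exact le_of_lt h
    · exact h.1.le
  have hfin : ∀ i, {j | g j < g i}.Finite := fun i =>
    (hf (f i)).subset fun j hj => hgf j i (le_of_lt hj)
  let r : ι → ℕ := fun i => {j | g j < g i}.ncard
  have hr : ∀ i j, g i < g j → r i < r j := fun i j h =>
    Set.ncard_lt_ncard ⟨fun k hk => lt_trans hk h, fun hs =>
      lt_irrefl (g i) (hs (show i ∈ {k | g k < g j} from h))⟩ (hfin j)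
  have hinj : Function.Injective r := fun i j h => by
    rcases lt_trichotomy (g i) (g j) with h1 | h1 | h1
    · exact absurd h (hr _ _ h1).ne
    · exact hg h1
    · exact absurd h (hr _ _ h1).ne'
  have hsurj : Function.Surjective r := fun n => by
    have hne : {i | n ≤ r i}.Nonempty := by
      by_contra hemp
      have : (range r) ⊆ Iio n := by
        rintro _ ⟨i, rfl⟩
        exact lt_of_not_ge fun h : n ≤ r i => hemp ⟨i, h⟩
      exact Set.infinite_range_of_injective hinj ((finite_Iio n).subset this)
    obtain ⟨i, hi, hmin⟩ :=
      WellFounded.has_min (InvImage.wf r Nat.lt_wfRel.wf) {i | n ≤ r i} hne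
    refine ⟨i, le_antisymm ?_ hi⟩
    have := Set.ncard_le_ncard_of_injOn (s := {j | g j < g i}) (t := Iio n) r
      (fun j hj => lt_of_not_ge fun h : n ≤ r j => hmin j h (hr _ _ hj)) hinj.injOn (finite_Iio n)
    simpa [r] using this
  refine ⟨(Equiv.ofBijective r ⟨hinj, hsurj⟩).symm, fun n m hnm => hgf _ _ (not_lt.1 fun h => ?_)⟩
  have h' := hr _ _ h
  have hap : ∀ k, r ((Equiv.ofBijective r ⟨hinj, hsurj⟩).symm k) = k := fun k =>
    (Equiv.ofBijective r ⟨hinj, hsurj⟩).apply_symm_apply k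
  rw [hap, hap] at h'
  omega

variable {H : Type*} [NormedAddCommGroup H] [InnerProductSpace ℝ H]

/-- The eigenvalues of a compact operator along an orthonormal family of eigenvectors accumulate
only at zero. -/
lemma finite_eigenvalue_ge {ι : Type*} {R : H →L[ℝ] H} (hR : IsCompactOperator R) {e : ι → H}
    (he : Orthonormal ℝ e) {l : ι → ℝ} (hl : ∀ i, R (e i) = l i • e i) {ε : ℝ} (hε : 0 < ε) :
    {i | ε ≤ l i}.Finite := by
  by_contra hinf
  have hinf : {i | ε ≤ l i}.Infinite := hinf
  let s := hinf.natEmbedding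
  obtain ⟨K, hK, hKsub⟩ := hR.image_closedBall_subset_compact 1
  have hmem : ∀ n, R (e (s n)) ∈ K := fun n =>
    hKsub ⟨e (s n), by simp [he.1], rfl⟩
  obtain ⟨a, -, σ, hσ, hlim⟩ := hK.tendsto_subseq hmem
  obtain ⟨N, hN⟩ := Metric.cauchySeq_iff.1 hlim.cauchySeq ε hε
  have h1 := hN N le_rfl (N + 1) (Nat.le_succ N)
  have hne : (s (σ N) : ι) ≠ s (σ (N + 1)) := fun h => by
    have := hσ.injective (s.injective (Subtype.ext h))
    omega
  rw [dist_eq_norm] at h1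
  have h2 : ⟪e (s (σ N)), R (e (s (σ N))) - R (e (s (σ (N + 1))))⟫ = l (s (σ N)) := by
    rw [inner_sub_right, hl, hl, inner_smul_right, inner_smul_right, he.2 hne,
      real_inner_self_eq_norm_sq, he.1]
    simp
  have h3 := real_inner_le_norm (e (s (σ N))) (R (e (s (σ N))) - R (e (s (σ (N + 1)))))
  rw [h2, he.1, one_mul] at h3
  exact absurd ((s (σ N)).2.trans h3) (not_le.2 h1)

/-- The spectral theorem for a compact, symmetric, positive definite operator on a Hilbert space of
infinite dimension, with the reciprocals of the eigenvalues in increasing order. -/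
lemma exists_hilbertBasis_eigenvectors [CompleteSpace H] (hdim : ¬ FiniteDimensional ℝ H)
    {R : H →L[ℝ] H} (hR : IsCompactOperator R) (hsym : (R : H →ₗ[ℝ] H).IsSymmetric)
    (hpos : ∀ x, x ≠ 0 → 0 < ⟪R x, x⟫) :
    ∃ (φ : HilbertBasis ℕ ℝ H) (μ : ℕ → ℝ), (∀ j, 0 < μ j) ∧ Monotone μ ∧
      Tendsto μ atTop atTop ∧ ∀ j, R (φ j) = (μ j)⁻¹ • φ j := by
  let E : ℝ → Submodule ℝ H := fun l => Module.End.eigenspace (R : H →ₗ[ℝ] H) l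
  have hEcl : ∀ l, IsClosed (E l : Set H) := fun l => by
    have : (E l : Set H) = {x | R x = l • x} := by
      ext x; exact Module.End.mem_eigenspace_iff
    rw [this]
    exact isClosed_eq R.continuous (continuous_const_smul l)
  have hEc : ∀ l, CompleteSpace (E l) := fun l => (hEcl l).completeSpace_coe
  choose w b hb using fun l => exists_hilbertBasis ℝ (E l)
  let e : (Σ l : ℝ, w l) → H := fun i => (b i.1 i.2 : E i.1)
  have he : Orthonormal ℝ e :=
    hsym.orthogonalFamily_eigenspaces.orthonormal_sigma_orthonormal fun l => (b l).orthonormal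
  have heig : ∀ i, R (e i) = i.1 • e i := fun i =>
    Module.End.mem_eigenspace_iff.1 (b i.1 i.2).2
  have hspan : (Submodule.span ℝ (range e))ᗮ = ⊥ := by
    rw [eq_bot_iff, ← ContinuousLinearMap.orthogonalComplement_iSup_eigenspaces_eq_bot hR hsym]
    intro x hx
    rw [← Submodule.iInf_orthogonal, Submodule.mem_iInf]
    intro l
    have hz : (innerSL ℝ x).comp (E l).subtypeL = 0 := by
      refine ContinuousLinearMap.ext_on (s := range (b l)) ?_ ?_
      · rw [dense_iff_closure_eq, ← Submodule.topologicalClosure_coe, (b l).dense_span]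
        rfl
      · rintro _ ⟨i, rfl⟩
        exact (Submodule.mem_orthogonal' _ _).1 hx _ (Submodule.subset_span ⟨⟨l, i⟩, rfl⟩)
    exact (Submodule.mem_orthogonal' _ _).2 fun y hy => DFunLike.congr_fun hz ⟨y, hy⟩
  have hlpos : ∀ i : (Σ l : ℝ, w l), 0 < i.1 := fun i => by
    have h := hpos (e i) (he.ne_zero i)
    rwa [heig, inner_smul_left, real_inner_self_eq_norm_sq, he.1, one_pow, mul_one] at h
  have hinf : Infinite (Σ l : ℝ, w l) := by
    by_contra hfin
    have : Finite (Σ l : ℝ, w l) := not_infinite_iff_finite.1 hfin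
    have hfd : FiniteDimensional ℝ (Submodule.span ℝ (range e)) :=
      FiniteDimensional.span_of_finite ℝ (finite_range e)
    have htop : Submodule.span ℝ (range e) = ⊤ := by
      rw [← Submodule.orthogonal_eq_bot_iff]
      exact hspan
    rw [htop] at hfd
    exact hdim (Module.finite_def.2 (Module.Finite.iff_fg.1 hfd))
  obtain ⟨s, hs⟩ := exists_equiv_nat_monotone (fun i : (Σ l : ℝ, w l) => (i.1)⁻¹) fun C => by
    rcases le_or_gt C 0 with hC | hC
    · refine Set.finite_empty.subset fun i hi => ?_
      exact absurd (lt_of_lt_of_le (inv_pos.2 (hlpos i)) (le_trans hi hC)) (lt_irrefl 0)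
    · refine (finite_eigenvalue_ge hR he heig (inv_pos.2 hC)).subset fun i hi => ?_
      exact inv_le_of_inv_le₀ (hlpos i) hi
  have hφ : Orthonormal ℝ (e ∘ s) := he.comp s s.injective
  have hφs : (Submodule.span ℝ (range (e ∘ s)))ᗮ = ⊥ := by
    rw [s.surjective.range_comp, hspan]
  refine ⟨HilbertBasis.mkOfOrthogonalEqBot hφ hφs, fun j => ((s j).1)⁻¹,
    fun j => inv_pos.2 (hlpos _), hs, ?_, fun j => ?_⟩
  · refine tendsto_atTop_atTop_of_monotone hs fun C => ?_
    by_contra! hlt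
    have : (univ : Set ℕ) ⊆ s ⁻¹' {i | (C + 1)⁻¹ ≤ i.1} := fun j _ => by
      have hj : ((s j).1)⁻¹ < C := hlt j
      exact inv_le_of_inv_le₀ (hlpos _) (by linarith)
    have hC : 0 < C := (inv_pos.2 (hlpos (s 0))).trans (hlt 0)
    exact Set.infinite_univ (((finite_eigenvalue_ge hR he heig
      (inv_pos.2 (by linarith : (0 : ℝ) < C + 1))).preimage s.injective.injOn).subset this)
  · rw [HilbertBasis.coe_mkOfOrthogonalEqBot, inv_inv]
    exact heig _

end

section

variable {Ω : Set Plane}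

/-! ### The operator `A` and its eigenfunctions -/

/-- The form `a` as a bounded bilinear form on `V`. -/
def aBilin (Ω : Set Plane) : V Ω →L[ℝ] V Ω →L[ℝ] ℝ :=
  ∑ i, ∑ j, (isBoundedBilinearMap_inner (𝕜 := ℝ) (E := L2 Ω)).toContinuousLinearMap.bilinearComp
    (hessL Ω i j) (hessL Ω i j)

lemma aBilin_apply (v w : V Ω) : aBilin Ω v w = aForm v w := by
  simp only [aBilin, _root_.sum_apply, aForm]
  rfl

lemma isCoercive_aBilin (hb : Bornology.IsBounded Ω) : IsCoercive (aBilin Ω) := by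
  obtain ⟨C, hC, h⟩ := exists_norm_sq_le_aForm hb
  refine ⟨C⁻¹, inv_pos.2 hC, fun v => ?_⟩
  rw [aBilin_apply, mul_assoc, ← pow_two, inv_mul_le_iff₀ hC]
  exact h v

lemma isA_iff {f g : L2 Ω} :
    IsA f g ↔ ∃ v : V Ω, toL2 Ω v = f ∧ ∀ w, aForm v w = ⟪g, toL2 Ω w⟫ := by
  constructor
  · rintro ⟨⟨v, rfl⟩, h⟩
    exact ⟨v, rfl, (isBilaplacian_iff v g).1 h⟩
  · rintro ⟨v, rfl, h⟩
    exact ⟨⟨v, rfl⟩, (isBilaplacian_iff v g).2 h⟩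

/-- The operator `A` is symmetric. -/
lemma IsA.inner_eq {f g f' g' : L2 Ω} (h : IsA f g) (h' : IsA f' g') : ⟪g, f'⟫ = ⟪g', f⟫ := by
  obtain ⟨v, rfl, h1⟩ := isA_iff.1 h
  obtain ⟨v', rfl, h2⟩ := isA_iff.1 h'
  rw [← h1, ← h2, aForm_comm]

/-- A functional on `V` is represented by the form `a`. -/
lemma exists_aForm_eq (hb : Bornology.IsBounded Ω) (F : VDual Ω) :
    ∃ f : V Ω, ∀ w, aForm f w = F w := by
  have hc := isCoercive_aBilin hb
  refine ⟨hc.continuousLinearEquivOfBilin.symm ((InnerProductSpace.toDual ℝ (V Ω)).symm F),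
    fun w => ?_⟩
  rw [← aBilin_apply, ← hc.continuousLinearEquivOfBilin_apply,
    ContinuousLinearEquiv.apply_symm_apply, InnerProductSpace.toDual_symm_apply]

/-- The solution operator `L²(Ω) → V` of `Δ²v = f`. -/
def solution (hb : Bornology.IsBounded Ω) : L2 Ω →L[ℝ] V Ω :=
  ((isCoercive_aBilin hb).continuousLinearEquivOfBilin.symm : V Ω →L[ℝ] V Ω).comp
    (ContinuousLinearMap.adjoint (toL2 Ω))

lemma aForm_solution (hb : Bornology.IsBounded Ω) (f : L2 Ω) (w : V Ω) :
    aForm (solution hb f) w = ⟪f, toL2 Ω w⟫ := by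
  rw [← aBilin_apply, ← (isCoercive_aBilin hb).continuousLinearEquivOfBilin_apply, solution,
    ContinuousLinearMap.comp_apply]
  erw [ContinuousLinearEquiv.apply_symm_apply]
  rw [ContinuousLinearMap.adjoint_inner_left]

/-- The eigenfunctions of the inverse of `A`, which is compact because the embedding of `H²₀(Ω)`
in `L²(Ω)` is, are those of `A`. -/
theorem exists_isEigensystem (hΩ : IsOpen Ω) (hb : Bornology.IsBounded Ω) (hne : Ω.Nonempty) :
    ∃ (φ : HilbertBasis ℕ ℝ (L2 Ω)) (μ : ℕ → ℝ), IsEigensystem Ω φ μ := by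
  let R : L2 Ω →L[ℝ] L2 Ω := (toL2 Ω).comp (solution hb)
  have hR : ∀ f g, ⟪R f, g⟫ = aForm (solution hb f) (solution hb g) := fun f g => by
    rw [aForm_comm, aForm_solution, real_inner_comm]
    rfl
  have hcomp : IsCompactOperator R := (isCompactOperator_toL2 hb hΩ).comp_clm (solution hb)
  have hsym : (R : L2 Ω →ₗ[ℝ] L2 Ω).IsSymmetric := fun f g => by
    change ⟪R f, g⟫ = ⟪f, R g⟫
    rw [hR, real_inner_comm, hR, aForm_comm]
  obtain ⟨C, hC, hcoer⟩ := exists_norm_sq_le_aForm hb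
  have hpos : ∀ f, f ≠ 0 → 0 < ⟪R f, f⟫ := fun f hf => by
    rw [hR]
    refine (aForm_self_nonneg _).lt_of_ne fun h0 => hf ?_
    have h1 := hcoer (solution hb f)
    rw [← h0, mul_zero] at h1
    have h2 : solution hb f = 0 := norm_eq_zero.1 (pow_eq_zero_iff two_ne_zero |>.1
      (le_antisymm h1 (sq_nonneg _)))
    refine eq_zero_of_inner_toLp hΩ fun ψ h => ?_
    rw [← toL2_toV, ← aForm_solution hb, h2, ← aBilin_apply]
    simp
  obtain ⟨φ, μ, h1, h2, h3, h4⟩ :=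
    exists_hilbertBasis_eigenvectors (not_finiteDimensional_L2 hΩ hb hne) hcomp hsym hpos
  refine ⟨φ, μ, h1, h2, h3, fun j => isA_iff.2 ⟨μ j • solution hb (φ j), ?_, fun w => ?_⟩⟩
  · rw [map_smul]
    change μ j • R (φ j) = φ j
    rw [h4, smul_smul, mul_inv_cancel₀ (h1 j).ne', one_smul]
  · rw [← aBilin_apply, map_smul, _root_.smul_apply, aBilin_apply, aForm_solution,
      inner_smul_left]
    rfl

variable {φ : HilbertBasis ℕ ℝ (L2 Ω)} {μ : ℕ → ℝ}

/-- The eigenfunctions as elements of `V`. -/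
lemma IsEigensystem.exists_lift (h : IsEigensystem Ω φ μ) :
    ∃ v : ℕ → V Ω, (∀ j, toL2 Ω (v j) = φ j) ∧
      ∀ j w, aForm (v j) w = μ j * ⟪φ j, toL2 Ω w⟫ := by
  choose v h1 h2 using fun j => isA_iff.1 (h.eigen j)
  exact ⟨v, h1, fun j w => by rw [h2, inner_smul_left]; rfl⟩

/-- The eigenfunctions are total in `V`. -/
lemma eq_zero_of_apply_eigenfunction (hΩ : IsOpen Ω) (hb : Bornology.IsBounded Ω)
    (h : IsEigensystem Ω φ μ) {v : ℕ → V Ω}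
    (hv : ∀ j w, aForm (v j) w = μ j * ⟪φ j, toL2 Ω w⟫) {F : VDual Ω} (hF : ∀ j, F (v j) = 0) :
    F = 0 := by
  obtain ⟨f, hf⟩ := exists_aForm_eq hb F
  have h0 : toL2 Ω f = 0 := by
    refine φ.repr.injective (lp.ext (funext fun j => ?_))
    rw [φ.repr_apply_apply, map_zero]
    have h1 := hf (v j)
    rw [hF, aForm_comm, hv] at h1
    exact (mul_eq_zero.1 h1).resolve_left (h.pos j).ne'
  have h1 : f = 0 := toL2_injective hΩ hb (by rw [h0, map_zero])
  ext w
  rw [← hf, h1, ← aBilin_apply]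
  simp

/-- The spectral coefficients of `A f`. -/
lemma IsEigensystem.inner_of_isA (h : IsEigensystem Ω φ μ) {f g : L2 Ω} (hfg : IsA f g) (j : ℕ) :
    ⟪φ j, g⟫ = μ j * ⟪φ j, f⟫ := by
  have := hfg.inner_eq (h.eigen j)
  rw [real_inner_comm, this, inner_smul_left]
  rfl

end

section

/-! ### Spectral multipliers -/

section Multiplier

variable {H : Type*} [NormedAddCommGroup H] [InnerProductSpace ℝ H] (φ : HilbertBasis ℕ ℝ H)

lemma hasSum_inner_sq (x : H) : HasSum (fun j => ⟪φ j, x⟫ ^ 2) (‖x‖ ^ 2) := by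
  have h := φ.hasSum_inner_mul_inner x x
  rw [real_inner_self_eq_norm_sq] at h
  simpa only [real_inner_comm (φ _) x, pow_two] using h

/-- The spectral multiplier `b`: the `k`-th coefficient of `f` in the basis is multiplied by
`b k`. -/
def mult (b : ℕ → ℝ) (f : H) : H := ∑' k, (b k * ⟪φ k, f⟫) • φ k

variable {φ}

/-- The coefficients of a bounded multiplier. -/
lemma inner_mult {b : ℕ → ℝ} {M : ℝ} (hb : ∀ k, |b k| ≤ M) (f : H) (j : ℕ) :
    ⟪φ j, mult φ b f⟫ = b j * ⟪φ j, f⟫ := by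
  have hs : Summable fun k => ‖b k * ⟪φ k, f⟫‖ ^ (2 : ENNReal).toReal := by
    refine Summable.of_nonneg_of_le (fun k => by positivity) (fun k => ?_)
      ((hasSum_inner_sq φ f).summable.mul_left (M ^ 2))
    rw [ENNReal.toReal_ofNat, Real.rpow_ofNat, Real.norm_eq_abs, sq_abs, mul_pow]
    exact mul_le_mul_of_nonneg_right (sq_le_sq.2 ((hb k).trans (le_abs_self M))) (sq_nonneg _)
  let c : lp (fun _ : ℕ => ℝ) 2 := ⟨fun k => b k * ⟪φ k, f⟫, memℓp_gen hs⟩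
  have h : mult φ b f = φ.repr.symm c := (φ.hasSum_repr_symm c).tsum_eq
  rw [h, ← φ.repr_apply_apply, LinearIsometryEquiv.apply_symm_apply]

lemma norm_le_of_inner_le {x : H} {M : ℝ} (hM : 0 ≤ M) {d : ℕ → ℝ}
    (hd : Summable fun j => d j ^ 2) (h : ∀ j, |⟪φ j, x⟫| ≤ M * |d j|) :
    ‖x‖ ≤ M * Real.sqrt (∑' j, d j ^ 2) := by
  refine le_of_sq_le_sq ?_ (by positivity)
  rw [mul_pow, Real.sq_sqrt (tsum_nonneg fun j => sq_nonneg _), ← tsum_mul_left]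
  refine hasSum_le (fun j => ?_) (hasSum_inner_sq φ x) (hd.mul_left _).hasSum
  rw [← mul_pow]
  exact sq_le_sq.2 ((h j).trans_eq (by rw [abs_mul, abs_of_nonneg hM]))

/-- Dominated convergence for sums of squares. -/
lemma tendsto_tsum_sq {ι : Type*} {l : Filter ι} {a : ι → ℕ → ℝ} {B : ℕ → ℝ}
    (hB : Summable fun k => B k ^ 2) (hlim : ∀ k, Tendsto (fun s => a s k) l (𝓝 0))
    (hle : ∀ᶠ s in l, ∀ k, |a s k| ≤ |B k|) : Tendsto (fun s => ∑' k, a s k ^ 2) l (𝓝 0) := by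
  have h := tendsto_tsum_of_dominated_convergence (𝓕 := l) (f := fun s k => a s k ^ 2)
    (g := fun _ => 0) hB (fun k => by simpa using (hlim k).pow 2)
    (hle.mono fun s hs k => by
      rw [Real.norm_eq_abs, abs_of_nonneg (sq_nonneg _)]
      exact sq_le_sq.2 (hs k))
  simpa using h

/-- Convergence of the coefficients under a square summable bound implies convergence. -/
lemma tendsto_of_tendsto_inner {ι : Type*} {l : Filter ι} {x : ι → H} {y : H} {B : ℕ → ℝ}
    (hB : Summable fun k => B k ^ 2)
    (hlim : ∀ k, Tendsto (fun s => ⟪φ k, x s⟫) l (𝓝 ⟪φ k, y⟫))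
    (hle : ∀ᶠ s in l, ∀ k, |⟪φ k, x s⟫| ≤ B k) (hy : ∀ k, |⟪φ k, y⟫| ≤ B k) :
    Tendsto x l (𝓝 y) := by
  rw [tendsto_iff_norm_sub_tendsto_zero]
  have h : Tendsto (fun s => ∑' k, ⟪φ k, x s - y⟫ ^ 2) l (𝓝 0) := by
    refine tendsto_tsum_sq (B := fun k => 2 * B k) ?_ (fun k => ?_) ?_
    · simpa only [mul_pow] using hB.mul_left (2 ^ 2)
    · simpa only [inner_sub_right, sub_self] using (hlim k).sub_const ⟪φ k, y⟫
    · filter_upwards [hle] with s hs k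
      rw [inner_sub_right]
      have h1 := abs_sub ⟪φ k, x s⟫ ⟪φ k, y⟫
      have h2 := hs k
      have h3 := hy k
      exact le_trans (by linarith) (le_abs_self _)
  have h2 := h.sqrt
  rw [Real.sqrt_zero] at h2
  refine h2.congr fun s => ?_
  rw [(hasSum_inner_sq φ (x s - y)).tsum_eq, Real.sqrt_sq (norm_nonneg _)]

/-- A curve may be differentiated coefficient by coefficient if the derivatives have a square
summable bound near the point. -/
lemma hasDerivAt_of_inner {w w' : ℝ → H} {t r : ℝ} (hr : 0 < r) {B : ℕ → ℝ}
    (hB : Summable fun k => B k ^ 2)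
    (hd : ∀ k, ∀ s ∈ Metric.ball t r, HasDerivAt (fun s => ⟪φ k, w s⟫) ⟪φ k, w' s⟫ s)
    (hle : ∀ k, ∀ s ∈ Metric.ball t r, |⟪φ k, w' s⟫| ≤ B k) : HasDerivAt w (w' t) t := by
  have ht : t ∈ Metric.ball t r := Metric.mem_ball_self hr
  have hsl : ∀ k s, ⟪φ k, slope w t s⟫ = slope (fun s => ⟪φ k, w s⟫) t s := fun k s => by
    rw [slope_def_module, slope_def_module, inner_smul_right, inner_sub_right, smul_eq_mul]
  rw [hasDerivAt_iff_tendsto_slope]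
  refine tendsto_of_tendsto_inner hB (fun k => ?_) ?_ fun k => hle k t ht
  · simp only [hsl]
    exact hasDerivAt_iff_tendsto_slope.1 (hd k t ht)
  · filter_upwards [self_mem_nhdsWithin, mem_nhdsWithin_of_mem_nhds (Metric.ball_mem_nhds t hr)]
      with s hs hsr k
    have h := Convex.norm_image_sub_le_of_norm_hasDerivWithin_le
      (fun x hx => (hd k x hx).hasDerivWithinAt) (fun x hx => hle k x hx) (convex_ball t r) ht hsr
    have hpos : 0 < |s - t| := abs_pos.2 (sub_ne_zero.2 hs)
    rw [hsl, slope_def_field, abs_div, div_le_iff₀ hpos]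
    exact h

end Multiplier

section Power

variable {Ω : Set Plane} {φ : HilbertBasis ℕ ℝ (L2 Ω)} {μ : ℕ → ℝ}

lemma rpow_two_mul_sq {m : ℝ} (hm : 0 < m) (p x : ℝ) :
    m ^ (2 * p) * |x| ^ 2 = (m ^ p * |x|) ^ 2 := by
  rw [mul_pow, ← Real.rpow_natCast (m ^ p), ← Real.rpow_mul hm.le, Nat.cast_ofNat, mul_comm p]

lemma normPow_one_eq (hμ : ∀ j, 0 < μ j) (f : L2 Ω) :
    normPow φ μ 1 f = Real.sqrt (∑' j, (μ j * ⟪φ j, f⟫) ^ 2) := by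
  rw [normPow]
  congr 1
  refine tsum_congr fun j => ?_
  rw [rpow_two_mul_sq (hμ j), Real.rpow_one, mul_pow, sq_abs, mul_pow, real_inner_comm]

lemma norm_eq_sqrt_tsum (f : L2 Ω) : ‖f‖ = Real.sqrt (∑' j, ⟪φ j, f⟫ ^ 2) := by
  rw [(hasSum_inner_sq φ f).tsum_eq, Real.sqrt_sq (norm_nonneg f)]

/-- A bound of the weighted coefficients by a square summable sequence bounds the norm of `D(A^p)`. -/
lemma memDomPow_of_inner_le (hμ : ∀ j, 0 < μ j) {x : L2 Ω} {p M : ℝ} (hM : 0 ≤ M) {d : ℕ → ℝ}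
    (hd : Summable fun j => d j ^ 2) (h : ∀ j, μ j ^ p * |⟪φ j, x⟫| ≤ M * |d j|) :
    MemDomPow φ μ p x ∧ normPow φ μ p x ≤ M * Real.sqrt (∑' j, d j ^ 2) := by
  have hle : ∀ j, μ j ^ (2 * p) * |⟪x, φ j⟫| ^ 2 ≤ M ^ 2 * d j ^ 2 := fun j => by
    rw [rpow_two_mul_sq (hμ j), ← mul_pow, real_inner_comm]
    have h0 : 0 ≤ μ j ^ p * |⟪φ j, x⟫| := mul_nonneg (Real.rpow_nonneg (hμ j).le _) (abs_nonneg _)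
    refine sq_le_sq.2 ?_
    rw [abs_of_nonneg h0, abs_mul, abs_of_nonneg hM]
    exact h j
  have hs : MemDomPow φ μ p x := Summable.of_nonneg_of_le
    (fun j => mul_nonneg (Real.rpow_nonneg (hμ j).le _) (sq_nonneg _)) hle (hd.mul_left _)
  refine ⟨hs, Real.sqrt_le_iff.2 ⟨by positivity, ?_⟩⟩
  rw [mul_pow, Real.sq_sqrt (tsum_nonneg fun j => sq_nonneg _), ← tsum_mul_left]
  exact hs.tsum_le_tsum hle (hd.mul_left _)

end Power

end

section

/-! ### The solution operator -/

lemma half_lt_of_mem_ball {s t : ℝ} (hs : s ∈ Metric.ball t (t / 2)) : t / 2 < s := by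
  have := (abs_lt.1 (Real.dist_eq s t ▸ Metric.mem_ball.1 hs)).1
  linarith

section Flow

open MittagLeffler

variable {H : Type*} [NormedAddCommGroup H] [InnerProductSpace ℝ H] {φ : HilbertBasis ℕ ℝ H}
  {μ : ℕ → ℝ} {α : ℝ}

/-- The solution of `∂ₜ^α u + A u = 0`, `u(0) = f`: the `k`-th mode is multiplied by the
Mittag-Leffler function `E_α(-μ_k t^α)`. -/
def flow (φ : HilbertBasis ℕ ℝ H) (μ : ℕ → ℝ) (α : ℝ) (f : H) (t : ℝ) : H :=
  mult φ (fun k => mode α (μ k) t) f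

/-- The first time derivative of `flow`. -/
def flow' (φ : HilbertBasis ℕ ℝ H) (μ : ℕ → ℝ) (α : ℝ) (f : H) (t : ℝ) : H :=
  mult φ (fun k => mode' α (μ k) t) f

/-- The second time derivative of `flow`. -/
def flow'' (φ : HilbertBasis ℕ ℝ H) (μ : ℕ → ℝ) (α : ℝ) (f : H) (t : ℝ) : H :=
  mult φ (fun k => mode'' α (μ k) t) f

/-- The fractional time derivative `-A u` of `flow`. -/
def flowCaputo (φ : HilbertBasis ℕ ℝ H) (μ : ℕ → ℝ) (α : ℝ) (f : H) (t : ℝ) : H :=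
  mult φ (fun k => -μ k * mode α (μ k) t) f

variable (h0 : 0 < α) (h1 : α < 1) (hμ : ∀ k, 0 < μ k) (f : H) {t : ℝ}
include h0 h1 hμ

lemma abs_mode_le_one (ht : 0 ≤ t) (k : ℕ) : |mode α (μ k) t| ≤ 1 := by
  rw [abs_of_nonneg (mode_nonneg h0 h1 t)]
  exact mode_le_one h0 h1 (hμ k) ht

lemma abs_mode'_le_div (ht : 0 < t) (k : ℕ) : |mode' α (μ k) t| ≤ modeConst α / t := by
  rw [le_div_iff₀ ht, mul_comm]
  exact mul_abs_mode'_le h0 h1 (hμ k) ht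

lemma abs_mul_mode_le (ht : 0 < t) (k : ℕ) :
    |-μ k * mode α (μ k) t| ≤ modeConst α * t ^ (-α) := by
  have h := rpow_mul_mode_le h0 h1 (hμ k) ht (right_mem_Icc.2 zero_le_one)
  rwa [Real.rpow_one, mul_one, ← abs_of_pos (hμ k), ← abs_mul, abs_of_pos (hμ k), ← abs_neg,
    ← neg_mul] at h

lemma inner_flow (ht : 0 ≤ t) (k : ℕ) :
    ⟪φ k, flow φ μ α f t⟫ = mode α (μ k) t * ⟪φ k, f⟫ :=
  inner_mult (abs_mode_le_one h0 h1 hμ ht) f k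

lemma inner_flow' (ht : 0 < t) (k : ℕ) :
    ⟪φ k, flow' φ μ α f t⟫ = mode' α (μ k) t * ⟪φ k, f⟫ :=
  inner_mult (abs_mode'_le_div h0 h1 hμ ht) f k

lemma inner_flow'' (ht : 0 < t) (k : ℕ) :
    ⟪φ k, flow'' φ μ α f t⟫ = mode'' α (μ k) t * ⟪φ k, f⟫ :=
  inner_mult (fun k => abs_mode''_le_rpow h0 h1 (hμ k) ht) f k

lemma inner_flowCaputo (ht : 0 < t) (k : ℕ) :
    ⟪φ k, flowCaputo φ μ α f t⟫ = -μ k * mode α (μ k) t * ⟪φ k, f⟫ :=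
  inner_mult (abs_mul_mode_le h0 h1 hμ ht) f k

lemma continuousOn_flow : ContinuousOn (flow φ μ α f) (Ici 0) := fun t ht => by
  have hle : ∀ s ∈ Ici (0 : ℝ), ∀ k, |⟪φ k, flow φ μ α f s⟫| ≤ |⟪φ k, f⟫| := fun s hs k => by
    rw [inner_flow h0 h1 hμ f hs, abs_mul]
    exact mul_le_of_le_one_left (abs_nonneg _) (abs_mode_le_one h0 h1 hμ hs k)
  refine tendsto_of_tendsto_inner (B := fun k => |⟪φ k, f⟫|)
    (by simpa only [sq_abs] using (hasSum_inner_sq φ f).summable) (fun k => ?_)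
    (eventually_of_mem self_mem_nhdsWithin hle) (hle t ht)
  rw [inner_flow h0 h1 hμ f ht]
  refine (((continuousOn_mode h0 h1 (hμ k)) t ht).mul_const ⟪φ k, f⟫).congr' ?_
  filter_upwards [self_mem_nhdsWithin] with s hs
  exact (inner_flow h0 h1 hμ f hs k).symm

lemma hasDerivAt_flow (ht : 0 < t) : HasDerivAt (flow φ μ α f) (flow' φ μ α f t) t := by
  have hpos : ∀ s ∈ Metric.ball t (t / 2), 0 < s := fun s hs =>
    (half_pos ht).trans (half_lt_of_mem_ball hs)
  have hC := zero_le_one.trans (one_le_modeConst h0 h1)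
  refine hasDerivAt_of_inner (φ := φ) (half_pos ht)
    (B := fun k => modeConst α / (t / 2) * |⟪φ k, f⟫|) ?_ (fun k s hs => ?_) fun k s hs => ?_
  · simpa only [mul_pow, sq_abs] using (hasSum_inner_sq φ f).summable.mul_left _
  · rw [inner_flow' h0 h1 hμ f (hpos s hs)]
    refine ((hasDerivAt_mode h0 h1 (hμ k) (hpos s hs)).mul_const ⟪φ k, f⟫).congr_of_eventuallyEq ?_
    filter_upwards [lt_mem_nhds (hpos s hs)] with x hx
    exact inner_flow h0 h1 hμ f hx.le k
  · rw [inner_flow' h0 h1 hμ f (hpos s hs), abs_mul]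
    refine mul_le_mul_of_nonneg_right ((abs_mode'_le_div h0 h1 hμ (hpos s hs) k).trans ?_)
      (abs_nonneg _)
    exact div_le_div_of_nonneg_left hC (half_pos ht) (half_lt_of_mem_ball hs).le

lemma hasDerivAt_flow' (ht : 0 < t) : HasDerivAt (flow' φ μ α f) (flow'' φ μ α f t) t := by
  have hpos : ∀ s ∈ Metric.ball t (t / 2), 0 < s := fun s hs =>
    (half_pos ht).trans (half_lt_of_mem_ball hs)
  have hC := zero_le_one.trans (one_le_modeConst h0 h1)
  refine hasDerivAt_of_inner (φ := φ) (half_pos ht)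
    (B := fun k => modeConst α * (t / 2) ^ (-2 : ℝ) * |⟪φ k, f⟫|) ?_ (fun k s hs => ?_)
    fun k s hs => ?_
  · simpa only [mul_pow, sq_abs] using (hasSum_inner_sq φ f).summable.mul_left _
  · rw [inner_flow'' h0 h1 hμ f (hpos s hs)]
    refine ((hasDerivAt_mode' h0 h1 (hμ k) (hpos s hs)).mul_const ⟪φ k, f⟫).congr_of_eventuallyEq ?_
    filter_upwards [lt_mem_nhds (hpos s hs)] with x hx
    exact inner_flow' h0 h1 hμ f hx k
  · rw [inner_flow'' h0 h1 hμ f (hpos s hs), abs_mul]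
    refine mul_le_mul_of_nonneg_right ((abs_mode''_le_rpow h0 h1 (hμ k) (hpos s hs)).trans ?_)
      (abs_nonneg _)
    exact mul_le_mul_of_nonneg_left (Real.rpow_le_rpow_of_nonpos (half_pos ht)
      (half_lt_of_mem_ball hs).le (by norm_num)) hC

lemma continuousOn_flow' : ContinuousOn (flow' φ μ α f) (Ioi 0) := fun _ ht =>
  (hasDerivAt_flow' h0 h1 hμ f ht).continuousAt.continuousWithinAt

end Flow

/-! ### Estimates -/

section Bounds

open MittagLeffler

variable {Ω : Set Plane} {φ : HilbertBasis ℕ ℝ (L2 Ω)} {μ : ℕ → ℝ} {α : ℝ}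

variable (h0 : 0 < α) (h1 : α < 1) (hμ : ∀ k, 0 < μ k) (f : L2 Ω) {t p : ℝ}
include h0 h1 hμ

lemma normPow_flow_le (ht : 0 < t) (hp : p ∈ Icc (0 : ℝ) 1) :
    MemDomPow φ μ p (flow φ μ α f t) ∧
      normPow φ μ p (flow φ μ α f t) ≤ modeConst α * t ^ (-(α * p)) * ‖f‖ := by
  have hC := zero_le_one.trans (one_le_modeConst h0 h1)
  rw [norm_eq_sqrt_tsum (φ := φ) f]
  refine memDomPow_of_inner_le hμ (by positivity) (hasSum_inner_sq φ f).summable fun k => ?_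
  rw [inner_flow h0 h1 hμ f ht.le, abs_mul, ← mul_assoc]
  exact mul_le_mul_of_nonneg_right (rpow_mul_mode_le h0 h1 (hμ k) ht hp) (abs_nonneg _)

lemma normPow_flow'_le (ht : 0 < t) (hp : p ∈ Icc (0 : ℝ) 1) :
    MemDomPow φ μ p (flow' φ μ α f t) ∧
      normPow φ μ p (flow' φ μ α f t) ≤ modeConst α * t ^ (-(1 + α * p)) * ‖f‖ := by
  have hC := zero_le_one.trans (one_le_modeConst h0 h1)
  rw [norm_eq_sqrt_tsum (φ := φ) f]
  refine memDomPow_of_inner_le hμ (by positivity) (hasSum_inner_sq φ f).summable fun k => ?_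
  rw [inner_flow' h0 h1 hμ f ht, abs_mul, ← mul_assoc]
  exact mul_le_mul_of_nonneg_right (rpow_mul_mode'_le h0 h1 (hμ k) ht hp) (abs_nonneg _)

lemma norm_flow''_le (ht : 0 < t) :
    ‖flow'' φ μ α f t‖ ≤ modeConst α * t ^ (-2 : ℝ) * ‖f‖ := by
  have hC := zero_le_one.trans (one_le_modeConst h0 h1)
  rw [norm_eq_sqrt_tsum (φ := φ) f]
  refine norm_le_of_inner_le (φ := φ) (by positivity) (hasSum_inner_sq φ f).summable fun k => ?_
  rw [inner_flow'' h0 h1 hμ f ht, abs_mul]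
  exact mul_le_mul_of_nonneg_right (abs_mode''_le_rpow h0 h1 (hμ k) ht) (abs_nonneg _)

lemma norm_flowCaputo_le (ht : 0 < t) :
    ‖flowCaputo φ μ α f t‖ ≤ modeConst α * t ^ (-α) * ‖f‖ := by
  have hC := zero_le_one.trans (one_le_modeConst h0 h1)
  rw [norm_eq_sqrt_tsum (φ := φ) f]
  refine norm_le_of_inner_le (φ := φ) (by positivity) (hasSum_inner_sq φ f).summable fun k => ?_
  rw [inner_flowCaputo h0 h1 hμ f ht, abs_mul]
  exact mul_le_mul_of_nonneg_right (abs_mul_mode_le h0 h1 hμ ht k) (abs_nonneg _)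

lemma norm_flow_le (ht : 0 ≤ t) : ‖flow φ μ α f t‖ ≤ modeConst α * ‖f‖ := by
  have hC := one_le_modeConst h0 h1
  rw [norm_eq_sqrt_tsum (φ := φ) f]
  refine norm_le_of_inner_le (φ := φ) (by positivity) (hasSum_inner_sq φ f).summable fun k => ?_
  rw [inner_flow h0 h1 hμ f ht, abs_mul]
  exact mul_le_mul_of_nonneg_right ((abs_mode_le_one h0 h1 hμ ht k).trans hC) (abs_nonneg _)

-- square summability of the coefficients of `A f` expresses `f ∈ D(A)`
variable {f} (hf : Summable fun k => (μ k * ⟪φ k, f⟫) ^ 2)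
include hf

lemma normPow_one_flow_le (ht : 0 ≤ t) :
    MemDomPow φ μ 1 (flow φ μ α f t) ∧
      normPow φ μ 1 (flow φ μ α f t) ≤ modeConst α * normPow φ μ 1 f := by
  have hC := one_le_modeConst h0 h1
  rw [normPow_one_eq hμ f]
  refine memDomPow_of_inner_le hμ (by positivity) hf fun k => ?_
  rw [inner_flow h0 h1 hμ f ht, abs_mul, abs_mul, abs_of_pos (hμ k), Real.rpow_one, mul_left_comm]
  exact mul_le_mul_of_nonneg_right ((abs_mode_le_one h0 h1 hμ ht k).trans hC)
    (mul_nonneg (hμ k).le (abs_nonneg _))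

lemma normPow_flow'_le_smooth (ht : 0 < t) (hp : p ∈ Icc (0 : ℝ) 1) :
    MemDomPow φ μ p (flow' φ μ α f t) ∧ normPow φ μ p (flow' φ μ α f t) ≤
      modeConst α * t ^ (-(1 + α * (p - 1))) * normPow φ μ 1 f := by
  have hC := zero_le_one.trans (one_le_modeConst h0 h1)
  rw [normPow_one_eq hμ f]
  refine memDomPow_of_inner_le hμ (by positivity) hf fun k => ?_
  rw [inner_flow' h0 h1 hμ f ht, abs_mul, abs_mul, abs_of_pos (hμ k), ← mul_assoc, ← mul_assoc]
  exact mul_le_mul_of_nonneg_right (rpow_mul_mode'_le_smooth h0 h1 (hμ k) ht hp) (abs_nonneg _)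

lemma norm_flow''_le_smooth (ht : 0 < t) :
    ‖flow'' φ μ α f t‖ ≤ modeConst α * t ^ (α - 2) * normPow φ μ 1 f := by
  have hC := zero_le_one.trans (one_le_modeConst h0 h1)
  rw [normPow_one_eq hμ f]
  refine norm_le_of_inner_le (φ := φ) (by positivity) hf fun k => ?_
  rw [inner_flow'' h0 h1 hμ f ht, abs_mul, abs_mul, abs_of_pos (hμ k), ← mul_assoc]
  exact mul_le_mul_of_nonneg_right (abs_mode''_le_smooth h0 h1 (hμ k) ht) (abs_nonneg _)

lemma norm_flowCaputo_le_smooth (ht : 0 < t) :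
    ‖flowCaputo φ μ α f t‖ ≤ modeConst α * normPow φ μ 1 f := by
  have hC := one_le_modeConst h0 h1
  rw [normPow_one_eq hμ f]
  refine norm_le_of_inner_le (φ := φ) (by positivity) hf fun k => ?_
  rw [inner_flowCaputo h0 h1 hμ f ht, neg_mul, neg_mul, abs_neg, mul_comm (μ k), mul_assoc, abs_mul]
  exact mul_le_mul_of_nonneg_right ((abs_mode_le_one h0 h1 hμ ht.le k).trans hC) (abs_nonneg _)

/-- Continuity of the flow in `D(A)`, at every time including zero. -/
lemma tendsto_normPow_one_flow_sub (ht : 0 ≤ t) :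
    Tendsto (fun s => normPow φ μ 1 (flow φ μ α f s - flow φ μ α f t)) (𝓝[Ici 0] t) (𝓝 0) := by
  have h := tendsto_tsum_sq (l := 𝓝[Ici 0] t)
    (a := fun s k => μ k * ⟪φ k, flow φ μ α f s - flow φ μ α f t⟫)
    (B := fun k => 2 * (μ k * ⟪φ k, f⟫)) (by simpa only [mul_pow] using hf.mul_left (2 ^ 2))
    (fun k => ?_) ?_
  · have h2 := h.sqrt
    rw [Real.sqrt_zero] at h2
    exact h2.congr fun s => (normPow_one_eq hμ _).symm
  · have h2 := ((continuousOn_flow (φ := φ) h0 h1 hμ f t ht).tendsto.sub_const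
      (flow φ μ α f t))
    rw [sub_self] at h2
    simpa using (Tendsto.inner (tendsto_const_nhds (x := φ k)) h2).const_mul (μ k)
  · filter_upwards [self_mem_nhdsWithin] with s hs k
    rw [inner_sub_right, inner_flow h0 h1 hμ f hs, inner_flow h0 h1 hμ f ht, ← sub_mul,
      mul_left_comm, abs_mul, abs_mul 2, abs_two]
    refine mul_le_mul_of_nonneg_right ?_ (abs_nonneg _)
    have h3 := abs_sub (mode α (μ k) s) (mode α (μ k) t)
    have h4 := abs_mode_le_one h0 h1 hμ hs k
    have h5 := abs_mode_le_one h0 h1 hμ ht k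
    linarith

end Bounds

end

section

/-! ### Weak solutions -/

lemma intervalIntegrable_of_integrableOn_Ioo {X : Type*} [NormedAddCommGroup X] {T : ℝ} {g : ℝ → X}
    (hg : IntegrableOn g (Ioo 0 T)) {t : ℝ} (ht : t ∈ Icc 0 T) : IntervalIntegrable g volume 0 t :=
  (intervalIntegrable_iff_integrableOn_Ioo_of_le ht.1).2
    (hg.mono_set (Ioo_subset_Ioo_right ht.2))

section Primitive

variable {X : Type*} [NormedAddCommGroup X] [NormedSpace ℝ X] {T : ℝ} {u g : ℝ → X}

/-- Lebesgue's differentiation theorem for functions of class `W^{1,1}`. -/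
lemma ae_deriv_eq [CompleteSpace X] (hg : IntegrableOn g (Ioo 0 T))
    (hu : ∀ t ∈ Icc 0 T, u t = u 0 + ∫ s in (0 : ℝ)..t, g s) :
    ∀ᵐ t, t ∈ Ioo 0 T → deriv u t = g t := by
  rcases le_or_gt T 0 with hT | hT
  · exact Eventually.of_forall fun t ht => absurd (ht.1.trans ht.2) (not_lt.2 hT)
  have hi := intervalIntegrable_of_integrableOn_Ioo hg (right_mem_Icc.2 hT.le)
  filter_upwards [hi.ae_hasDerivAt_integral] with t ht htI
  rw [uIcc_of_le hT.le] at ht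
  refine (((ht ⟨htI.1.le, htI.2.le⟩ 0 (left_mem_Icc.2 hT.le)).const_add (u 0)).congr_of_eventuallyEq
    ?_).deriv
  filter_upwards [Ioo_mem_nhds htI.1 htI.2] with s hs
  exact hu s ⟨hs.1.le, hs.2.le⟩

lemma rlIntegral_congr_ae {β t : ℝ} {v v' : ℝ → X} (ht : t ∈ Icc 0 T)
    (h : ∀ᵐ s, s ∈ Ioo 0 T → v s = v' s) : rlIntegral β v t = rlIntegral β v' t := by
  refine intervalIntegral.integral_congr_ae ?_
  have hne : ∀ᵐ s : ℝ, s ≠ t := by simp [ae_iff, measure_singleton]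
  filter_upwards [h, hne] with s hs hst hsI
  rw [uIoc_of_le ht.1] at hsI
  rw [hs ⟨hsI.1, (hsI.2.lt_of_ne hst).trans_le ht.2⟩]

end Primitive

variable {Ω : Set Plane}

/-- The inclusion `L²(Ω) ⊂ V*` as a bounded linear map. -/
def embDualL (Ω : Set Plane) : L2 Ω →L[ℝ] VDual Ω :=
  ((ContinuousLinearMap.compL ℝ (V Ω) (L2 Ω) ℝ).flip (toL2 Ω)).comp
    (isBoundedBilinearMap_inner (𝕜 := ℝ) (E := L2 Ω)).toContinuousLinearMap

lemma embDualL_apply (f : L2 Ω) : embDualL Ω f = embDual Ω f := rfl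

lemma embDual_apply (f : L2 Ω) (v : V Ω) : embDual Ω f v = ⟪f, toL2 Ω v⟫ := rfl

variable {α T : ℝ} {φ : HilbertBasis ℕ ℝ (L2 Ω)} {μ : ℕ → ℝ} {u₀ : L2 Ω} {u : ℝ → VDual Ω}

lemma IsWeakSolution.apply_zero (hT : 0 < T) (hu : IsWeakSolution Ω α T u₀ u) :
    u 0 = embDual Ω u₀ := by
  obtain ⟨g, hg, hug⟩ := hu.memW11
  have hc := MittagLeffler.continuousOn_of_eq_integral hg hug 0 (left_mem_Icc.2 hT.le)
  have h1 : Tendsto u (𝓝[>] 0) (𝓝 (u 0)) := by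
    rw [← nhdsWithin_Ioc_eq_nhdsGT hT]
    exact hc.mono Ioc_subset_Icc_self
  exact tendsto_nhds_unique h1 (tendsto_iff_norm_sub_tendsto_zero.2 hu.initial)

/-- A weak solution is given by the Mittag-Leffler multipliers: its modes solve scalar fractional
differential equations, and the eigenfunctions are total in `V`. -/
theorem IsWeakSolution.eq_flow (h0 : 0 < α) (h1 : α < 1) (hT : 0 < T) (hΩ : IsOpen Ω)
    (hb : Bornology.IsBounded Ω) (hφ : IsEigensystem Ω φ μ) (hu : IsWeakSolution Ω α T u₀ u) {t : ℝ}
    (ht : t ∈ Icc 0 T) : u t = embDual Ω (flow φ μ α u₀ t) := by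
  obtain ⟨v, hv, hav⟩ := hφ.exists_lift
  obtain ⟨g, hg, hug⟩ := hu.memW11
  obtain ⟨w, -, huw, heq⟩ := hu.equation
  refine sub_eq_zero.1 (eq_zero_of_apply_eigenfunction hΩ hb hφ hav fun k => ?_)
  have hy : ∀ s ∈ Icc 0 T, u s (v k) = u 0 (v k) + ∫ r in (0 : ℝ)..s, g r (v k) := fun s hs => by
    rw [hug s hs]
    have h := (ContinuousLinearMap.apply ℝ ℝ (v k)).intervalIntegral_comp_comm
      (intervalIntegrable_of_integrableOn_Ioo hg hs)
    simp only [ContinuousLinearMap.apply_apply] at h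
    rw [_root_.add_apply, h]
  have hgk : IntegrableOn (fun r => g r (v k)) (Ioo 0 T) :=
    (ContinuousLinearMap.apply ℝ ℝ (v k)).integrable_comp hg
  have hode : ∀ᵐ s ∂volume.restrict (Ioo 0 T),
      rlIntegral (1 - α) (fun r => g r (v k)) s + μ k * u s (v k) = 0 := by
    filter_upwards [huw, heq (v k), ae_restrict_mem measurableSet_Ioo] with s h2 h3 hs
    rw [caputo, rlIntegral_congr_ae ⟨hs.1.le, hs.2.le⟩ (ae_deriv_eq hgk hy), aForm_comm, hav] at h3
    rw [h2, embDual_apply, hv, real_inner_comm]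
    exact h3
  have h4 := MittagLeffler.eq_mode_of_equation h0 h1 (hφ.pos k) hgk hy hode t ht
  rw [_root_.sub_apply, h4, hu.apply_zero hT, embDual_apply, embDual_apply, hv, real_inner_comm,
    real_inner_comm (φ k) (flow φ μ α u₀ t), inner_flow h0 h1 hφ.pos u₀ ht.1, mul_comm, sub_self]

lemma IsWeakSolution.hasDerivAt (h0 : 0 < α) (h1 : α < 1) (hT : 0 < T) (hΩ : IsOpen Ω)
    (hb : Bornology.IsBounded Ω) (hφ : IsEigensystem Ω φ μ) (hu : IsWeakSolution Ω α T u₀ u) {t : ℝ}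
    (ht : t ∈ Ioo 0 T) : HasDerivAt u (embDual Ω (flow' φ μ α u₀ t)) t := by
  refine ((embDualL Ω).hasFDerivAt.comp_hasDerivAt t
    (hasDerivAt_flow h0 h1 hφ.pos u₀ ht.1)).congr_of_eventuallyEq ?_
  filter_upwards [Ioo_mem_nhds ht.1 ht.2] with s hs
  exact hu.eq_flow h0 h1 hT hΩ hb hφ ⟨hs.1.le, hs.2.le⟩

/-- The integral that defines the Caputo derivative of a weak solution converges in `V*` at every
positive time: the kernel is bounded on the first half of the interval, and the derivative of the
solution on the second. -/
lemma IsWeakSolution.intervalIntegrable_caputo (h0 : 0 < α) (h1 : α < 1) (hΩ : IsOpen Ω)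
    (hb : Bornology.IsBounded Ω) (hφ : IsEigensystem Ω φ μ) (hu : IsWeakSolution Ω α T u₀ u) {t : ℝ}
    (ht : t ∈ Ioc 0 T) :
    IntervalIntegrable (fun s => kappa (1 - α) (t - s) • deriv u s) volume 0 t := by
  have hT := ht.1.trans_le ht.2
  have hh := half_pos ht.1
  have hht := half_lt_self ht.1
  obtain ⟨g, hg, hug⟩ := hu.memW11
  refine IntervalIntegrable.trans (b := t / 2) ?_ ?_
  · have hgi := intervalIntegrable_of_integrableOn_Ioo hg (t := t / 2)
      ⟨hh.le, (hht.le.trans ht.2)⟩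
    have hd : IntervalIntegrable (deriv u) volume 0 (t / 2) := by
      refine hgi.congr_ae ?_
      rw [uIoc_of_le hh.le]
      filter_upwards [ae_restrict_of_ae (ae_deriv_eq hg hug), ae_restrict_mem measurableSet_Ioc]
        with s h2 hs
      exact (h2 ⟨hs.1, (hs.2.trans_lt hht).trans_le ht.2⟩).symm
    refine hd.continuousOn_smul ?_
    rw [uIcc_of_le hh.le]
    have hk : ContinuousOn (kappa (1 - α)) (Ioi 0) := fun x hx =>
      ((Real.continuousAt_rpow_const x _ (Or.inl (ne_of_gt hx))).div_const _).continuousWithinAt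
    refine hk.comp (continuousOn_const.sub continuousOn_id) fun s hs => ?_
    exact sub_pos.2 (hs.2.trans_lt hht)
  · have hk : IntervalIntegrable (fun s => kappa (1 - α) (t - s)) volume (t / 2) t := by
      have h := (MittagLeffler.intervalIntegrable_kappa (sub_pos.2 h1) (t - t / 2)
        (t - t)).comp_sub_left t
      simpa only [sub_sub_cancel] using h
    have hc : ContinuousOn (fun s => embDualL Ω (flow' φ μ α u₀ s)) (uIcc (t / 2) t) := by
      rw [uIcc_of_le hht.le]
      exact (embDualL Ω).continuous.comp_continuousOn
        ((continuousOn_flow' h0 h1 hφ.pos u₀).mono fun s hs => hh.trans_le hs.1)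
    refine (hk.smul_continuousOn hc).congr_ae ?_
    rw [uIoc_of_le hht.le]
    have hne : ∀ᵐ s : ℝ, s ≠ t := by simp [ae_iff, measure_singleton]
    filter_upwards [ae_restrict_of_ae hne, ae_restrict_mem measurableSet_Ioc] with s hst hs
    rw [(hu.hasDerivAt h0 h1 hT hΩ hb hφ
      ⟨hh.trans hs.1, (hs.2.lt_of_ne hst).trans_le ht.2⟩).deriv, embDualL_apply]

lemma IsWeakSolution.caputo_eq (h0 : 0 < α) (h1 : α < 1) (hΩ : IsOpen Ω)
    (hb : Bornology.IsBounded Ω) (hφ : IsEigensystem Ω φ μ) (hu : IsWeakSolution Ω α T u₀ u) {t : ℝ}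
    (ht : t ∈ Ioc 0 T) : caputo α u t = embDual Ω (flowCaputo φ μ α u₀ t) := by
  have hT := ht.1.trans_le ht.2
  obtain ⟨v, hv, hav⟩ := hφ.exists_lift
  refine sub_eq_zero.1 (eq_zero_of_apply_eigenfunction hΩ hb hφ hav fun k => ?_)
  have h2 := (ContinuousLinearMap.apply ℝ ℝ (v k)).intervalIntegral_comp_comm
    (hu.intervalIntegrable_caputo h0 h1 hΩ hb hφ ht)
  have h3 : rlIntegral (1 - α) (fun s => deriv u s (v k)) t =
      rlIntegral (1 - α) (fun s => ⟪φ k, u₀⟫ • MittagLeffler.mode' α (μ k) s) t := by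
    refine rlIntegral_congr_ae ⟨ht.1.le, ht.2⟩ (Eventually.of_forall fun s hs => ?_)
    rw [(hu.hasDerivAt h0 h1 hT hΩ hb hφ hs).deriv, embDual_apply, hv, real_inner_comm,
      inner_flow' h0 h1 hφ.pos u₀ hs.1, smul_eq_mul, mul_comm]
  have h4 : rlIntegral (1 - α) (fun s => ⟪φ k, u₀⟫ • MittagLeffler.mode' α (μ k) s) t =
      ⟪φ k, u₀⟫ * rlIntegral (1 - α) (MittagLeffler.mode' α (μ k)) t := by
    simp only [rlIntegral, smul_eq_mul, ← intervalIntegral.integral_const_mul, mul_left_comm]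
  simp only [ContinuousLinearMap.apply_apply, _root_.smul_apply] at h2
  rw [_root_.sub_apply, caputo, rlIntegral, ← h2]
  change rlIntegral (1 - α) (fun s => deriv u s (v k)) t - _ = 0
  rw [h3, h4, MittagLeffler.rlIntegral_mode' h0 h1 (hφ.pos k) ht.1, embDual_apply, hv,
    real_inner_comm (φ k) (flowCaputo φ μ α u₀ t), inner_flowCaputo h0 h1 hφ.pos u₀ ht.1, mul_comm,
    sub_self]

end

end FracBiharmonic

end

theorem theorem2p2 (α : ℝ) (hα₀ : 0 < α) (hα₁ : α < 1) (T : ℝ) (hT : 0 < T) :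
    ∃ C : ℝ, 0 < C ∧ ∀ Ω : Set Plane, IsOpen Ω → Bornology.IsBounded Ω → Ω.Nonempty →
      (∃ (φ : HilbertBasis ℕ ℝ (L2 Ω)) (μ : ℕ → ℝ), IsEigensystem Ω φ μ) ∧
      ∀ (φ : HilbertBasis ℕ ℝ (L2 Ω)) (μ : ℕ → ℝ), IsEigensystem Ω φ μ →
      ∀ (u₀ : L2 Ω) (u : ℝ → VDual Ω), IsWeakSolution Ω α T u₀ u →
      -- `w`, `w'`, `w''` and `d` are `u`, `u'`, `u''` and `∂ₜ^α u` as functions with values in `L²(Ω)`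
      ∃ w w' w'' d : ℝ → L2 Ω,
        (∀ t ∈ Icc 0 T, u t = embDual Ω (w t)) ∧
        (∀ t ∈ Ioc 0 T, HasDerivWithinAt w (w' t) (Ioc 0 T) t) ∧
        (∀ t ∈ Ioc 0 T, HasDerivWithinAt w' (w'' t) (Ioc 0 T) t) ∧
        (∀ t ∈ Ioc 0 T,
          IntervalIntegrable (fun s => kappa (1 - α) (t - s) • deriv u s) volume 0 t ∧
          caputo α u t = embDual Ω (d t)) ∧
        -- nonsmooth initial data
        ((∀ t ∈ Ioc 0 T, ∀ p ∈ Icc (0 : ℝ) 1,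
            (MemDomPow φ μ p (w t) ∧ normPow φ μ p (w t) ≤ C * t ^ (-(α * p)) * ‖u₀‖) ∧
            (MemDomPow φ μ p (w' t) ∧ normPow φ μ p (w' t) ≤ C * t ^ (-(1 + α * p)) * ‖u₀‖)) ∧
          (∀ t ∈ Ioc 0 T, ‖w'' t‖ ≤ C * t ^ (-2 : ℝ) * ‖u₀‖) ∧
          (∀ t ∈ Ioc 0 T, ‖d t‖ ≤ C * t ^ (-α) * ‖u₀‖) ∧
          ContinuousOn w (Icc 0 T) ∧
          (∀ t ∈ Icc 0 T, ‖w t‖ ≤ C * ‖u₀‖)) ∧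
        -- smooth initial data
        (MemDomA u₀ →
          (∀ t ∈ Icc 0 T, MemDomPow φ μ 1 (w t) ∧ normPow φ μ 1 (w t) ≤ C * normPow φ μ 1 u₀) ∧
          (∀ t ∈ Ioc 0 T, ∀ p ∈ Icc (0 : ℝ) 1,
            MemDomPow φ μ p (w' t) ∧
              normPow φ μ p (w' t) ≤ C * t ^ (-(1 + α * (p - 1))) * normPow φ μ 1 u₀) ∧
          (∀ t ∈ Ioc 0 T, ‖w'' t‖ ≤ C * t ^ (α - 2) * normPow φ μ 1 u₀) ∧
          (∀ t ∈ Ioc 0 T, ‖d t‖ ≤ C * normPow φ μ 1 u₀) ∧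
          (∀ t₀ ∈ Icc 0 T,
            Tendsto (fun t => normPow φ μ 1 (w t - w t₀)) (𝓝[Icc 0 T] t₀) (𝓝 0))) := by
  refine ⟨MittagLeffler.modeConst α,
    zero_lt_one.trans_le (MittagLeffler.one_le_modeConst hα₀ hα₁), fun Ω hΩ hb hne =>
    ⟨exists_isEigensystem hΩ hb hne, fun φ μ hφ u₀ u hu => ?_⟩⟩
  have hμ := hφ.pos
  refine ⟨flow φ μ α u₀, flow' φ μ α u₀, flow'' φ μ α u₀, flowCaputo φ μ α u₀,
    fun t ht => hu.eq_flow hα₀ hα₁ hT hΩ hb hφ ht,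
    fun t ht => (hasDerivAt_flow hα₀ hα₁ hμ u₀ ht.1).hasDerivWithinAt,
    fun t ht => (hasDerivAt_flow' hα₀ hα₁ hμ u₀ ht.1).hasDerivWithinAt,
    fun t ht => ⟨hu.intervalIntegrable_caputo hα₀ hα₁ hΩ hb hφ ht,
      hu.caputo_eq hα₀ hα₁ hΩ hb hφ ht⟩,
    ⟨fun t ht p hp => ⟨normPow_flow_le hα₀ hα₁ hμ u₀ ht.1 hp,
        normPow_flow'_le hα₀ hα₁ hμ u₀ ht.1 hp⟩,
      fun t ht => norm_flow''_le hα₀ hα₁ hμ u₀ ht.1,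
      fun t ht => norm_flowCaputo_le hα₀ hα₁ hμ u₀ ht.1,
      (continuousOn_flow hα₀ hα₁ hμ u₀).mono Icc_subset_Ici_self,
      fun t ht => norm_flow_le hα₀ hα₁ hμ u₀ ht.1⟩, fun hu₀ => ?_⟩
  obtain ⟨g, hg⟩ := hu₀
  have hs : Summable fun k => (μ k * ⟪φ k, u₀⟫) ^ 2 := by
    simpa only [hφ.inner_of_isA hg] using (hasSum_inner_sq φ g).summable
  exact ⟨fun t ht => normPow_one_flow_le hα₀ hα₁ hμ hs ht.1,
    fun t ht p hp => normPow_flow'_le_smooth hα₀ hα₁ hμ hs ht.1 hp,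
    fun t ht => norm_flow''_le_smooth hα₀ hα₁ hμ hs ht.1,
    fun t ht => norm_flowCaputo_le_smooth hα₀ hα₁ hμ hs ht.1,
    fun t₀ ht₀ => (tendsto_normPow_one_flow_sub hα₀ hα₁ hμ hs ht₀.1).mono_left
      (nhdsWithin_mono t₀ Icc_subset_Ici_self)⟩
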